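/- **Setting.** Let $(\mathcal X,d)$ be a metric space with a Borel measure $\mu$ for which all (open) balls have positive and finite measure, and suppose there are $C_1>1$ and $n>0$ with $$\mu(B(x,\lambda r))\le C_1\lambda^n\mu(B(x,r))\qquad\text{for all }x\in\mathcal X,\ r>0,\ \lambda>1 .$$ Write ⨍ for averages, $u_B=$ ⨍$_B\,u\,d\mu$, and let $u\in L^r_{\rm loc}(\mathcal X)$ mean that $u\in L^r(B)$ for every ball $B$. Functions are real-valued and measurable. For $s\in(0,\infty)$ and $p\in(0,\infty]$ put $p_*(s)=np/(n-ps)$ if $p<n/s$ and $p_*(s)=\infty$ if $p\ge n/s$. For $p,q\in(0,\infty]$ the homogeneous Besov space $\dot B^s_{p,q}(\mathcal X)$ consists of all $u\in L^p_{\rm loc}(\mathcal X)$ with $$\|u\|_{\dot B^s_{p,q}(\mathcal X)}=\Big(\int_0^\infty\Big(\int_{\mathcal X}\frac1{\mu(B(x,t))}\int_{B(x,t)}|u(x)-u(y)|^p\,d\mu(y)\,d\mu(x)\Big)^{q/p}\frac{dt}{t^{1+sq}}\Big)^{1/q}<\infty,$$ with the usual modification (suprema) when $p=\infty$ or $q=\infty$.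 For $\sigma\in(0,\infty)$, $\epsilon\in[0,s]$, $t>0$ and $x\in\mathcal X$ let, with $B=B(x,t)$, $$C^{s,\sigma}_t(u)(x)=t^{-s}\Big(\frac1{\mu(B)}\int_{B}|u(x)-u(y)|^\sigma d\mu(y)\Big)^{1/\sigma},\qquad A^{s,\sigma}_t(u)(x)=t^{-s}\Big(\frac1{\mu(B)}\int_{B}|u(y)-u_{B}|^\sigma d\mu(y)\Big)^{1/\sigma},$$ $$I^{s,\sigma}_t(u)(x)=t^{-s}\Big(\inf_{c\in\mathbb R}\frac1{\mu(B)}\int_{B}|u(y)-c|^\sigma d\mu(y)\Big)^{1/\sigma},\qquad S^{s,\epsilon,\sigma}_t(u)(x)=t^{\epsilon-s}\sup_{r\in(0,t]}r^{-\epsilon}\Big(\inf_{c\in\mathbb R}\frac1{\mu(B(x,r))}\int_{B(x,r)}|u(y)-c|^\sigma d\mu(y)\Big)^{1/\sigma}.$$ For $E$ equal to $C^{s,\sigma}$, $A^{s,\sigma}$, $I^{s,\sigma}$ or $S^{s,\epsilon,\sigma}$, let $\vec E\dot B_{p,q}(\mathcal X)$ be the set of all $u\in L^\sigma_{\rm loc}(\mathcal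 X)$ (for $A^{s,\sigma}$ also $u\in L^1_{\rm loc}(\mathcal X)$, so that the averages $u_B$ are defined) with $$\|u\|_{\vec E\dot B_{p,q}(\mathcal X)}=\Big(\int_0^\infty\|E_t(u)\|_{L^p(\mathcal X)}^q\,\frac{dt}t\Big)^{1/q}<\infty,$$ with a supremum over $t>0$ when $q=\infty$. Equality of two such spaces means that they consist of the same functions and that each norm is bounded by a constant, independent of the function, times the other. **Theorem 1.1.** Let $s\in(0,\infty)$ and $p,q\in(0,\infty]$; in (i)–(iv), $\sigma\in(0,\infty)$. (i) If $\sigma\le p$, then $\dot B^s_{p,q}(\mathcal X)=\vec C^{s,\sigma}\dot B_{p,q}(\mathcal X)$. (ii) If $\sigma<p_*(s)$, then $\dot B^s_{p,q}(\mathcal X)=\vec I^{s,\sigma}\dot B_{p,q}(\mathcal X)$. (iii) If $\epsilon\in[0,s)$ and $\sigma<p_*(s)$, then $\dot B^s_{p,q}(\mathcal X)=\vec S^{s,\epsilon,\sigma}\dot B_{p,q}(\mathcal X)$. (iv) If $p\in(n/(n+s),\infty]$ and $\sigma<p_*(s)$, then $\dot B^s_{p,q}(\mathcal X)=\vec A^{s,\sigma}\dot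 B_{p,q}(\mathcal X)$. Moreover, on $\mathbb R^n$, $n\ge1$, with the Euclidean distance and Lebesgue measure, the ranges of $\sigma$ and $\epsilon$ are optimal in the following sense. (v) Let $s\in(0,1)$, $p\in(0,n/s)$ and $\sigma\in(p_*(s),\infty)$. Then there is a function $u$ such that for all $q\in(0,\infty]$, $u\in\dot B^s_{p,q}(\mathbb R^n)$ but $u\notin L^\sigma_{\rm loc}(\mathbb R^n)$, and hence $u\notin\vec E\dot B_{p,q}(\mathbb R^n)$ for $\vec E=\vec A^{s,\sigma}$, $\vec I^{s,\sigma}$ and $\vec S^{s,\epsilon,\sigma}$ with any $\epsilon\in[0,s]$. (vi) Let $p\in(0,\infty)$, $\sigma\in(p,\infty)$ and $s\in(0,n/p-n/\sigma)\cap(0,1)$. Then there is a function $u$ such that for all $q\in(0,\infty]$, $u\in\dot B^s_{p,q}(\mathbb R^n)$ but $u\notin\vec C^{s,\sigma}\dot B_{p,q}(\mathbb R^n)$. (vii) Let $s\in(0,1)$ and $p\in(0,\infty)$. Then there is a function $u\in\dot B^s_{p,p}(\mathbb R^n)$ with $u\notin\vec S^{s,s,p}\dot B_{p,p}(\mathbb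 R^n)$. -/

import Mathlib

open MeasureTheory Set Metric
open scoped ENNReal

noncomputable section

namespace BesovMMS

/-- Standing assumptions on a metric space with a Borel measure: all balls have positive and finite
measure, and `μ` is doubling with constant `C₁` and exponent `n`. -/
structure IsDoubling {X : Type*} [MetricSpace X] [MeasurableSpace X] (μ : Measure X)
    (C₁ n : ℝ) : Prop where
  one_lt : 1 < C₁
  exponent_pos : 0 < n
  ball_pos : ∀ (x : X) (r : ℝ), 0 < r → 0 < μ (ball x r)
  ball_lt_top : ∀ (x : X) (r : ℝ), 0 < r → μ (ball x r) < ∞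
  doubling : ∀ (x : X) (r lam : ℝ), 0 < r → 1 < lam →
    μ (ball x (lam * r)) ≤ ENNReal.ofReal (C₁ * lam ^ n) * μ (ball x r)

/-- `p_*(s)`, equal to `n p / (n - p s)` if `p < n / s` and to `∞` otherwise. -/
def pStar (n s : ℝ) (p : ℝ≥0∞) : ℝ≥0∞ :=
  if p < ENNReal.ofReal (n / s) then ENNReal.ofReal (n * p.toReal / (n - p.toReal * s)) else ∞

/-- A collection of real functions on `X` together with its (quasi-)seminorm. -/
structure FunctionSpace (X : Type*) where
  carrier : Set (X → ℝ)
  seminorm : (X → ℝ) → ℝ≥0∞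

/-- `A ⊂ B` as function spaces: an inclusion of sets with a bound for the seminorms. -/
def FunctionSpace.Embeds {X : Type*} (A B : FunctionSpace X) : Prop :=
  ∃ K : ℝ, 0 < K ∧ ∀ u ∈ A.carrier, u ∈ B.carrier ∧ B.seminorm u ≤ ENNReal.ofReal K * A.seminorm u

/-- `A = B` as function spaces: the same functions, with equivalent seminorms. -/
def FunctionSpace.Equivalent {X : Type*} (A B : FunctionSpace X) : Prop :=
  A.Embeds B ∧ B.Embeds A

variable {X : Type*} [MetricSpace X] [MeasurableSpace X]

/-- `u ∈ L^p_loc`, that is, `u ∈ L^p(B)` for each ball `B`. -/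
def MemLpLoc (u : X → ℝ) (p : ℝ≥0∞) (μ : Measure X) : Prop :=
  ∀ (x : X) (r : ℝ), 0 < r → MemLp u p (μ.restrict (ball x r))

/-- The `L^p` size of the differences of `u` at distance less than `t`:
`(∫ ⨍_{B(x,t)} |u(x) - u(y)|^p dμ(y) dμ(x))^{1/p}`, with essential suprema when `p = ∞`. -/
def differenceModulus (u : X → ℝ) (p : ℝ≥0∞) (μ : Measure X) (t : ℝ) : ℝ≥0∞ :=
  if p = ∞ then
    essSup (fun x => essSup (fun y => ‖u x - u y‖ₑ) (μ.restrict (ball x t))) μ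
  else
    (∫⁻ x, ⨍⁻ y in ball x t, ‖u x - u y‖ₑ ^ p.toReal ∂μ ∂μ) ^ (1 / p.toReal)

/-- The seminorm of the homogeneous Besov space. -/
def besovNorm (s : ℝ) (p q : ℝ≥0∞) (μ : Measure X) (u : X → ℝ) : ℝ≥0∞ :=
  if q = ∞ then
    ⨆ t ∈ Ioi (0 : ℝ), ENNReal.ofReal (t ^ (-s)) * differenceModulus u p μ t
  else
    (∫⁻ t in Ioi (0 : ℝ), differenceModulus u p μ t ^ q.toReal *
      ENNReal.ofReal (t ^ (-(1 + s * q.toReal)))) ^ (1 / q.toReal)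

/-- The homogeneous Besov space. -/
def besovSpace (s : ℝ) (p q : ℝ≥0∞) (μ : Measure X) : FunctionSpace X where
  carrier := {u | MemLpLoc u p μ ∧ besovNorm s p q μ u < ∞}
  seminorm := besovNorm s p q μ

/-- `inf_c ⨍_{B(x,t)} |u(y) - c|^σ dμ(y)`. -/
def bestConst (σ : ℝ) (μ : Measure X) (u : X → ℝ) (t : ℝ) (x : X) : ℝ≥0∞ :=
  ⨅ c : ℝ, ⨍⁻ y in ball x t, ‖u y - c‖ₑ ^ σ ∂μ

/-- The functional `C^{s,σ}_t(u)(x)`. -/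
def functionalC (s σ : ℝ) (μ : Measure X) (u : X → ℝ) (t : ℝ) (x : X) : ℝ≥0∞ :=
  ENNReal.ofReal (t ^ (-s)) * (⨍⁻ y in ball x t, ‖u x - u y‖ₑ ^ σ ∂μ) ^ (1 / σ)

/-- The functional `A^{s,σ}_t(u)(x)`. -/
def functionalA (s σ : ℝ) (μ : Measure X) (u : X → ℝ) (t : ℝ) (x : X) : ℝ≥0∞ :=
  ENNReal.ofReal (t ^ (-s)) *
    (⨍⁻ y in ball x t, ‖u y - ⨍ z in ball x t, u z ∂μ‖ₑ ^ σ ∂μ) ^ (1 / σ)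

/-- The functional `I^{s,σ}_t(u)(x)`. -/
def functionalI (s σ : ℝ) (μ : Measure X) (u : X → ℝ) (t : ℝ) (x : X) : ℝ≥0∞ :=
  ENNReal.ofReal (t ^ (-s)) * bestConst σ μ u t x ^ (1 / σ)

/-- The functional `S^{s,ε,σ}_t(u)(x)`. -/
def functionalS (s ε σ : ℝ) (μ : Measure X) (u : X → ℝ) (t : ℝ) (x : X) : ℝ≥0∞ :=
  ENNReal.ofReal (t ^ (ε - s)) *
    ⨆ r ∈ Ioc (0 : ℝ) t, ENNReal.ofReal (r ^ (-ε)) * bestConst σ μ u r x ^ (1 / σ)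

/-- `(∫_0^∞ ‖E(·,t)‖_{L^p}^q dt/t)^{1/q}`, with a supremum over `t` when `q = ∞`. -/
def besovTypeNorm (p q : ℝ≥0∞) (μ : Measure X) (E : ℝ → X → ℝ≥0∞) : ℝ≥0∞ :=
  if q = ∞ then
    ⨆ t ∈ Ioi (0 : ℝ), eLpNorm (E t) p μ
  else
    (∫⁻ t in Ioi (0 : ℝ), eLpNorm (E t) p μ ^ q.toReal * ENNReal.ofReal t⁻¹) ^ (1 / q.toReal)

/-- The space of Besov type given by pointwise differences. -/
def spaceC (s σ : ℝ) (p q : ℝ≥0∞) (μ : Measure X) : FunctionSpace X where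
  carrier := {u | MemLpLoc u (ENNReal.ofReal σ) μ ∧ besovTypeNorm p q μ (functionalC s σ μ u) < ∞}
  seminorm := fun u => besovTypeNorm p q μ (functionalC s σ μ u)

/-- The space of Besov type given by mean oscillations. Local integrability, which for `1 ≤ σ`
follows from the first condition, is what gives the averages of `u` a meaning. -/
def spaceA (s σ : ℝ) (p q : ℝ≥0∞) (μ : Measure X) : FunctionSpace X where
  carrier := {u | MemLpLoc u (ENNReal.ofReal σ) μ ∧ MemLpLoc u 1 μ ∧
    besovTypeNorm p q μ (functionalA s σ μ u) < ∞}
  seminorm := fun u => besovTypeNorm p q μ (functionalA s σ μ u)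

/-- The space of Besov type given by best-constant oscillations. -/
def spaceI (s σ : ℝ) (p q : ℝ≥0∞) (μ : Measure X) : FunctionSpace X where
  carrier := {u | MemLpLoc u (ENNReal.ofReal σ) μ ∧ besovTypeNorm p q μ (functionalI s σ μ u) < ∞}
  seminorm := fun u => besovTypeNorm p q μ (functionalI s σ μ u)

/-- The space of Besov type given by the suprema of oscillations over smaller radii. -/
def spaceS (s ε σ : ℝ) (p q : ℝ≥0∞) (μ : Measure X) : FunctionSpace X where
  carrier := {u | MemLpLoc u (ENNReal.ofReal σ) μ ∧
    besovTypeNorm p q μ (functionalS s ε σ μ u) < ∞}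
  seminorm := fun u => besovTypeNorm p q μ (functionalS s ε σ μ u)

end BesovMMS

end

open BesovMMS

/-!
All spaces are compared with the seminorm built on the double oscillations
`⨍_B ⨍_B |u(y) - u(z)|^σ`. For `σ ≤ 1`, when `|a - b|^σ` is a metric on `ℝ`, telescoping along the
balls `B(x, t / 2^j)` and Lebesgue's differentiation theorem bound `|u(x) - u(y)|^σ` by a sum of
oscillations over smaller scales, and a discrete Hardy inequality in the scale sums these up. By
doubling, an oscillation over a ball of radius `t / 2^j` inside `B(x, t)` is at most a constant
times `2^(jn)` times the mean over a slightly larger ball of the oscillations at a comparable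
scale; this raises the exponent of the oscillations from a small one to any `σ < p_*(s)`, as in a
Sobolev inequality.

For optimality, `max (|x|^(-n/σ) - 1) 0` is not in `L^σ_loc`, while it has a Hajłasz gradient in
`L^p` of an order slightly above `s` when `n/σ < n/p - s`. The cone `max (1 - |x|) 0` has
`S^{s,s}_t` bounded away from zero in `L^p` for all large `t`, so that the integral in `dt/t`
diverges.
-/

namespace BesovMMS

open Filter Topology
open scoped NNReal

section LowerAverages

variable {α : Type*} [MeasurableSpace α] {ν : Measure α} {f g : α → ℝ≥0∞}

theorem laverage_mono (h : ∀ x, f x ≤ g x) : ⨍⁻ x, f x ∂ν ≤ ⨍⁻ x, g x ∂ν :=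
  lintegral_mono h

theorem setLAverage_mono_on {s : Set α} (hs : MeasurableSet s) (h : ∀ x ∈ s, f x ≤ g x) :
    ⨍⁻ x in s, f x ∂ν ≤ ⨍⁻ x in s, g x ∂ν :=
  laverage_mono_ae (ae_restrict_of_forall_mem hs h)

theorem laverage_const_mul {K : ℝ≥0∞} (hK : K ≠ ∞) :
    ⨍⁻ x, K * f x ∂ν = K * ⨍⁻ x, f x ∂ν :=
  lintegral_const_mul' _ _ hK

theorem laverage_mul_const (hf : Measurable f) (c : ℝ≥0∞) :
    ⨍⁻ x, f x * c ∂ν = (⨍⁻ x, f x ∂ν) * c :=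
  lintegral_mul_const _ hf

theorem laverage_add_left (hf : Measurable f) :
    ⨍⁻ x, (f x + g x) ∂ν = ⨍⁻ x, f x ∂ν + ⨍⁻ x, g x ∂ν :=
  lintegral_add_left hf _

end LowerAverages

section EnormRpow

variable {σ : ℝ}

theorem enorm_sub_rpow_le_two_rpow_mul (hσ : 0 ≤ σ) (a b c : ℝ) :
    ‖a - b‖ₑ ^ σ ≤ 2 ^ σ * (‖a - c‖ₑ ^ σ + ‖b - c‖ₑ ^ σ) := by
  refine le_trans ?_ (ENNReal.add_rpow_le_two_rpow_mul_rpow_add_rpow _ _ hσ)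
  rw [enorm_sub_rev b c, ← sub_add_sub_cancel a c b]
  gcongr
  exact enorm_add_le _ _

theorem enorm_sub_rpow_le_add (h0 : 0 ≤ σ) (h1 : σ ≤ 1) (a b c : ℝ) :
    ‖a - b‖ₑ ^ σ ≤ ‖a - c‖ₑ ^ σ + ‖b - c‖ₑ ^ σ := by
  refine le_trans ?_ (ENNReal.rpow_add_le_add_rpow _ _ h0 h1)
  rw [enorm_sub_rev b c, ← sub_add_sub_cancel a c b]
  gcongr
  exact enorm_add_le _ _

theorem ofReal_abs_rpow (hσ : 0 ≤ σ) (a : ℝ) : ENNReal.ofReal (|a| ^ σ) = ‖a‖ₑ ^ σ := by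
  rw [← ENNReal.ofReal_rpow_of_nonneg (abs_nonneg a) hσ, ← Real.norm_eq_abs, ofReal_norm]

theorem two_rpow_ne_top (e : ℝ) : (2 : ℝ≥0∞) ^ e ≠ ∞ :=
  ENNReal.rpow_ne_top_of_ne_zero two_ne_zero ENNReal.ofNat_ne_top

theorem two_rpow_add (a b : ℝ) : (2 : ℝ≥0∞) ^ (a + b) = 2 ^ a * 2 ^ b :=
  ENNReal.rpow_add a b two_ne_zero ENNReal.ofNat_ne_top

theorem two_rpow_eq_ofReal (e : ℝ) : (2 : ℝ≥0∞) ^ e = ENNReal.ofReal (2 ^ e) := by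
  rw [← ENNReal.ofReal_rpow_of_pos two_pos, ENNReal.ofReal_ofNat]

end EnormRpow

section Doubling

variable {X : Type*} [MetricSpace X] [MeasurableSpace X] {μ : Measure X} {C₁ n : ℝ}

theorem exists_isSeparated_isCover_univ (X : Type*) [PseudoEMetricSpace X] (ε : ℝ≥0) :
    ∃ N : Set X, IsSeparated ε N ∧ IsCover ε univ N := by
  obtain ⟨N, hN⟩ := zorn_subset {N : Set X | N ⊆ univ ∧ IsSeparated ε N} fun c hc hchain =>
    ⟨⋃₀ c, ⟨subset_univ _, (pairwise_sUnion hchain.directedOn).2 fun s hs => (hc hs).2⟩,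
      fun s hs => subset_sUnion_of_mem hs⟩
  exact ⟨N, hN.prop.2, .of_maximal_isSeparated hN⟩

/-- The factor by which averages of a nonnegative function over comparable balls may differ, when
the ratio of the radii is at most `lam`. -/
noncomputable def doublingFactor (C₁ n lam : ℝ) : ℝ≥0∞ := ENNReal.ofReal (C₁ * lam ^ n)

theorem doublingFactor_ne_top (C₁ n lam : ℝ) : doublingFactor C₁ n lam ≠ ∞ :=
  ENNReal.ofReal_ne_top

namespace IsDoubling

theorem ball_ne_zero (hμ : IsDoubling μ C₁ n) (x : X) {r : ℝ} (hr : 0 < r) : μ (ball x r) ≠ 0 :=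
  (hμ.ball_pos x r hr).ne'

theorem ball_ne_top (hμ : IsDoubling μ C₁ n) (x : X) {r : ℝ} (hr : 0 < r) : μ (ball x r) ≠ ∞ :=
  (hμ.ball_lt_top x r hr).ne

theorem sigmaFinite (hμ : IsDoubling μ C₁ n) : SigmaFinite μ := by
  rcases isEmpty_or_nonempty X with _ | ⟨⟨x⟩⟩
  · rw [Measure.eq_zero_of_isEmpty μ]
    infer_instance
  · exact ⟨⟨⟨fun k => ball x (k + 1), fun _ => trivial,
      fun k => hμ.ball_lt_top x _ (by positivity), iUnion_ball_nat_succ x⟩⟩⟩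

theorem countable_of_isSeparated [OpensMeasurableSpace X] (hμ : IsDoubling μ C₁ n) {ε : ℝ≥0}
    (hε : 0 < ε) {N : Set X} (hN : IsSeparated ε N) : N.Countable := by
  have := hμ.sigmaFinite
  have hdisj : Pairwise (Function.onFun Disjoint fun i : N => ball (i : X) (ε / 2)) := by
    refine fun i j hij => ball_disjoint_ball ?_
    have : (ε : ℝ≥0∞) < edist (i : X) j := hN i.2 j.2 (Subtype.coe_injective.ne hij)
    rw [edist_nndist, ENNReal.coe_lt_coe] at this
    rw [add_halves]
    exact_mod_cast this.le
  have hcount := Measure.countable_meas_pos_of_disjoint_iUnion (μ := μ)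
    (fun i : N => measurableSet_ball (x := (i : X)) (ε := ε / 2)) hdisj
  have huniv : {i : N | 0 < μ (ball (i : X) (ε / 2))} = univ :=
    eq_univ_of_forall fun i => hμ.ball_pos _ _ (by positivity)
  rw [huniv, countable_univ_iff] at hcount
  exact countable_coe_iff.1 hcount

theorem secondCountableTopology [OpensMeasurableSpace X] (hμ : IsDoubling μ C₁ n) :
    SecondCountableTopology X := by
  refine Metric.secondCountable_of_almost_dense_set fun ε hε => ?_
  lift ε to ℝ≥0 using hε.le
  obtain ⟨N, hsep, hcov⟩ := exists_isSeparated_isCover_univ X ε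
  refine ⟨N, hμ.countable_of_isSeparated (by exact_mod_cast hε) hsep, fun x => ?_⟩
  obtain ⟨y, hy, hxy⟩ := hcov (mem_univ x)
  exact ⟨y, hy, edist_le_coe.1 hxy⟩

theorem isLocallyFiniteMeasure (hμ : IsDoubling μ C₁ n) : IsLocallyFiniteMeasure μ :=
  ⟨fun x => ⟨ball x 1, ball_mem_nhds x one_pos, hμ.ball_lt_top x 1 one_pos⟩⟩

theorem isUnifLocDoublingMeasure (hμ : IsDoubling μ C₁ n) : IsUnifLocDoublingMeasure μ := by
  refine ⟨(C₁ * 3 ^ n).toNNReal, ?_⟩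
  filter_upwards [self_mem_nhdsWithin] with r (hr : 0 < r) x
  calc μ (closedBall x (2 * r)) ≤ μ (ball x (3 * r)) :=
        measure_mono (closedBall_subset_ball (by linarith))
    _ ≤ ENNReal.ofReal (C₁ * 3 ^ n) * μ (ball x r) := hμ.doubling x r 3 hr (by norm_num)
    _ ≤ ENNReal.ofReal (C₁ * 3 ^ n) * μ (closedBall x r) := by
        gcongr
        exact ball_subset_closedBall

theorem laverage_ball_const (hμ : IsDoubling μ C₁ n) (x : X) {r : ℝ} (hr : 0 < r) (c : ℝ≥0∞) :
    ⨍⁻ _ in ball x r, c ∂μ = c :=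
  setLAverage_const (hμ.ball_ne_zero x hr) (hμ.ball_ne_top x hr) c

theorem laverage_ball_le (hμ : IsDoubling μ C₁ n) {x : X} {r lam : ℝ} {s : Set X}
    (hr : 0 < r) (hlam : 1 < lam) (hrs : ball x r ⊆ s) (hsr : s ⊆ ball x (lam * r))
    (f : X → ℝ≥0∞) :
    ⨍⁻ z in ball x r, f z ∂μ ≤ doublingFactor C₁ n lam * ⨍⁻ z in s, f z ∂μ := by
  have hs : μ s ≤ doublingFactor C₁ n lam * μ (ball x r) :=
    (measure_mono hsr).trans (hμ.doubling x r lam hr hlam)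
  have hs0 : μ s ≠ 0 := fun h => hμ.ball_ne_zero x hr (measure_mono_null hrs h)
  have hst : μ s ≠ ∞ := ne_top_of_le_ne_top
    (hμ.ball_ne_top x (mul_pos (one_pos.trans hlam) hr)) (measure_mono hsr)
  rw [setLAverage_eq, setLAverage_eq, ENNReal.div_eq_inv_mul, ENNReal.div_eq_inv_mul, ← mul_assoc]
  gcongr
  rw [← div_eq_mul_inv, ENNReal.le_div_iff_mul_le (.inl hs0) (.inl hst), ← ENNReal.div_eq_inv_mul]
  exact ENNReal.div_le_of_le_mul hs

theorem ae_tendsto_laverage_closedBall [BorelSpace X] (hμ : IsDoubling μ C₁ n) {g : X → ℝ}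
    (hg : LocallyIntegrable g μ) (hg0 : ∀ x, 0 ≤ g x) :
    ∀ᵐ x ∂μ, Tendsto (fun r => ⨍⁻ y in closedBall x r, ENNReal.ofReal (g y) ∂μ) (𝓝[>] 0)
      (𝓝 (ENNReal.ofReal (g x))) := by
  have := hμ.secondCountableTopology
  have := hμ.isLocallyFiniteMeasure
  have := hμ.isUnifLocDoublingMeasure
  filter_upwards [IsUnifLocDoublingMeasure.ae_tendsto_average μ hg 1] with x hx
  have hlim : Tendsto (fun r => ⨍ y in closedBall x r, g y ∂μ) (𝓝[>] 0) (𝓝 (g x)) := by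
    refine hx (fun _ => x) id tendsto_id ?_
    filter_upwards [self_mem_nhdsWithin] with r (hr : 0 < r)
    exact mem_closedBall_self (by simpa using hr.le)
  obtain ⟨s, hs, hint⟩ := hg x
  obtain ⟨ρ, hρ, hρs⟩ := nhds_basis_closedBall.mem_iff.1 hs
  refine ((ENNReal.continuous_ofReal.tendsto _).comp hlim).congr' ?_
  filter_upwards [Ioc_mem_nhdsGT hρ] with r hr
  have hrs : closedBall x r ⊆ s := (closedBall_subset_closedBall hr.2).trans hρs
  rw [Function.comp_apply, ofReal_setAverage (hint.mono_set hrs) (.of_forall hg0), setLAverage_eq]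

end IsDoubling

end Doubling

section Measurability

variable {X : Type*} [MetricSpace X] [MeasurableSpace X] [BorelSpace X]
  [SecondCountableTopology X] {μ : Measure X} [SFinite μ]
  {α : Type*} [MeasurableSpace α] {c : α → X} {r : α → ℝ} {f : α → X → ℝ≥0∞}

theorem measurable_setLIntegral_ball (hc : Measurable c) (hr : Measurable r)
    (hf : Measurable (Function.uncurry f)) :
    Measurable fun a => ∫⁻ y in ball (c a) (r a), f a y ∂μ := by
  have hset : MeasurableSet {z : α × X | dist z.2 (c z.1) < r z.1} :=
    measurableSet_lt (by fun_prop) (by fun_prop)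
  simp_rw [← lintegral_indicator measurableSet_ball]
  exact (hf.indicator hset).lintegral_prod_right'

theorem measurable_laverage_ball (hc : Measurable c) (hr : Measurable r)
    (hf : Measurable (Function.uncurry f)) :
    Measurable fun a => ⨍⁻ y in ball (c a) (r a), f a y ∂μ := by
  have hball : Measurable fun a => μ (ball (c a) (r a)) := by
    simpa using measurable_setLIntegral_ball (μ := μ) hc hr (f := fun _ _ => 1) measurable_const
  simp only [setLAverage_eq]
  exact (measurable_setLIntegral_ball hc hr hf).div hball

end Measurability

section Series

theorem tsum_two_rpow_ne_top {δ : ℝ} (hδ : 0 < δ) : ∑' j : ℕ, (2 : ℝ≥0∞) ^ (-(δ * j)) ≠ ∞ := by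
  have hpow (j : ℕ) : (2 : ℝ≥0∞) ^ (-(δ * j)) = ((2 : ℝ≥0∞) ^ (-δ)) ^ j := by
    rw [← ENNReal.rpow_natCast, ← ENNReal.rpow_mul, neg_mul]
  simp only [hpow, ENNReal.tsum_geometric]
  refine ENNReal.inv_ne_top.2 (tsub_pos_of_lt ?_).ne'
  exact ENNReal.rpow_lt_one_of_one_lt_of_neg ENNReal.one_lt_two (by linarith)

theorem exists_tsum_rpow_le {a δ : ℝ} (ha : 0 < a) (hδ : 0 < δ) :
    ∃ K : ℝ≥0∞, K ≠ ∞ ∧ ∀ f : ℕ → ℝ≥0∞, (∑' j, f j) ^ a ≤ K * ∑' j : ℕ, 2 ^ (δ * j) * f j ^ a := by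
  refine ⟨(∑' j : ℕ, (2 : ℝ≥0∞) ^ (-(δ / a * j))) ^ a,
    ENNReal.rpow_ne_top_of_nonneg ha.le (tsum_two_rpow_ne_top (by positivity)), fun f => ?_⟩
  set S := ∑' j : ℕ, (2 : ℝ≥0∞) ^ (δ * j) * f j ^ a
  have hterm (j : ℕ) : f j ≤ 2 ^ (-(δ / a * j)) * S ^ (1 / a) := by
    calc f j = 2 ^ (-(δ / a * j)) * (2 ^ (δ * j) * f j ^ a) ^ (1 / a) := by
          rw [ENNReal.mul_rpow_of_nonneg _ _ (by positivity), ← ENNReal.rpow_mul,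
            ← ENNReal.rpow_mul, mul_one_div_cancel ha.ne', ENNReal.rpow_one, ← mul_assoc,
            ← two_rpow_add, show -(δ / a * j) + δ * j * (1 / a) = 0 by ring, ENNReal.rpow_zero,
            one_mul]
      _ ≤ 2 ^ (-(δ / a * j)) * S ^ (1 / a) := by
          gcongr
          exact ENNReal.le_tsum j
  calc (∑' j, f j) ^ a ≤ (∑' j : ℕ, 2 ^ (-(δ / a * j)) * S ^ (1 / a)) ^ a := by
        gcongr
        exact hterm _
    _ = (∑' j : ℕ, (2 : ℝ≥0∞) ^ (-(δ / a * j))) ^ a * S := by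
        rw [ENNReal.tsum_mul_right, ENNReal.mul_rpow_of_nonneg _ _ ha.le, ← ENNReal.rpow_mul,
          one_div_mul_cancel ha.ne', ENNReal.rpow_one]

end Series

section Oscillation

variable {X : Type*} [MetricSpace X] [MeasurableSpace X]

/-- The `σ`-oscillation of `u` about its value at `x`: the average of `|u(x) - u(y)|^σ` over
`y ∈ B(x,r)`. -/
noncomputable def pointOsc (σ : ℝ) (μ : Measure X) (u : X → ℝ) (x : X) (r : ℝ) : ℝ≥0∞ :=
  ⨍⁻ y in ball x r, ‖u x - u y‖ₑ ^ σ ∂μ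

/-- The `σ`-oscillation of `u` on `B(x,r)`: the average of `|u(y) - u(z)|^σ` over `y, z ∈ B(x,r)`.
Unlike `bestConst`, to which it is comparable, it is jointly measurable in `(x, r)`. -/
noncomputable def doubleOsc (σ : ℝ) (μ : Measure X) (u : X → ℝ) (x : X) (r : ℝ) : ℝ≥0∞ :=
  ⨍⁻ y in ball x r, ⨍⁻ z in ball x r, ‖u y - u z‖ₑ ^ σ ∂μ ∂μ

variable {μ : Measure X} {C₁ n : ℝ} {u : X → ℝ} {σ : ℝ}

section

variable [BorelSpace X] [SecondCountableTopology X] [SFinite μ]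

theorem measurable_pointOsc (hu : Measurable u) (σ : ℝ) :
    Measurable fun q : X × ℝ => pointOsc σ μ u q.1 q.2 :=
  measurable_laverage_ball measurable_fst measurable_snd (by fun_prop)

theorem measurable_doubleOsc (hu : Measurable u) (σ : ℝ) :
    Measurable fun q : X × ℝ => doubleOsc σ μ u q.1 q.2 :=
  measurable_laverage_ball
    (f := fun (q : X × ℝ) y => ⨍⁻ z in ball q.1 q.2, ‖u y - u z‖ₑ ^ σ ∂μ)
    measurable_fst measurable_snd <|
    measurable_laverage_ball (c := fun q : (X × ℝ) × X => q.1.1) (r := fun q => q.1.2)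
      (f := fun q z => ‖u q.2 - u z‖ₑ ^ σ) (by fun_prop) (by fun_prop) (by fun_prop)

theorem measurable_pointOsc_rpow (hu : Measurable u) (σ r e : ℝ) :
    Measurable fun x => pointOsc σ μ u x r ^ e :=
  ((measurable_pointOsc hu σ).comp (measurable_id.prodMk measurable_const)).pow_const _

theorem measurable_doubleOsc_rpow (hu : Measurable u) (σ r e : ℝ) :
    Measurable fun x => doubleOsc σ μ u x r ^ e :=
  ((measurable_doubleOsc hu σ).comp (measurable_id.prodMk measurable_const)).pow_const _

end

theorem bestConst_le_pointOsc (σ : ℝ) (u : X → ℝ) (x : X) (r : ℝ) :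
    bestConst σ μ u r x ≤ pointOsc σ μ u x r := by
  refine (iInf_le _ (u x)).trans (le_of_eq ?_)
  simp only [pointOsc, enorm_sub_rev]

namespace IsDoubling

theorem bestConst_le_doubleOsc (hμ : IsDoubling μ C₁ n) (σ : ℝ) (u : X → ℝ) (x : X)
    {r : ℝ} (hr : 0 < r) : bestConst σ μ u r x ≤ doubleOsc σ μ u x r := by
  rw [← hμ.laverage_ball_const x hr (bestConst σ μ u r x)]
  refine laverage_mono fun y => (iInf_le _ (u y)).trans (le_of_eq ?_)
  simp only [enorm_sub_rev]

theorem laverage_enorm_sub_rpow_le (hμ : IsDoubling μ C₁ n) (hσ : 0 ≤ σ) (u : X → ℝ) (x : X)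
    {r : ℝ} (hr : 0 < r) (a c : ℝ) :
    ⨍⁻ y in ball x r, ‖a - u y‖ₑ ^ σ ∂μ ≤
      2 ^ σ * (‖a - c‖ₑ ^ σ + ⨍⁻ y in ball x r, ‖u y - c‖ₑ ^ σ ∂μ) := by
  calc ⨍⁻ y in ball x r, ‖a - u y‖ₑ ^ σ ∂μ
      ≤ ⨍⁻ y in ball x r, 2 ^ σ * (‖a - c‖ₑ ^ σ + ‖u y - c‖ₑ ^ σ) ∂μ :=
        laverage_mono fun y => enorm_sub_rpow_le_two_rpow_mul hσ _ _ _
    _ = 2 ^ σ * (‖a - c‖ₑ ^ σ + ⨍⁻ y in ball x r, ‖u y - c‖ₑ ^ σ ∂μ) := by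
        rw [laverage_const_mul (two_rpow_ne_top _), laverage_add_left measurable_const,
          hμ.laverage_ball_const x hr]

theorem doubleOsc_le_bestConst (hμ : IsDoubling μ C₁ n) (hσ : 0 ≤ σ)
    (hu : Measurable u) (x : X) {r : ℝ} (hr : 0 < r) :
    doubleOsc σ μ u x r ≤ 2 ^ (σ + 1) * bestConst σ μ u r x := by
  rw [bestConst, ENNReal.mul_iInf_of_ne (by simp) (two_rpow_ne_top _)]
  refine le_iInf fun c => ?_
  calc doubleOsc σ μ u x r ≤ ⨍⁻ y in ball x r,
        2 ^ σ * (‖u y - c‖ₑ ^ σ + ⨍⁻ z in ball x r, ‖u z - c‖ₑ ^ σ ∂μ) ∂μ :=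
        laverage_mono fun y => hμ.laverage_enorm_sub_rpow_le hσ u x hr (u y) c
    _ = 2 ^ (σ + 1) * ⨍⁻ z in ball x r, ‖u z - c‖ₑ ^ σ ∂μ := by
        rw [laverage_const_mul (two_rpow_ne_top _), laverage_add_left (by fun_prop),
          hμ.laverage_ball_const x hr, two_rpow_add, ENNReal.rpow_one, mul_assoc, two_mul]

theorem doubleOsc_le_doubleOsc (hμ : IsDoubling μ C₁ n) (σ : ℝ) (u : X → ℝ) {x y : X}
    {r R lam : ℝ} (hr : 0 < r) (hlam : 1 < lam) (hrR : ball x r ⊆ ball y R)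
    (hRr : ball y R ⊆ ball x (lam * r)) :
    doubleOsc σ μ u x r ≤ doublingFactor C₁ n lam ^ 2 * doubleOsc σ μ u y R := by
  calc doubleOsc σ μ u x r
      ≤ ⨍⁻ y' in ball x r, doublingFactor C₁ n lam *
          ⨍⁻ z in ball y R, ‖u y' - u z‖ₑ ^ σ ∂μ ∂μ :=
        laverage_mono fun y' => hμ.laverage_ball_le hr hlam hrR hRr _
    _ ≤ doublingFactor C₁ n lam * (doublingFactor C₁ n lam * doubleOsc σ μ u y R) := by
        rw [laverage_const_mul (doublingFactor_ne_top C₁ n lam)]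
        gcongr
        exact hμ.laverage_ball_le hr hlam hrR hRr _
    _ = doublingFactor C₁ n lam ^ 2 * doubleOsc σ μ u y R := by rw [sq, mul_assoc]

theorem pointOsc_mono (hμ : IsDoubling μ C₁ n) (σ : ℝ) (u : X → ℝ) (x : X)
    {r lam : ℝ} (hr : 0 < r) (hlam : 1 < lam) :
    pointOsc σ μ u x r ≤ doublingFactor C₁ n lam * pointOsc σ μ u x (lam * r) :=
  hμ.laverage_ball_le hr hlam (ball_subset_ball (by nlinarith)) Subset.rfl _

theorem enorm_sub_rpow_le_laverage_add (hμ : IsDoubling μ C₁ n) (h0 : 0 ≤ σ) (h1 : σ ≤ 1)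
    (hu : Measurable u) (x : X) {r : ℝ} (hr : 0 < r) (a b : ℝ) :
    ‖a - b‖ₑ ^ σ ≤
      ⨍⁻ z in ball x r, ‖a - u z‖ₑ ^ σ ∂μ + ⨍⁻ z in ball x r, ‖b - u z‖ₑ ^ σ ∂μ := by
  rw [← hμ.laverage_ball_const x hr (‖a - b‖ₑ ^ σ), ← laverage_add_left (by fun_prop)]
  exact laverage_mono fun z => enorm_sub_rpow_le_add h0 h1 _ _ _

theorem pointOsc_le_half (hμ : IsDoubling μ C₁ n) (h0 : 0 ≤ σ) (h1 : σ ≤ 1)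
    (hu : Measurable u) (x : X) {r : ℝ} (hr : 0 < r) :
    pointOsc σ μ u x r ≤
      pointOsc σ μ u x (r / 2) + doublingFactor C₁ n 2 * doubleOsc σ μ u x r := by
  calc pointOsc σ μ u x r
      ≤ ⨍⁻ y in ball x r, (pointOsc σ μ u x (r / 2) +
          doublingFactor C₁ n 2 * ⨍⁻ z in ball x r, ‖u y - u z‖ₑ ^ σ ∂μ) ∂μ := by
        refine laverage_mono fun y =>
          (hμ.enorm_sub_rpow_le_laverage_add h0 h1 hu x (half_pos hr) (u x) (u y)).trans ?_
        exact add_le_add le_rfl (hμ.laverage_ball_le (half_pos hr) one_lt_two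
          (ball_subset_ball (by linarith)) (ball_subset_ball (by linarith)) _)
    _ = pointOsc σ μ u x (r / 2) + doublingFactor C₁ n 2 * doubleOsc σ μ u x r := by
        rw [laverage_add_left measurable_const, hμ.laverage_ball_const x hr,
          laverage_const_mul (doublingFactor_ne_top _ _ _), doubleOsc]

theorem pointOsc_le_sum (hμ : IsDoubling μ C₁ n) (h0 : 0 ≤ σ) (h1 : σ ≤ 1)
    (hu : Measurable u) (x : X) {r : ℝ} (hr : 0 < r) (N : ℕ) :
    pointOsc σ μ u x r ≤ pointOsc σ μ u x (r / 2 ^ N) +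
      doublingFactor C₁ n 2 * ∑ j ∈ Finset.range N, doubleOsc σ μ u x (r / 2 ^ j) := by
  induction N with
  | zero => simp
  | succ N ih =>
    have hstep := hμ.pointOsc_le_half h0 h1 hu x (r := r / 2 ^ N) (by positivity)
    refine ih.trans ?_
    rw [Finset.sum_range_succ, mul_add, pow_succ, ← div_div,
      add_comm (doublingFactor C₁ n 2 * _), ← add_assoc]
    gcongr

theorem locallyIntegrable_abs_sub_rpow (hμ : IsDoubling μ C₁ n) (hσ : 0 < σ)
    (hu : MemLpLoc u (ENNReal.ofReal σ) μ) (c : ℝ) :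
    LocallyIntegrable (fun y => |u y - c| ^ σ) μ := by
  intro x
  have : IsFiniteMeasure (μ.restrict (ball x 1)) :=
    isFiniteMeasure_restrict.2 (hμ.ball_ne_top x one_pos)
  have hint := ((hu x 1 one_pos).sub (memLp_const c)).integrable_norm_rpow
    (by simpa using hσ) ENNReal.ofReal_ne_top
  rw [ENNReal.toReal_ofReal hσ.le] at hint
  exact ⟨ball x 1, ball_mem_nhds x one_pos, hint⟩

theorem pointOsc_le_closedBall (hμ : IsDoubling μ C₁ n) (hσ : 0 ≤ σ) (u : X → ℝ) (x : X)
    {r : ℝ} (hr : 0 < r) (c : ℝ) :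
    pointOsc σ μ u x r ≤ 2 ^ σ * (‖u x - c‖ₑ ^ σ +
      doublingFactor C₁ n 2 * ⨍⁻ y in closedBall x r, ‖u y - c‖ₑ ^ σ ∂μ) := by
  refine (hμ.laverage_enorm_sub_rpow_le hσ u x hr (u x) c).trans ?_
  gcongr
  exact hμ.laverage_ball_le hr one_lt_two ball_subset_closedBall
    (closedBall_subset_ball (by linarith)) _

theorem ae_tendsto_pointOsc [BorelSpace X] (hμ : IsDoubling μ C₁ n) (hσ : 0 < σ)
    (hu : MemLpLoc u (ENNReal.ofReal σ) μ) :
    ∀ᵐ x ∂μ, Tendsto (pointOsc σ μ u x) (𝓝[>] 0) (𝓝 0) := by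
  have hlebesgue : ∀ᵐ x ∂μ, ∀ c : ℚ, Tendsto (fun r => ⨍⁻ y in closedBall x r, ‖u y - c‖ₑ ^ σ ∂μ)
      (𝓝[>] 0) (𝓝 (‖u x - c‖ₑ ^ σ)) := by
    refine ae_all_iff.2 fun c => ?_
    simpa only [ofReal_abs_rpow hσ.le] using hμ.ae_tendsto_laverage_closedBall
      (hμ.locallyIntegrable_abs_sub_rpow hσ hu c) fun y => Real.rpow_nonneg (abs_nonneg _) _
  filter_upwards [hlebesgue] with x hx
  set K := doublingFactor C₁ n 2
  -- `2^σ (1 + K) |u(x) - c|^σ` bounds the upper limit, and is small for `c` rational near `u(x)`.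
  let bound (a : ℝ≥0∞) : ℝ≥0∞ := 2 ^ σ * (a + K * a)
  have hbound : Continuous fun c : ℝ => bound (‖u x - c‖ₑ ^ σ) := by
    have hK : K ≠ ∞ := doublingFactor_ne_top _ _ _
    have hpow : Continuous fun c : ℝ => ‖u x - c‖ₑ ^ σ :=
      ENNReal.continuous_rpow_const.comp (by fun_prop)
    exact (ENNReal.continuous_const_mul (two_rpow_ne_top σ)).comp
      (hpow.add ((ENNReal.continuous_const_mul hK).comp hpow))
  refine ENNReal.tendsto_nhds_zero.2 fun ε hε => ?_
  obtain ⟨c, hc⟩ : ∃ c : ℚ, bound (‖u x - c‖ₑ ^ σ) < ε :=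
    Rat.denseRange_cast.exists_mem_open (isOpen_lt hbound continuous_const)
      ⟨u x, by simpa [bound, hσ] using hε⟩
  have hlim : Tendsto (fun r => 2 ^ σ * (‖u x - c‖ₑ ^ σ +
      K * ⨍⁻ y in closedBall x r, ‖u y - c‖ₑ ^ σ ∂μ)) (𝓝[>] 0) (𝓝 (bound (‖u x - c‖ₑ ^ σ))) :=
    ENNReal.Tendsto.const_mul (tendsto_const_nhds.add (ENNReal.Tendsto.const_mul (hx c)
      (.inr (doublingFactor_ne_top _ _ _)))) (.inr (two_rpow_ne_top σ))
  filter_upwards [hlim.eventually_lt_const hc, self_mem_nhdsWithin] with r hrε hr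
  exact (hμ.pointOsc_le_closedBall hσ.le u x hr c).trans hrε.le

theorem ae_pointOsc_le_tsum [BorelSpace X] (hμ : IsDoubling μ C₁ n) (hσ : 0 < σ)
    (h1 : σ ≤ 1) (hu : Measurable u) (hloc : MemLpLoc u (ENNReal.ofReal σ) μ) :
    ∀ᵐ x ∂μ, ∀ r : ℝ, 0 < r →
      pointOsc σ μ u x r ≤ doublingFactor C₁ n 2 * ∑' j : ℕ, doubleOsc σ μ u x (r / 2 ^ j) := by
  filter_upwards [hμ.ae_tendsto_pointOsc hσ hloc] with x hx r hr
  have hradii : Tendsto (fun N : ℕ => r / 2 ^ N) atTop (𝓝[>] 0) :=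
    tendsto_nhdsWithin_iff.2 ⟨tendsto_const_nhds.div_atTop
      (tendsto_pow_atTop_atTop_of_one_lt one_lt_two), .of_forall fun N => by
        simp only [mem_Ioi]; positivity⟩
  have hlim := (hx.comp hradii).add_const
    (doublingFactor C₁ n 2 * ∑' j : ℕ, doubleOsc σ μ u x (r / 2 ^ j))
  rw [zero_add] at hlim
  refine ge_of_tendsto' hlim fun N => (hμ.pointOsc_le_sum hσ.le h1 hu x hr N).trans ?_
  dsimp only [Function.comp_apply]
  gcongr
  exact ENNReal.sum_le_tsum _

theorem exists_ae_pointOsc_rpow_le_tsum [BorelSpace X] (hμ : IsDoubling μ C₁ n) (hσ : 0 < σ)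
    (h1 : σ ≤ 1) {e δ : ℝ} (he : 0 < e) (hδ : 0 < δ) :
    ∃ K : ℝ≥0∞, K ≠ ∞ ∧ ∀ u : X → ℝ, Measurable u → MemLpLoc u (ENNReal.ofReal σ) μ →
      ∀ᵐ x ∂μ, ∀ r : ℝ, 0 < r → pointOsc σ μ u x r ^ e ≤
        K * ∑' j : ℕ, 2 ^ (δ * j) * doubleOsc σ μ u x (r / 2 ^ j) ^ e := by
  obtain ⟨M, hM, hMsum⟩ := exists_tsum_rpow_le he hδ
  refine ⟨doublingFactor C₁ n 2 ^ e * M, ENNReal.mul_ne_top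
    (ENNReal.rpow_ne_top_of_nonneg he.le (doublingFactor_ne_top _ _ _)) hM, fun u hu hloc => ?_⟩
  filter_upwards [hμ.ae_pointOsc_le_tsum hσ h1 hu hloc] with x hx r hr
  calc pointOsc σ μ u x r ^ e
      ≤ (doublingFactor C₁ n 2 * ∑' j : ℕ, doubleOsc σ μ u x (r / 2 ^ j)) ^ e := by
        gcongr
        exact hx r hr
    _ ≤ _ := by
        rw [ENNReal.mul_rpow_of_nonneg _ _ he.le, mul_assoc]
        gcongr
        exact hMsum _

theorem enorm_sub_rpow_le_pointOsc (hμ : IsDoubling μ C₁ n) (h0 : 0 ≤ σ) (h1 : σ ≤ 1)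
    (hu : Measurable u) {x y : X} {t : ℝ} (hxy : dist x y < t) :
    ‖u x - u y‖ₑ ^ σ ≤
      pointOsc σ μ u x t + doublingFactor C₁ n 3 * pointOsc σ μ u y (2 * t) := by
  have ht : 0 < t := dist_nonneg.trans_lt hxy
  refine (hμ.enorm_sub_rpow_le_laverage_add h0 h1 hu x ht (u x) (u y)).trans ?_
  refine add_le_add le_rfl (hμ.laverage_ball_le ht (by norm_num) ?_ ?_ _)
  · exact ball_subset_ball' (by linarith)
  · exact ball_subset_ball' (by rw [dist_comm]; linarith)

end IsDoubling

end Oscillation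

section LpNorms

variable {α : Type*} [MeasurableSpace α] {ν : Measure α} {p : ℝ≥0∞}

theorem eLpNorm_eq_lintegral_rpow (hp : p ≠ 0) (hpt : p ≠ ∞) (f : α → ℝ≥0∞) :
    eLpNorm f p ν = (∫⁻ x, f x ^ p.toReal ∂ν) ^ (1 / p.toReal) :=
  eLpNorm_eq_lintegral_rpow_enorm_toReal hp hpt

theorem eLpNorm_rpow_eq_lintegral_rpow (hp : p ≠ 0) (hpt : p ≠ ∞) (f : α → ℝ≥0∞) :
    eLpNorm f p ν ^ p.toReal = ∫⁻ x, f x ^ p.toReal ∂ν := by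
  rw [eLpNorm_eq_lintegral_rpow hp hpt, ← ENNReal.rpow_mul,
    one_div_mul_cancel (ENNReal.toReal_pos hp hpt).ne', ENNReal.rpow_one]

theorem eLpNorm_const_mul_ennreal (hp : p ≠ 0) {K : ℝ≥0∞} (hK : K ≠ ∞) (f : α → ℝ≥0∞) :
    eLpNorm (fun x => K * f x) p ν = K * eLpNorm f p ν := by
  by_cases hpt : p = ∞
  · subst hpt
    simp only [eLpNorm_exponent_top, eLpNormEssSup, enorm_eq_self]
    exact ENNReal.essSup_const_mul
  · have hp' : 0 < p.toReal := ENNReal.toReal_pos hp hpt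
    simp_rw [eLpNorm_eq_lintegral_rpow hp hpt, ENNReal.mul_rpow_of_nonneg _ _ hp'.le]
    rw [lintegral_const_mul' _ _ (ENNReal.rpow_ne_top_of_nonneg hp'.le hK),
      ENNReal.mul_rpow_of_nonneg _ _ (by positivity), ← ENNReal.rpow_mul,
      mul_one_div_cancel hp'.ne', ENNReal.rpow_one]

theorem essSup_tsum_le (f : ℕ → α → ℝ≥0∞) :
    essSup (fun x => ∑' j, f j x) ν ≤ ∑' j, essSup (f j) ν := by
  refine essSup_le_of_ae_le _ ?_
  filter_upwards [ae_all_iff.2 fun j => ENNReal.ae_le_essSup (f j)] with x hx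
  exact ENNReal.tsum_le_tsum hx

theorem tsum_le_tsum_two_rpow_mul {δ : ℝ} (hδ : 0 ≤ δ) (f : ℕ → ℝ≥0∞) :
    ∑' j, f j ≤ ∑' j : ℕ, 2 ^ (δ * j) * f j := by
  refine ENNReal.tsum_le_tsum fun j => le_mul_of_one_le_left zero_le ?_
  rw [← ENNReal.rpow_zero (x := 2)]
  exact ENNReal.rpow_le_rpow_of_exponent_le (by norm_num) (by positivity)

-- A substitute for the triangle inequality that is valid for all exponents `p`.
theorem exists_eLpNorm_tsum_le (α : Type*) [MeasurableSpace α] (hp : p ≠ 0) :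
    ∃ a : ℝ, 0 < a ∧ ∀ δ : ℝ, 0 < δ → ∃ K : ℝ≥0∞, K ≠ ∞ ∧
      ∀ (ν : Measure α) (f : ℕ → α → ℝ≥0∞), (∀ j, Measurable (f j)) →
        eLpNorm (fun x => ∑' j, f j x) p ν ^ a ≤
          K * ∑' j : ℕ, 2 ^ (δ * j) * eLpNorm (f j) p ν ^ a := by
  by_cases hpt : p = ∞
  · refine ⟨1, one_pos, fun δ hδ => ⟨1, ENNReal.one_ne_top, fun ν f _ => ?_⟩⟩
    simp only [hpt, eLpNorm_exponent_top, eLpNormEssSup, enorm_eq_self, ENNReal.rpow_one, one_mul]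
    exact (essSup_tsum_le f).trans (tsum_le_tsum_two_rpow_mul hδ.le _)
  · have hp' : 0 < p.toReal := ENNReal.toReal_pos hp hpt
    refine ⟨p.toReal, hp', fun δ hδ => ?_⟩
    obtain ⟨K, hK, hsum⟩ := exists_tsum_rpow_le hp' hδ
    refine ⟨K, hK, fun ν f hf => ?_⟩
    simp only [eLpNorm_rpow_eq_lintegral_rpow hp hpt]
    calc ∫⁻ x, (∑' j, f j x) ^ p.toReal ∂ν
        ≤ ∫⁻ x, K * ∑' j : ℕ, 2 ^ (δ * j) * f j x ^ p.toReal ∂ν := lintegral_mono fun x => hsum _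
      _ = K * ∑' j : ℕ, 2 ^ (δ * j) * ∫⁻ x, f j x ^ p.toReal ∂ν := by
          rw [lintegral_const_mul' _ _ hK, lintegral_tsum (fun j => by fun_prop)]
          simp_rw [lintegral_const_mul' _ _ (two_rpow_ne_top _)]

theorem exists_eLpNorm_rpow_le_of_ae_le_tsum (α : Type*) [MeasurableSpace α] (hp : p ≠ 0) :
    ∃ a : ℝ, 0 < a ∧ ∀ δ : ℝ, 0 < δ → ∃ K : ℝ≥0∞, K ≠ ∞ ∧
      ∀ (ν : Measure α) (F : α → ℝ≥0∞) (f : ℕ → α → ℝ≥0∞) (L : ℝ≥0∞) (θ : ℝ), L ≠ ∞ →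
        (∀ j, Measurable (f j)) → (∀ᵐ x ∂ν, F x ≤ L * ∑' j : ℕ, 2 ^ (θ * j) * f j x) →
        eLpNorm F p ν ^ a ≤
          L ^ a * K * ∑' j : ℕ, 2 ^ ((δ + θ * a) * j) * eLpNorm (f j) p ν ^ a := by
  obtain ⟨a, ha, hsum⟩ := exists_eLpNorm_tsum_le α hp
  refine ⟨a, ha, fun δ hδ => ?_⟩
  obtain ⟨K, hK, hKsum⟩ := hsum δ hδ
  refine ⟨K, hK, fun ν F f L θ hL hf hF => ?_⟩
  have hterm (j : ℕ) : 2 ^ (δ * j) * eLpNorm (fun x => 2 ^ (θ * j) * f j x) p ν ^ a =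
      2 ^ ((δ + θ * a) * j) * eLpNorm (f j) p ν ^ a := by
    rw [eLpNorm_const_mul_ennreal hp (two_rpow_ne_top _), ENNReal.mul_rpow_of_nonneg _ _ ha.le,
      ← ENNReal.rpow_mul, ← mul_assoc, ← two_rpow_add]
    congr 2
    ring
  calc eLpNorm F p ν ^ a
      ≤ (L * eLpNorm (fun x => ∑' j : ℕ, 2 ^ (θ * j) * f j x) p ν) ^ a := by
        rw [← eLpNorm_const_mul_ennreal hp hL]
        gcongr
        exact eLpNorm_mono_enorm_ae (by simpa only [enorm_eq_self] using hF)
    _ ≤ L ^ a * (K * ∑' j : ℕ, 2 ^ (δ * j) * eLpNorm (fun x => 2 ^ (θ * j) * f j x) p ν ^ a) := by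
        rw [ENNReal.mul_rpow_of_nonneg _ _ ha.le]
        gcongr
        exact hKsum ν _ fun j => (hf j).const_mul _
    _ = L ^ a * K * ∑' j : ℕ, 2 ^ ((δ + θ * a) * j) * eLpNorm (f j) p ν ^ a := by
        simp only [hterm, mul_assoc]

theorem lt_essSup_iff {f : α → ℝ≥0∞} {c : ℝ≥0∞} : c < essSup f ν ↔ 0 < ν {x | c < f x} := by
  have hle : essSup f ν ≤ c ↔ ∀ᵐ x ∂ν, f x ≤ c :=
    ⟨fun h => (ENNReal.ae_le_essSup f).mono fun x hx => hx.trans h, essSup_le_of_ae_le c⟩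
  rw [← not_le, hle, ae_iff, pos_iff_ne_zero]
  simp only [not_le]

theorem measurable_eLpNorm_right {β : Type*} [MeasurableSpace β] [SFinite ν] {f : α × β → ℝ≥0∞}
    (hf : Measurable f) : Measurable fun t => eLpNorm (fun x => f (x, t)) p ν := by
  rcases eq_or_ne p 0 with rfl | hp
  · simp
  by_cases hpt : p = ∞
  · simp only [hpt, eLpNorm_exponent_top, eLpNormEssSup, enorm_eq_self]
    refine measurable_of_Ioi fun c => ?_
    have hpre : (fun t => essSup (fun x => f (x, t)) ν) ⁻¹' Ioi c =
        {t | 0 < ν {x | c < f (x, t)}} := ext fun _ => lt_essSup_iff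
    rw [hpre]
    exact measurableSet_lt measurable_const
      (measurable_measure_prodMk_right (measurableSet_lt measurable_const hf))
  · simp only [eLpNorm_eq_lintegral_rpow hp hpt]
    exact (Measurable.lintegral_prod_left' (f := fun q : α × β => f q ^ p.toReal)
      (hf.pow_const _)).pow_const _

end LpNorms

section LpNormsOfAverages

variable {X : Type*} [MetricSpace X] [MeasurableSpace X] {μ : Measure X} {C₁ n : ℝ}

theorem lintegral_laverage_ball_eq [BorelSpace X] [SecondCountableTopology X] [SFinite μ] (t : ℝ)
    {G : X → ℝ≥0∞} (hG : Measurable G) :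
    ∫⁻ x, ⨍⁻ z in ball x t, G z ∂μ ∂μ = ∫⁻ z, (∫⁻ x in ball z t, (μ (ball x t))⁻¹ ∂μ) * G z ∂μ := by
  have hnear : MeasurableSet {q : X × X | dist q.2 q.1 < t} :=
    measurableSet_lt (by fun_prop) (by fun_prop)
  have hinv : Measurable fun x => (μ (ball x t))⁻¹ :=
    (measurable_measure_prodMk_left (ν := μ) hnear).inv
  let F : X × X → ℝ≥0∞ :=
    {q : X × X | dist q.2 q.1 < t}.indicator fun q => (μ (ball q.1 t))⁻¹ * G q.2
  have hF : Measurable F :=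
    ((hinv.comp measurable_fst).mul (hG.comp measurable_snd)).indicator hnear
  calc ∫⁻ x, ⨍⁻ z in ball x t, G z ∂μ ∂μ = ∫⁻ x, ∫⁻ z, F (x, z) ∂μ ∂μ := by
        refine lintegral_congr fun x => ?_
        rw [setLAverage_eq, ENNReal.div_eq_inv_mul, ← lintegral_const_mul _ hG,
          ← lintegral_indicator measurableSet_ball]
        rfl
    _ = ∫⁻ z, ∫⁻ x, F (x, z) ∂μ ∂μ := lintegral_lintegral_swap hF.aemeasurable
    _ = ∫⁻ z, (∫⁻ x in ball z t, (μ (ball x t))⁻¹ ∂μ) * G z ∂μ := by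
        refine lintegral_congr fun z => ?_
        rw [← lintegral_mul_const _ hinv, ← lintegral_indicator measurableSet_ball]
        refine lintegral_congr fun x => ?_
        simp only [F, indicator, mem_ofPred_eq, mem_ball, dist_comm]

namespace IsDoubling

theorem setLIntegral_inv_measure_ball_le (hμ : IsDoubling μ C₁ n) (z : X) {t : ℝ} (ht : 0 < t) :
    ∫⁻ x in ball z t, (μ (ball x t))⁻¹ ∂μ ≤ doublingFactor C₁ n 2 := by
  have hinv : ∀ x ∈ ball z t, (μ (ball x t))⁻¹ ≤ doublingFactor C₁ n 2 * (μ (ball z t))⁻¹ := by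
    intro x hx
    have hzx : μ (ball z t) ≤ doublingFactor C₁ n 2 * μ (ball x t) :=
      (measure_mono (ball_subset_ball' (by rw [dist_comm]; linarith [mem_ball.1 hx]))).trans
        (hμ.doubling x t 2 ht one_lt_two)
    rw [← div_eq_mul_inv, ENNReal.le_div_iff_mul_le (.inl (hμ.ball_ne_zero z ht))
      (.inl (hμ.ball_ne_top z ht)), ← ENNReal.div_eq_inv_mul]
    exact ENNReal.div_le_of_le_mul hzx
  calc ∫⁻ x in ball z t, (μ (ball x t))⁻¹ ∂μ
      ≤ ∫⁻ _ in ball z t, doublingFactor C₁ n 2 * (μ (ball z t))⁻¹ ∂μ :=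
        setLIntegral_mono measurable_const hinv
    _ = doublingFactor C₁ n 2 := by
        rw [setLIntegral_const, mul_assoc,
          ENNReal.inv_mul_cancel (hμ.ball_ne_zero z ht) (hμ.ball_ne_top z ht), mul_one]

theorem lintegral_laverage_le [BorelSpace X] (hμ : IsDoubling μ C₁ n) {t : ℝ}
    (ht : 0 < t) {G : X → ℝ≥0∞} (hG : Measurable G) :
    ∫⁻ x, ⨍⁻ z in ball x t, G z ∂μ ∂μ ≤ doublingFactor C₁ n 2 * ∫⁻ x, G x ∂μ := by
  have := hμ.secondCountableTopology
  have := hμ.sigmaFinite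
  rw [lintegral_laverage_ball_eq t hG, ← lintegral_const_mul _ hG]
  gcongr with z
  exact hμ.setLIntegral_inv_measure_ball_le z ht

end IsDoubling

end LpNormsOfAverages

section ScaleNorm

variable {q : ℝ≥0∞} {φ ψ : ℝ → ℝ≥0∞}

/-- The quasi-norm `(∫_0^∞ φ(t)^q dt/t)^{1/q}`, with a supremum (not an essential one) over `t > 0`
when `q = ∞`. -/
noncomputable def scaleNorm (q : ℝ≥0∞) (φ : ℝ → ℝ≥0∞) : ℝ≥0∞ :=
  if q = ∞ then ⨆ t ∈ Ioi (0 : ℝ), φ t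
  else (∫⁻ t in Ioi (0 : ℝ), φ t ^ q.toReal * ENNReal.ofReal t⁻¹) ^ (1 / q.toReal)

theorem scaleNorm_top (φ : ℝ → ℝ≥0∞) : scaleNorm ∞ φ = ⨆ t ∈ Ioi (0 : ℝ), φ t :=
  if_pos rfl

theorem le_scaleNorm_top {t : ℝ} (ht : 0 < t) : φ t ≤ scaleNorm ∞ φ := by
  rw [scaleNorm_top]
  exact le_iSup₂ (f := fun t (_ : t ∈ Ioi (0 : ℝ)) => φ t) t ht

theorem scaleNorm_eq_eLpNorm (hq : q ≠ 0) (hqt : q ≠ ∞) (φ : ℝ → ℝ≥0∞) :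
    scaleNorm q φ =
      eLpNorm φ q ((volume.restrict (Ioi 0)).withDensity fun t => ENNReal.ofReal t⁻¹) := by
  rw [eLpNorm_eq_lintegral_rpow hq hqt, lintegral_withDensity_eq_lintegral_mul_non_measurable _
    (by fun_prop) (.of_forall fun _ => ENNReal.ofReal_lt_top), scaleNorm, if_neg hqt]
  simp_rw [Pi.mul_apply, mul_comm]

theorem scaleNorm_mono (h : ∀ t, 0 < t → φ t ≤ ψ t) : scaleNorm q φ ≤ scaleNorm q ψ := by
  unfold scaleNorm
  split_ifs
  · exact iSup₂_mono h
  · gcongr ?_ ^ _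
    refine setLIntegral_mono' measurableSet_Ioi fun t ht => ?_
    gcongr
    exact h t ht

theorem scaleNorm_const_mul (hq : q ≠ 0) {K : ℝ≥0∞} (hK : K ≠ ∞) (φ : ℝ → ℝ≥0∞) :
    scaleNorm q (fun t => K * φ t) = K * scaleNorm q φ := by
  by_cases hqt : q = ∞
  · simp only [hqt, scaleNorm_top, ENNReal.mul_iSup]
  · rw [scaleNorm_eq_eLpNorm hq hqt, scaleNorm_eq_eLpNorm hq hqt,
      eLpNorm_const_mul_ennreal hq hK]

theorem setLIntegral_Ioi_comp_mul_inv {f : ℝ → ℝ≥0∞} {c : ℝ} (hc : 0 < c) :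
    ∫⁻ t in Ioi (0 : ℝ), f (c * t) * ENNReal.ofReal t⁻¹ =
      ∫⁻ t in Ioi (0 : ℝ), f t * ENNReal.ofReal t⁻¹ := by
  have himage : (fun t => c * t) '' Ioi (0 : ℝ) = Ioi 0 := by
    simpa using image_mul_left_Ioi hc (0 : ℝ)
  have hderiv (t : ℝ) : HasDerivAt (fun t => c * t) c t := by
    simpa using (hasDerivAt_id t).const_mul c
  conv_rhs => rw [← himage, lintegral_image_eq_lintegral_abs_deriv_mul measurableSet_Ioi
    (fun t _ => (hderiv t).hasDerivWithinAt) (mul_right_injective₀ hc.ne').injOn]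
  refine setLIntegral_congr_fun measurableSet_Ioi fun t _ => ?_
  rw [abs_of_pos hc, mul_left_comm, ← ENNReal.ofReal_mul hc.le, mul_inv,
    mul_inv_cancel_left₀ hc.ne']

theorem scaleNorm_comp_mul {c : ℝ} (hc : 0 < c) (φ : ℝ → ℝ≥0∞) :
    scaleNorm q (fun t => φ (c * t)) = scaleNorm q φ := by
  by_cases hqt : q = ∞
  · subst hqt
    rw [scaleNorm_top, scaleNorm_top]
    refine le_antisymm (iSup₂_le fun t ht => ?_) (iSup₂_le fun t ht => ?_)
    · exact le_iSup₂ (f := fun t (_ : t ∈ Ioi (0 : ℝ)) => φ t) (c * t) (mul_pos hc ht)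
    · refine le_iSup₂_of_le (c⁻¹ * t) (mul_pos (inv_pos.2 hc) ht) ?_
      rw [mul_inv_cancel_left₀ hc.ne']
  · simp only [scaleNorm, if_neg hqt,
      setLIntegral_Ioi_comp_mul_inv (f := fun t => φ t ^ q.toReal) hc]

theorem exists_scaleNorm_tsum_le (hq : q ≠ 0) :
    ∃ a : ℝ, 0 < a ∧ ∀ δ : ℝ, 0 < δ → ∃ K : ℝ≥0∞, K ≠ ∞ ∧
      ∀ f : ℕ → ℝ → ℝ≥0∞, (∀ j, Measurable (f j)) →
        scaleNorm q (fun t => ∑' j, f j t) ^ a ≤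
          K * ∑' j : ℕ, 2 ^ (δ * j) * scaleNorm q (f j) ^ a := by
  by_cases hqt : q = ∞
  · refine ⟨1, one_pos, fun δ hδ => ⟨1, ENNReal.one_ne_top, fun f _ => ?_⟩⟩
    simp only [hqt, ENNReal.rpow_one, one_mul]
    refine le_trans ?_ (tsum_le_tsum_two_rpow_mul hδ.le _)
    rw [scaleNorm_top]
    exact iSup₂_le fun t ht => ENNReal.tsum_le_tsum fun j => le_scaleNorm_top ht
  · simp only [scaleNorm_eq_eLpNorm hq hqt]
    obtain ⟨a, ha, hsum⟩ := exists_eLpNorm_tsum_le ℝ hq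
    exact ⟨a, ha, fun δ hδ => (hsum δ hδ).imp fun K hK => ⟨hK.1, hK.2 _⟩⟩

theorem exists_scaleNorm_tsum_comp_mul_le (hq : q ≠ 0) {η c : ℝ} (hη : 0 < η) (hc : 0 < c) :
    ∃ K : ℝ≥0∞, K ≠ ∞ ∧ ∀ ψ : ℝ → ℝ≥0∞, Measurable ψ →
      scaleNorm q (fun t => ∑' j : ℕ, 2 ^ (-(η * j)) * ψ (c * t / 2 ^ j)) ≤ K * scaleNorm q ψ := by
  obtain ⟨a, ha, hsum⟩ := exists_scaleNorm_tsum_le hq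
  obtain ⟨K, hK, hKsum⟩ := hsum (η * a / 2) (by positivity)
  set T := ∑' j : ℕ, (2 : ℝ≥0∞) ^ (-(η * a / 2 * j))
  have hT : T ≠ ∞ := tsum_two_rpow_ne_top (by positivity)
  refine ⟨(K * T) ^ (1 / a), ENNReal.rpow_ne_top_of_nonneg (by positivity)
    (ENNReal.mul_ne_top hK hT), fun ψ hψ => ?_⟩
  have hterm (j : ℕ) : 2 ^ (η * a / 2 * j) *
      scaleNorm q (fun t => 2 ^ (-(η * j)) * ψ (c * t / 2 ^ j)) ^ a =
        2 ^ (-(η * a / 2 * j)) * scaleNorm q ψ ^ a := by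
    rw [scaleNorm_const_mul hq (two_rpow_ne_top _)]
    simp_rw [mul_div_right_comm]
    rw [scaleNorm_comp_mul (by positivity), ENNReal.mul_rpow_of_nonneg _ _ ha.le,
      ← ENNReal.rpow_mul, ← mul_assoc, ← two_rpow_add]
    congr 2
    ring
  have hpow := hKsum (fun j t => 2 ^ (-(η * j)) * ψ (c * t / 2 ^ j)) fun j => by fun_prop
  simp only [hterm, ENNReal.tsum_mul_right, ← mul_assoc] at hpow
  calc _ ≤ (K * T * scaleNorm q ψ ^ a) ^ (1 / a) := by
        rwa [one_div, ENNReal.le_rpow_inv_iff ha]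
    _ = (K * T) ^ (1 / a) * scaleNorm q ψ := by
        rw [ENNReal.mul_rpow_of_nonneg _ _ (by positivity), ← ENNReal.rpow_mul,
          mul_one_div_cancel ha.ne', ENNReal.rpow_one]

/-- A discrete **Hardy inequality**. -/
theorem exists_scaleNorm_le_of_rpow_le_tsum (hq : q ≠ 0) {a η c : ℝ} (ha : 0 < a) (hη : 0 < η)
    (hc : 0 < c) {K : ℝ≥0∞} (hK : K ≠ ∞) :
    ∃ K' : ℝ≥0∞, K' ≠ ∞ ∧ ∀ φ ψ : ℝ → ℝ≥0∞, Measurable ψ →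
      (∀ t, 0 < t → φ t ^ a ≤ K * ∑' j : ℕ, 2 ^ (-(η * j)) * ψ (c * t / 2 ^ j) ^ a) →
      scaleNorm q φ ≤ K' * scaleNorm q ψ := by
  obtain ⟨M, hM, hMsum⟩ := exists_tsum_rpow_le (a := 1 / a) (δ := η / (2 * a)) (by positivity)
    (by positivity)
  obtain ⟨L, hL, hLsum⟩ :=
    exists_scaleNorm_tsum_comp_mul_le hq (η := η / (2 * a)) (by positivity) hc
  have hKM : K ^ (1 / a) * M ≠ ∞ :=
    ENNReal.mul_ne_top (ENNReal.rpow_ne_top_of_nonneg (by positivity) hK) hM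
  refine ⟨K ^ (1 / a) * M * L, ENNReal.mul_ne_top hKM hL, fun φ ψ hψ h => ?_⟩
  have hpt : ∀ t, 0 < t → φ t ≤
      K ^ (1 / a) * M * ∑' j : ℕ, 2 ^ (-(η / (2 * a) * j)) * ψ (c * t / 2 ^ j) := by
    intro t ht
    calc φ t ≤ (K * ∑' j : ℕ, 2 ^ (-(η * j)) * ψ (c * t / 2 ^ j) ^ a) ^ (1 / a) := by
          rw [one_div, ENNReal.le_rpow_inv_iff ha]
          exact h t ht
      _ ≤ K ^ (1 / a) * (M * ∑' j : ℕ, 2 ^ (η / (2 * a) * j) *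
          (2 ^ (-(η * j)) * ψ (c * t / 2 ^ j) ^ a) ^ (1 / a)) := by
          rw [ENNReal.mul_rpow_of_nonneg _ _ (by positivity)]
          gcongr
          exact hMsum _
      _ = K ^ (1 / a) * M * ∑' j : ℕ, 2 ^ (-(η / (2 * a) * j)) * ψ (c * t / 2 ^ j) := by
          rw [← mul_assoc]
          congr 1
          refine tsum_congr fun j => ?_
          rw [ENNReal.mul_rpow_of_nonneg _ _ (by positivity), ← ENNReal.rpow_mul,
            ← ENNReal.rpow_mul, mul_one_div_cancel ha.ne', ENNReal.rpow_one, ← mul_assoc,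
            ← two_rpow_add]
          congr 2
          field_simp
          ring
  calc scaleNorm q φ ≤ K ^ (1 / a) * M *
        scaleNorm q (fun t => ∑' j : ℕ, 2 ^ (-(η / (2 * a) * j)) * ψ (c * t / 2 ^ j)) := by
        rw [← scaleNorm_const_mul hq hKM]
        exact scaleNorm_mono hpt
    _ ≤ K ^ (1 / a) * M * L * scaleNorm q ψ := by
        rw [mul_assoc _ L]
        gcongr
        exact hLsum ψ hψ

end ScaleNorm

section Weights

theorem ofReal_rpow_neg_eq_mul_dyadic {c t : ℝ} (hc : 0 < c) (ht : 0 < t) (s : ℝ) (j : ℕ) :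
    ENNReal.ofReal (t ^ (-s)) = ENNReal.ofReal (c ^ s) *
      (2 ^ (-(s * j)) * ENNReal.ofReal ((c * t / 2 ^ j) ^ (-s))) := by
  rw [two_rpow_eq_ofReal, ← ENNReal.ofReal_mul (by positivity),
    ← ENNReal.ofReal_mul (by positivity)]
  congr 1
  rw [Real.div_rpow (by positivity) (by positivity), Real.mul_rpow hc.le ht.le,
    ← Real.rpow_natCast, ← Real.rpow_mul zero_le_two, Real.rpow_neg hc.le,
    show (j : ℝ) * -s = -(s * j) by ring]
  have hcs := (Real.rpow_pos_of_pos hc s).ne'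
  have h2s := (Real.rpow_pos_of_pos two_pos (-(s * j))).ne'
  field_simp

theorem exists_scaleNorm_weighted_le {q : ℝ≥0∞} (hq : q ≠ 0) {a s θ c : ℝ} (ha : 0 < a)
    (hθ : θ < s * a) (hc : 0 < c) {K : ℝ≥0∞} (hK : K ≠ ∞) :
    ∃ K' : ℝ≥0∞, K' ≠ ∞ ∧ ∀ φ ψ : ℝ → ℝ≥0∞, Measurable ψ →
      (∀ t, 0 < t → φ t ^ a ≤ K * ∑' j : ℕ, 2 ^ (θ * j) * ψ (c * t / 2 ^ j) ^ a) →
      scaleNorm q (fun t => ENNReal.ofReal (t ^ (-s)) * φ t) ≤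
        K' * scaleNorm q (fun t => ENNReal.ofReal (t ^ (-s)) * ψ t) := by
  obtain ⟨K', hK', hhardy⟩ := exists_scaleNorm_le_of_rpow_le_tsum hq (η := s * a - θ) ha
    (sub_pos.2 hθ) hc (K := K * ENNReal.ofReal (c ^ s) ^ a) (ENNReal.mul_ne_top hK
      (ENNReal.rpow_ne_top_of_nonneg ha.le ENNReal.ofReal_ne_top))
  refine ⟨K', hK', fun φ ψ hψ hφ => hhardy _ _ (by fun_prop) fun t ht => ?_⟩
  calc (ENNReal.ofReal (t ^ (-s)) * φ t) ^ a
      ≤ ENNReal.ofReal (t ^ (-s)) ^ a *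
        (K * ∑' j : ℕ, 2 ^ (θ * j) * ψ (c * t / 2 ^ j) ^ a) := by
        rw [ENNReal.mul_rpow_of_nonneg _ _ ha.le]
        gcongr
        exact hφ t ht
    _ = _ := by
        simp_rw [← ENNReal.tsum_mul_left]
        refine tsum_congr fun j => ?_
        rw [ofReal_rpow_neg_eq_mul_dyadic hc ht s j, ENNReal.mul_rpow_of_nonneg _ _ ha.le,
          ENNReal.mul_rpow_of_nonneg _ _ ha.le, ENNReal.mul_rpow_of_nonneg _ _ ha.le,
          ← ENNReal.rpow_mul, show -((s * a - θ) * j) = -(s * j) * a + θ * (j : ℝ) by ring,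
          two_rpow_add]
        ring

end Weights

section OscSeminorm

variable {X : Type*} [MetricSpace X] [MeasurableSpace X] {μ : Measure X} {C₁ n σ s : ℝ}
  {p q : ℝ≥0∞} {u : X → ℝ}

/-- The `L^p` quasi-norm of the `σ`-oscillation at scale `t`. -/
noncomputable def oscNorm (σ : ℝ) (p : ℝ≥0∞) (μ : Measure X) (u : X → ℝ) (t : ℝ) : ℝ≥0∞ :=
  eLpNorm (fun x => doubleOsc σ μ u x t ^ (1 / σ)) p μ

theorem measurable_oscNorm [BorelSpace X] [SecondCountableTopology X] [SFinite μ]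
    (hu : Measurable u) (σ : ℝ) (p : ℝ≥0∞) : Measurable (oscNorm σ p μ u) :=
  measurable_eLpNorm_right (f := fun q : X × ℝ => doubleOsc σ μ u q.1 q.2 ^ (1 / σ))
    ((measurable_doubleOsc hu σ).pow_const _)

/-- The Besov-type seminorm built on the double oscillations `doubleOsc`, through which all the
spaces are compared. -/
noncomputable def oscSeminorm (s σ : ℝ) (p q : ℝ≥0∞) (μ : Measure X) (u : X → ℝ) : ℝ≥0∞ :=
  scaleNorm q fun t => ENNReal.ofReal (t ^ (-s)) * oscNorm σ p μ u t

theorem besovNorm_eq_scaleNorm (s : ℝ) (p q : ℝ≥0∞) (u : X → ℝ) :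
    besovNorm s p q μ u =
      scaleNorm q fun t => ENNReal.ofReal (t ^ (-s)) * differenceModulus u p μ t := by
  unfold besovNorm scaleNorm
  split_ifs
  · rfl
  · congr 1
    refine setLIntegral_congr_fun measurableSet_Ioi fun t (ht : 0 < t) => ?_
    rw [ENNReal.mul_rpow_of_nonneg _ _ ENNReal.toReal_nonneg,
      ENNReal.ofReal_rpow_of_nonneg (by positivity) ENNReal.toReal_nonneg, ← Real.rpow_mul ht.le,
      mul_right_comm, ← ENNReal.ofReal_mul (by positivity),
      mul_comm (differenceModulus u p μ t ^ _), ← Real.rpow_neg_one t, ← Real.rpow_add ht]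
    congr 3
    ring

namespace IsDoubling

theorem exists_enorm_sub_rpow_le (hμ : IsDoubling μ C₁ n) {τ : ℝ} (hσ : 0 < σ)
    (h1 : σ ≤ 1) (hτ : 0 ≤ τ) :
    ∃ K : ℝ≥0∞, K ≠ ∞ ∧ ∀ u : X → ℝ, Measurable u → ∀ (x y : X) (t : ℝ), dist x y < t →
      ‖u x - u y‖ₑ ^ τ ≤
        K * (pointOsc σ μ u x (2 * t) ^ (τ / σ) + pointOsc σ μ u y (2 * t) ^ (τ / σ)) := by
  have he : 0 ≤ τ / σ := by positivity
  set L := doublingFactor C₁ n 2 + doublingFactor C₁ n 3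
  have hL : L ≠ ∞ :=
    ENNReal.add_ne_top.2 ⟨doublingFactor_ne_top _ _ _, doublingFactor_ne_top _ _ _⟩
  refine ⟨L ^ (τ / σ) * 2 ^ (τ / σ), ENNReal.mul_ne_top (ENNReal.rpow_ne_top_of_nonneg he hL)
    (two_rpow_ne_top _), fun u hu x y t hxy => ?_⟩
  have ht : 0 < t := dist_nonneg.trans_lt hxy
  have hosc : ‖u x - u y‖ₑ ^ σ ≤ L * (pointOsc σ μ u x (2 * t) + pointOsc σ μ u y (2 * t)) := by
    refine (hμ.enorm_sub_rpow_le_pointOsc hσ.le h1 hu hxy).trans ?_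
    rw [mul_add]
    gcongr
    · exact (hμ.pointOsc_mono σ u x ht one_lt_two).trans (by gcongr; exact le_self_add)
    · exact le_add_self
  calc ‖u x - u y‖ₑ ^ τ = (‖u x - u y‖ₑ ^ σ) ^ (τ / σ) := by
        rw [← ENNReal.rpow_mul, mul_div_cancel₀ _ hσ.ne']
    _ ≤ (L * (pointOsc σ μ u x (2 * t) + pointOsc σ μ u y (2 * t))) ^ (τ / σ) := by gcongr
    _ ≤ _ := by
        rw [ENNReal.mul_rpow_of_nonneg _ _ he, mul_assoc]
        gcongr
        exact ENNReal.add_rpow_le_two_rpow_mul_rpow_add_rpow _ _ he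

variable [BorelSpace X]

theorem exists_eLpNorm_pointOsc_le (hμ : IsDoubling μ C₁ n) (hσ : 0 < σ) (h1 : σ ≤ 1)
    (hp : p ≠ 0) :
    ∃ a : ℝ, 0 < a ∧ ∀ δ : ℝ, 0 < δ → ∃ K : ℝ≥0∞, K ≠ ∞ ∧ ∀ u : X → ℝ, Measurable u →
      MemLpLoc u (ENNReal.ofReal σ) μ → ∀ r : ℝ, 0 < r →
        eLpNorm (fun x => pointOsc σ μ u x r ^ (1 / σ)) p μ ^ a ≤
          K * ∑' j : ℕ, 2 ^ (δ * j) * oscNorm σ p μ u (r / 2 ^ j) ^ a := by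
  have := hμ.secondCountableTopology
  have := hμ.sigmaFinite
  obtain ⟨a, ha, hsum⟩ := exists_eLpNorm_rpow_le_of_ae_le_tsum X hp
  refine ⟨a, ha, fun δ hδ => ?_⟩
  obtain ⟨K, hK, hKsum⟩ := hsum (δ / 2) (half_pos hδ)
  obtain ⟨L, hL, htelescope⟩ := hμ.exists_ae_pointOsc_rpow_le_tsum hσ h1 (e := 1 / σ)
    (δ := δ / 2 / a) (by positivity) (by positivity)
  refine ⟨L ^ a * K, ENNReal.mul_ne_top (ENNReal.rpow_ne_top_of_nonneg ha.le hL) hK,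
    fun u hu hloc r hr => ?_⟩
  have hle := hKsum μ _ _ L (δ / 2 / a) hL
    (fun j => measurable_doubleOsc_rpow hu σ (r / 2 ^ j) (1 / σ))
    ((htelescope u hu hloc).mono fun x hx => hx r hr)
  rwa [div_mul_cancel₀ _ ha.ne', add_halves] at hle

theorem exists_differenceModulus_top_le (hμ : IsDoubling μ C₁ n) (hσ : 0 < σ) (h1 : σ ≤ 1) :
    ∃ K : ℝ≥0∞, K ≠ ∞ ∧ ∀ u : X → ℝ, Measurable u → ∀ t : ℝ,
      differenceModulus u ∞ μ t ≤
        K * eLpNorm (fun x => pointOsc σ μ u x (2 * t) ^ (1 / σ)) ∞ μ := by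
  obtain ⟨K, hK, hdiff⟩ := hμ.exists_enorm_sub_rpow_le hσ h1 zero_le_one
  refine ⟨K * 2, ENNReal.mul_ne_top hK ENNReal.ofNat_ne_top, fun u hu t => ?_⟩
  simp only [differenceModulus, if_true, eLpNorm_exponent_top, eLpNormEssSup, enorm_eq_self]
  set S := essSup (fun x => pointOsc σ μ u x (2 * t) ^ (1 / σ)) μ
  have hS : ∀ᵐ x ∂μ, pointOsc σ μ u x (2 * t) ^ (1 / σ) ≤ S := ENNReal.ae_le_essSup _
  refine essSup_le_of_ae_le _ ?_
  filter_upwards [hS] with x hx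
  refine essSup_le_of_ae_le _ ?_
  filter_upwards [ae_restrict_of_ae hS, ae_restrict_mem measurableSet_ball] with y hy hyx
  calc ‖u x - u y‖ₑ ≤ K * (pointOsc σ μ u x (2 * t) ^ (1 / σ) +
        pointOsc σ μ u y (2 * t) ^ (1 / σ)) := by
        simpa only [ENNReal.rpow_one] using hdiff u hu x y t (mem_ball'.1 hyx)
    _ ≤ K * (S + S) := by gcongr
    _ = K * 2 * S := by rw [mul_assoc, two_mul S]

theorem exists_lintegral_laverage_enorm_sub_rpow_le (hμ : IsDoubling μ C₁ n) (hσ : 0 < σ)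
    (h1 : σ ≤ 1) {τ : ℝ} (hτ : 0 ≤ τ) :
    ∃ K : ℝ≥0∞, K ≠ ∞ ∧ ∀ u : X → ℝ, Measurable u → ∀ t : ℝ, 0 < t →
      ∫⁻ x, ⨍⁻ y in ball x t, ‖u x - u y‖ₑ ^ τ ∂μ ∂μ ≤
        K * ∫⁻ x, pointOsc σ μ u x (2 * t) ^ (τ / σ) ∂μ := by
  have := hμ.secondCountableTopology
  have := hμ.sigmaFinite
  obtain ⟨K, hK, hdiff⟩ := hμ.exists_enorm_sub_rpow_le hσ h1 hτ
  refine ⟨K * (1 + doublingFactor C₁ n 2), ENNReal.mul_ne_top hK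
    (ENNReal.add_ne_top.2 ⟨ENNReal.one_ne_top, doublingFactor_ne_top _ _ _⟩), fun u hu t ht => ?_⟩
  have hmeas := measurable_pointOsc_rpow (μ := μ) hu σ (2 * t) (τ / σ)
  calc ∫⁻ x, ⨍⁻ y in ball x t, ‖u x - u y‖ₑ ^ τ ∂μ ∂μ
      ≤ ∫⁻ x, ⨍⁻ y in ball x t, K * (pointOsc σ μ u x (2 * t) ^ (τ / σ) +
          pointOsc σ μ u y (2 * t) ^ (τ / σ)) ∂μ ∂μ :=
        lintegral_mono fun x => setLAverage_mono_on measurableSet_ball fun y hy =>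
          hdiff u hu x y t (mem_ball'.1 hy)
    _ = K * (∫⁻ x, pointOsc σ μ u x (2 * t) ^ (τ / σ) ∂μ +
          ∫⁻ x, ⨍⁻ y in ball x t, pointOsc σ μ u y (2 * t) ^ (τ / σ) ∂μ ∂μ) := by
        rw [← lintegral_add_left hmeas, ← lintegral_const_mul' _ _ hK]
        refine lintegral_congr fun x => ?_
        rw [laverage_const_mul hK, laverage_add_left measurable_const,
          hμ.laverage_ball_const x ht]
    _ ≤ _ := by
        rw [mul_assoc, add_mul, one_mul]
        gcongr
        exact hμ.lintegral_laverage_le ht hmeas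

theorem exists_differenceModulus_le (hμ : IsDoubling μ C₁ n) (hσ : 0 < σ) (h1 : σ ≤ 1)
    (hp : p ≠ 0) :
    ∃ K : ℝ≥0∞, K ≠ ∞ ∧ ∀ u : X → ℝ, Measurable u → ∀ t : ℝ, 0 < t →
      differenceModulus u p μ t ≤
        K * eLpNorm (fun x => pointOsc σ μ u x (2 * t) ^ (1 / σ)) p μ := by
  by_cases hpt : p = ∞
  · subst hpt
    exact (hμ.exists_differenceModulus_top_le hσ h1).imp fun K hK =>
      ⟨hK.1, fun u hu t _ => hK.2 u hu t⟩
  · obtain ⟨K, hK, hint⟩ := hμ.exists_lintegral_laverage_enorm_sub_rpow_le hσ h1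
      (τ := p.toReal) ENNReal.toReal_nonneg
    refine ⟨K ^ (1 / p.toReal), ENNReal.rpow_ne_top_of_nonneg (by positivity) hK,
      fun u hu t ht => ?_⟩
    rw [differenceModulus, if_neg hpt, eLpNorm_eq_lintegral_rpow hp hpt,
      ← ENNReal.mul_rpow_of_nonneg _ _ (by positivity)]
    gcongr ?_ ^ _
    simpa only [← ENNReal.rpow_mul, div_mul_eq_mul_div, one_mul] using hint u hu t ht

theorem exists_besovNorm_le_oscSeminorm_of_le_one (hμ : IsDoubling μ C₁ n) (hσ : 0 < σ)
    (h1 : σ ≤ 1) (hs : 0 < s) (hp : p ≠ 0) (hq : q ≠ 0) :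
    ∃ K : ℝ≥0∞, K ≠ ∞ ∧ ∀ u : X → ℝ, Measurable u → MemLpLoc u (ENNReal.ofReal σ) μ →
      besovNorm s p q μ u ≤ K * oscSeminorm s σ p q μ u := by
  have := hμ.secondCountableTopology
  have := hμ.sigmaFinite
  obtain ⟨a, ha, hpoint⟩ := hμ.exists_eLpNorm_pointOsc_le hσ h1 hp
  obtain ⟨K, hK, hKsum⟩ := hpoint (s * a / 2) (by positivity)
  obtain ⟨M, hM, hdiff⟩ := hμ.exists_differenceModulus_le hσ h1 hp
  obtain ⟨K', hK', hhardy⟩ := exists_scaleNorm_weighted_le hq (s := s) (θ := s * a / 2) (c := 2)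
    ha (half_lt_self (by positivity)) two_pos
    (ENNReal.mul_ne_top (ENNReal.rpow_ne_top_of_nonneg ha.le hM) hK)
  refine ⟨K', hK', fun u hu hloc => ?_⟩
  rw [besovNorm_eq_scaleNorm]
  refine hhardy _ _ (measurable_oscNorm hu σ p) fun t ht => ?_
  calc differenceModulus u p μ t ^ a
      ≤ (M * eLpNorm (fun x => pointOsc σ μ u x (2 * t) ^ (1 / σ)) p μ) ^ a := by
        gcongr
        exact hdiff u hu t ht
    _ ≤ _ := by
        rw [ENNReal.mul_rpow_of_nonneg _ _ ha.le, mul_assoc]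
        gcongr
        exact hKsum u hu hloc _ (by positivity)

end IsDoubling

end OscSeminorm

section MaximalFunctional

variable {X : Type*} [MetricSpace X] [MeasurableSpace X] {μ : Measure X} {C₁ n s σ ε : ℝ}

theorem ofReal_rpow_mul_rpow_neg_le {r t : ℝ} {j : ℕ} (hε : 0 ≤ ε) (hr : 0 < r) (ht : 0 < t)
    (htr : t < 2 ^ (j + 1) * r) :
    ENNReal.ofReal (t ^ ε) * ENNReal.ofReal (r ^ (-ε)) ≤ 2 ^ ε * 2 ^ (ε * j) := by
  have hpow : (2 : ℝ) ^ (ε + ε * j) = (2 ^ (j + 1)) ^ ε := by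
    rw [← Real.rpow_natCast, ← Real.rpow_mul zero_le_two]
    push_cast
    ring_nf
  rw [← ENNReal.ofReal_mul (by positivity), ← two_rpow_add, two_rpow_eq_ofReal, hpow,
    Real.rpow_neg hr.le, ← div_eq_mul_inv, ← Real.div_rpow ht.le hr.le]
  gcongr
  exact (div_le_iff₀ hr).2 htr.le

theorem functionalS_eq_mul {t : ℝ} (ht : 0 < t) (s ε σ : ℝ) (u : X → ℝ) (x : X) :
    functionalS s ε σ μ u t x = ENNReal.ofReal (t ^ (-s)) * functionalS 0 ε σ μ u t x := by
  simp only [functionalS, sub_zero]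
  rw [← mul_assoc, ← ENNReal.ofReal_mul (by positivity), ← Real.rpow_add ht, neg_add_eq_sub]

namespace IsDoubling

theorem functionalS_zero_le_tsum (hμ : IsDoubling μ C₁ n) (hσ : 0 < σ) (hε : 0 ≤ ε)
    (u : X → ℝ) {t : ℝ} (ht : 0 < t) (x : X) :
    functionalS 0 ε σ μ u t x ≤ 2 ^ ε * (doublingFactor C₁ n 3 ^ 2) ^ (1 / σ) *
      ∑' j : ℕ, 2 ^ (ε * j) * doubleOsc σ μ u x (t / 2 ^ j) ^ (1 / σ) := by
  simp only [functionalS, sub_zero, ENNReal.mul_iSup]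
  refine iSup₂_le fun r hr => ?_
  obtain ⟨j, hjle, hjlt⟩ := exists_nat_pow_near ((one_le_div hr.1).2 hr.2) one_lt_two
  rw [le_div_iff₀ hr.1] at hjle
  rw [div_lt_iff₀ hr.1] at hjlt
  have h2j : (0 : ℝ) < 2 ^ j := by positivity
  have hrt : r ≤ t / 2 ^ j := by rw [le_div_iff₀ h2j]; linarith
  have htr : t / 2 ^ j ≤ 3 * r := by rw [div_le_iff₀ h2j]; nlinarith [hr.1, pow_succ (2 : ℝ) j]
  have hosc : bestConst σ μ u r x ≤ doublingFactor C₁ n 3 ^ 2 * doubleOsc σ μ u x (t / 2 ^ j) :=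
    (hμ.bestConst_le_doubleOsc σ u x hr.1).trans (hμ.doubleOsc_le_doubleOsc σ u hr.1
      (by norm_num) (ball_subset_ball hrt) (ball_subset_ball htr))
  calc ENNReal.ofReal (t ^ ε) * (ENNReal.ofReal (r ^ (-ε)) * bestConst σ μ u r x ^ (1 / σ))
      ≤ (2 ^ ε * 2 ^ (ε * j)) *
        (doublingFactor C₁ n 3 ^ 2 * doubleOsc σ μ u x (t / 2 ^ j)) ^ (1 / σ) := by
        rw [← mul_assoc]
        exact mul_le_mul' (ofReal_rpow_mul_rpow_neg_le hε hr.1 ht hjlt) (by gcongr)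
    _ = 2 ^ ε * (doublingFactor C₁ n 3 ^ 2) ^ (1 / σ) *
        (2 ^ (ε * j) * doubleOsc σ μ u x (t / 2 ^ j) ^ (1 / σ)) := by
        rw [ENNReal.mul_rpow_of_nonneg _ _ (by positivity)]
        ring
    _ ≤ _ := by
        gcongr
        exact ENNReal.le_tsum
          (f := fun j : ℕ => 2 ^ (ε * j) * doubleOsc σ μ u x (t / 2 ^ j) ^ (1 / σ)) j

theorem exists_besovTypeNorm_functionalS_le_oscSeminorm [BorelSpace X] (hμ : IsDoubling μ C₁ n)
    (hσ : 0 < σ) (hε : 0 ≤ ε) (hεs : ε < s) {p q : ℝ≥0∞} (hp : p ≠ 0) (hq : q ≠ 0) :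
    ∃ K : ℝ≥0∞, K ≠ ∞ ∧ ∀ u : X → ℝ, Measurable u →
      besovTypeNorm p q μ (functionalS s ε σ μ u) ≤ K * oscSeminorm s σ p q μ u := by
  have := hμ.secondCountableTopology
  have := hμ.sigmaFinite
  have : 0 < s - ε := sub_pos.2 hεs
  obtain ⟨a, ha, hsum⟩ := exists_eLpNorm_rpow_le_of_ae_le_tsum X hp
  obtain ⟨K, hK, hKsum⟩ := hsum ((s - ε) * a / 2) (by positivity)
  set L := (2 : ℝ≥0∞) ^ ε * (doublingFactor C₁ n 3 ^ 2) ^ (1 / σ)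
  have hL : L ≠ ∞ := ENNReal.mul_ne_top (two_rpow_ne_top _) (ENNReal.rpow_ne_top_of_nonneg
    (by positivity) (ENNReal.pow_ne_top (doublingFactor_ne_top _ _ _)))
  obtain ⟨K', hK', hhardy⟩ := exists_scaleNorm_weighted_le hq (s := s)
    (θ := (s - ε) * a / 2 + ε * a) (c := 1) ha (by nlinarith) one_pos
    (ENNReal.mul_ne_top (ENNReal.rpow_ne_top_of_nonneg ha.le hL) hK)
  refine ⟨K', hK', fun u hu => ?_⟩
  have hweight (t : ℝ) (ht : 0 < t) : eLpNorm (functionalS s ε σ μ u t) p μ =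
      ENNReal.ofReal (t ^ (-s)) * eLpNorm (functionalS 0 ε σ μ u t) p μ := by
    rw [← eLpNorm_const_mul_ennreal hp ENNReal.ofReal_ne_top]
    exact congrArg (eLpNorm · p μ) (funext fun x => functionalS_eq_mul ht s ε σ u x)
  refine (scaleNorm_mono fun t ht => (hweight t ht).le).trans
    (hhardy _ _ (measurable_oscNorm hu σ p) fun t ht => ?_)
  rw [one_mul]
  exact hKsum μ _ _ L ε hL (fun j => measurable_doubleOsc_rpow hu σ (t / 2 ^ j) (1 / σ))
    (.of_forall fun x => hμ.functionalS_zero_le_tsum hσ hε u ht x)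

end IsDoubling

end MaximalFunctional

section Sobolev

theorem setLAverage_rpow_one_add_le {α : Type*} [MeasurableSpace α] {ν : Measure α} {s : Set α}
    (hs : MeasurableSet s) {f : α → ℝ≥0∞} (hf : Measurable f) {b : ℝ} (hb : 0 ≤ b) {M : ℝ≥0∞}
    (hM : ∀ x ∈ s, f x ≤ M) :
    ⨍⁻ x in s, f x ^ (1 + b) ∂ν ≤ (⨍⁻ x in s, f x ∂ν) * M ^ b := by
  rw [← laverage_mul_const hf]
  refine setLAverage_mono_on hs fun x hx => ?_
  rw [ENNReal.rpow_add_of_nonneg _ _ zero_le_one hb, ENNReal.rpow_one]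
  gcongr
  exact hM x hx

variable {X : Type*} [MetricSpace X] [MeasurableSpace X] {μ : Measure X} {C₁ n σ τ : ℝ}
  {p q : ℝ≥0∞}

namespace IsDoubling

theorem one_le_doublingFactor (hμ : IsDoubling μ C₁ n) {lam : ℝ} (h : 1 ≤ lam) :
    1 ≤ doublingFactor C₁ n lam :=
  ENNReal.one_le_ofReal.2
    (one_le_mul_of_one_le_of_one_le hμ.one_lt.le (Real.one_le_rpow h hμ.exponent_pos.le))

theorem doublingFactor_mul_two_pow (hμ : IsDoubling μ C₁ n) {lam : ℝ} (hlam : 0 ≤ lam) (j : ℕ) :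
    doublingFactor C₁ n (lam * 2 ^ j) = doublingFactor C₁ n lam * 2 ^ (n * j) := by
  have := one_pos.trans hμ.one_lt
  rw [doublingFactor, doublingFactor, two_rpow_eq_ofReal, ← ENNReal.ofReal_mul (by positivity),
    Real.mul_rpow hlam (by positivity), ← Real.rpow_natCast 2 j, ← Real.rpow_mul zero_le_two,
    mul_comm (j : ℝ), mul_assoc]

theorem doubleOsc_rpow_le_of_dist_lt (hμ : IsDoubling μ C₁ n) {e : ℝ} (he : 0 ≤ e) (u : X → ℝ)
    {x z : X} {r : ℝ} (hxz : dist x z < r) :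
    doubleOsc σ μ u x r ^ e ≤
      (doublingFactor C₁ n 3 ^ 2) ^ e * doubleOsc σ μ u z (2 * r) ^ e := by
  rw [← ENNReal.mul_rpow_of_nonneg _ _ he]
  gcongr
  have hr := dist_nonneg.trans_lt hxz
  exact hμ.doubleOsc_le_doubleOsc σ u hr (by norm_num) (ball_subset_ball' (by linarith))
    (ball_subset_ball' (by rw [dist_comm]; linarith))

theorem laverage_doubleOsc_rpow_le (hμ : IsDoubling μ C₁ n) {e : ℝ} (he : 0 ≤ e) (u : X → ℝ)
    (w : X) {r t lam : ℝ} (hr : 0 < r) (ht : 0 < t) (hlam : 1 < lam) :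
    ⨍⁻ x in ball w t, doubleOsc σ μ u x r ^ e ∂μ ≤ (doublingFactor C₁ n 3 ^ 2) ^ e *
      (doublingFactor C₁ n lam * ⨍⁻ z in ball w (lam * t), doubleOsc σ μ u z (2 * r) ^ e ∂μ) :=
  calc ⨍⁻ x in ball w t, doubleOsc σ μ u x r ^ e ∂μ
      ≤ ⨍⁻ x in ball w t, (doublingFactor C₁ n 3 ^ 2) ^ e * doubleOsc σ μ u x (2 * r) ^ e ∂μ :=
        laverage_mono fun x => hμ.doubleOsc_rpow_le_of_dist_lt he u (by rwa [dist_self])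
    _ ≤ _ := by
        rw [laverage_const_mul (ENNReal.rpow_ne_top_of_nonneg he
          (ENNReal.pow_ne_top (doublingFactor_ne_top _ _ _)))]
        gcongr
        exact hμ.laverage_ball_le ht hlam (ball_subset_ball (le_mul_of_one_le_left ht.le hlam.le))
          Subset.rfl _

variable [BorelSpace X]

theorem doubleOsc_rpow_le_laverage (hμ : IsDoubling μ C₁ n) {e : ℝ} (he : 0 ≤ e) (u : X → ℝ)
    {x : X} {r lam : ℝ} (hr : 0 < r) (hlam : 1 < lam) {s : Set X} (hrs : ball x r ⊆ s)
    (hsr : s ⊆ ball x (lam * r)) :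
    doubleOsc σ μ u x r ^ e ≤ (doublingFactor C₁ n 3 ^ 2) ^ e *
      (doublingFactor C₁ n lam * ⨍⁻ z in s, doubleOsc σ μ u z (2 * r) ^ e ∂μ) :=
  calc doubleOsc σ μ u x r ^ e = ⨍⁻ _ in ball x r, doubleOsc σ μ u x r ^ e ∂μ :=
        (hμ.laverage_ball_const x hr _).symm
    _ ≤ ⨍⁻ z in ball x r, (doublingFactor C₁ n 3 ^ 2) ^ e * doubleOsc σ μ u z (2 * r) ^ e ∂μ :=
        setLAverage_mono_on measurableSet_ball fun z hz =>
          hμ.doubleOsc_rpow_le_of_dist_lt he u (mem_ball'.1 hz)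
    _ ≤ _ := by
        rw [laverage_const_mul (ENNReal.rpow_ne_top_of_nonneg he
          (ENNReal.pow_ne_top (doublingFactor_ne_top _ _ _)))]
        gcongr
        exact hμ.laverage_ball_le hr hlam hrs hsr _

theorem doubleOsc_rpow_le_two_rpow_mul_laverage (hμ : IsDoubling μ C₁ n) {e : ℝ} (he : 0 ≤ e)
    (u : X → ℝ) {w x : X} {t : ℝ} (hx : x ∈ ball w t) (j : ℕ) :
    doubleOsc σ μ u x (4 * t / 2 ^ j) ^ e ≤ (doublingFactor C₁ n 3 ^ 2) ^ e *
      (doublingFactor C₁ n 2 * 2 ^ (n * j) *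
        ⨍⁻ z in ball w (5 * t), doubleOsc σ μ u z (2 * (4 * t / 2 ^ j)) ^ e ∂μ) := by
  have ht : 0 < t := pos_of_mem_ball hx
  have hxw : dist x w < t := hx
  have hrt : 4 * t / 2 ^ j ≤ 4 * t := div_le_self (by positivity) (one_le_pow₀ one_le_two)
  have hrj : 2 * 2 ^ j * (4 * t / 2 ^ j) = 8 * t := by field_simp; norm_num
  rw [← hμ.doublingFactor_mul_two_pow zero_le_two]
  refine hμ.doubleOsc_rpow_le_laverage he u (by positivity) ?_ (ball_subset_ball' (by linarith))
    (ball_subset_ball' (by rw [hrj, dist_comm]; linarith))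
  linarith [one_le_pow₀ (n := j) (one_le_two (α := ℝ))]

/- Applying the pointwise bound only to the part of the exponent that exceeds `P` raises the
integrability from `P` to `τ` at the cost of the factor `2 ^ (n (τ / P - 1) j)`: `p_*(s)` is the
exponent at which this loss balances the smoothness `s`. -/
theorem exists_laverage_doubleOsc_rpow_le (hμ : IsDoubling μ C₁ n) {P : ℝ}
    (hσ : 0 < σ) (hP : 0 < P) (hPτ : P ≤ τ) :
    ∃ K : ℝ≥0∞, K ≠ ∞ ∧ ∀ u : X → ℝ, Measurable u → ∀ (w : X) (t : ℝ), 0 < t → ∀ j : ℕ,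
      ⨍⁻ x in ball w t, doubleOsc σ μ u x (4 * t / 2 ^ j) ^ (τ / σ) ∂μ ≤
        K * (2 ^ (n * (τ / P - 1) * j) *
          (⨍⁻ z in ball w (5 * t), doubleOsc σ μ u z (8 * t / 2 ^ j) ^ (P / σ) ∂μ) ^ (τ / P)) := by
  have := hμ.secondCountableTopology
  have := hμ.sigmaFinite
  obtain ⟨b, hb⟩ : ∃ b, τ / P - 1 = b := ⟨_, rfl⟩
  have hb0 : 0 ≤ b := by rw [← hb, sub_nonneg, one_le_div hP]; exact hPτ
  have hτP : τ / P = 1 + b := by rw [← hb]; ring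
  have hτσ : τ / σ = P / σ * (1 + b) := by rw [← hτP]; field_simp
  have hPσ : 0 ≤ P / σ := by positivity
  set L := (doublingFactor C₁ n 3 ^ 2) ^ (P / σ)
  have hLD (lam : ℝ) : L * doublingFactor C₁ n lam ≠ ∞ := ENNReal.mul_ne_top
    (ENNReal.rpow_ne_top_of_nonneg hPσ (ENNReal.pow_ne_top (doublingFactor_ne_top _ _ _)))
    (doublingFactor_ne_top _ _ _)
  refine ⟨L * doublingFactor C₁ n 5 * (L * doublingFactor C₁ n 2) ^ b,
    ENNReal.mul_ne_top (hLD 5) (ENNReal.rpow_ne_top_of_nonneg hb0 (hLD 2)),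
    fun u hu w t ht j => ?_⟩
  rw [show 8 * t / 2 ^ j = 2 * (4 * t / 2 ^ j) by ring, hb, hτP, hτσ]
  set A := ⨍⁻ z in ball w (5 * t), doubleOsc σ μ u z (2 * (4 * t / 2 ^ j)) ^ (P / σ) ∂μ
  simp_rw [ENNReal.rpow_mul (doubleOsc σ μ u _ _)]
  calc ⨍⁻ x in ball w t, (doubleOsc σ μ u x (4 * t / 2 ^ j) ^ (P / σ)) ^ (1 + b) ∂μ
      ≤ (⨍⁻ x in ball w t, doubleOsc σ μ u x (4 * t / 2 ^ j) ^ (P / σ) ∂μ) *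
          (L * (doublingFactor C₁ n 2 * 2 ^ (n * j) * A)) ^ b :=
        setLAverage_rpow_one_add_le measurableSet_ball (measurable_doubleOsc_rpow hu σ _ _) hb0
          fun x hx => hμ.doubleOsc_rpow_le_two_rpow_mul_laverage hPσ u hx j
    _ ≤ L * (doublingFactor C₁ n 5 * A) *
          (L * (doublingFactor C₁ n 2 * 2 ^ (n * j) * A)) ^ b := by
        gcongr
        exact hμ.laverage_doubleOsc_rpow_le hPσ u w (by positivity) ht (by norm_num)
    _ = _ := by
        simp only [ENNReal.mul_rpow_of_nonneg _ _ hb0, ← ENNReal.rpow_mul]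
        rw [ENNReal.rpow_add_of_nonneg _ _ zero_le_one hb0, ENNReal.rpow_one,
          mul_right_comm n b]
        ring

theorem exists_doubleOsc_le_laverage_pointOsc (hμ : IsDoubling μ C₁ n) (hσ : 0 < σ)
    (h1 : σ ≤ 1) (hτ : 0 ≤ τ) :
    ∃ K : ℝ≥0∞, K ≠ ∞ ∧ ∀ u : X → ℝ, Measurable u → ∀ (w : X) (t : ℝ), 0 < t →
      doubleOsc τ μ u w t ≤ K * ⨍⁻ x in ball w t, pointOsc σ μ u x (4 * t) ^ (τ / σ) ∂μ := by
  have := hμ.secondCountableTopology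
  have := hμ.sigmaFinite
  obtain ⟨K, hK, hdiff⟩ := hμ.exists_enorm_sub_rpow_le hσ h1 hτ
  refine ⟨K * 2, ENNReal.mul_ne_top hK ENNReal.ofNat_ne_top, fun u hu w t ht => ?_⟩
  have hmeas := measurable_pointOsc_rpow (μ := μ) hu σ (4 * t) (τ / σ)
  calc doubleOsc τ μ u w t
      ≤ ⨍⁻ y in ball w t, ⨍⁻ z in ball w t, K * (pointOsc σ μ u y (4 * t) ^ (τ / σ) +
          pointOsc σ μ u z (4 * t) ^ (τ / σ)) ∂μ ∂μ := by
        refine setLAverage_mono_on measurableSet_ball fun y hy =>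
          setLAverage_mono_on measurableSet_ball fun z hz => ?_
        have hyz : dist y z < 2 * t := by
          linarith [dist_triangle_right y z w, mem_ball.1 hy, mem_ball.1 hz]
        simpa only [show 2 * (2 * t) = 4 * t by ring] using hdiff u hu y z (2 * t) hyz
    _ = K * 2 * ⨍⁻ x in ball w t, pointOsc σ μ u x (4 * t) ^ (τ / σ) ∂μ := by
        simp_rw [laverage_const_mul hK, laverage_add_left measurable_const,
          hμ.laverage_ball_const w ht]
        rw [laverage_add_left hmeas, hμ.laverage_ball_const w ht, mul_assoc, two_mul]

theorem exists_doubleOsc_le_tsum_laverage (hμ : IsDoubling μ C₁ n) {δ : ℝ}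
    (hσ : 0 < σ) (h1 : σ ≤ 1) (hτ : 0 < τ) (hδ : 0 < δ) :
    ∃ K : ℝ≥0∞, K ≠ ∞ ∧ ∀ u : X → ℝ, Measurable u → MemLpLoc u (ENNReal.ofReal σ) μ →
      ∀ (w : X) (t : ℝ), 0 < t → doubleOsc τ μ u w t ≤ K * ∑' j : ℕ, 2 ^ (δ * j) *
        ⨍⁻ x in ball w t, doubleOsc σ μ u x (4 * t / 2 ^ j) ^ (τ / σ) ∂μ := by
  have := hμ.secondCountableTopology
  have := hμ.sigmaFinite
  obtain ⟨K, hK, hpoint⟩ := hμ.exists_doubleOsc_le_laverage_pointOsc hσ h1 hτ.le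
  obtain ⟨L, hL, htelescope⟩ := hμ.exists_ae_pointOsc_rpow_le_tsum hσ h1 (e := τ / σ)
    (by positivity) hδ
  refine ⟨K * L, ENNReal.mul_ne_top hK hL, fun u hu hloc w t ht => (hpoint u hu w t ht).trans ?_⟩
  rw [mul_assoc]
  gcongr
  calc ⨍⁻ x in ball w t, pointOsc σ μ u x (4 * t) ^ (τ / σ) ∂μ
      ≤ ⨍⁻ x in ball w t, L * ∑' j : ℕ, 2 ^ (δ * j) *
          doubleOsc σ μ u x (4 * t / 2 ^ j) ^ (τ / σ) ∂μ :=
        laverage_mono_ae (ae_restrict_of_ae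
          ((htelescope u hu hloc).mono fun x hx => hx _ (by positivity)))
    _ = _ := by
        rw [laverage_const_mul hL, laverage, lintegral_tsum fun j =>
          ((measurable_doubleOsc_rpow hu σ _ _).const_mul _).aemeasurable]
        congr 1
        exact tsum_congr fun j => laverage_const_mul (two_rpow_ne_top _)

theorem exists_doubleOsc_rpow_le_tsum_laverage (hμ : IsDoubling μ C₁ n) {P δ : ℝ}
    (hσ : 0 < σ) (h1 : σ ≤ 1) (hP : 0 < P) (hPτ : P ≤ τ) (hδ : 0 < δ) :
    ∃ K : ℝ≥0∞, K ≠ ∞ ∧ ∀ u : X → ℝ, Measurable u → MemLpLoc u (ENNReal.ofReal σ) μ →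
      ∀ (w : X) (t : ℝ), 0 < t → doubleOsc τ μ u w t ^ (P / τ) ≤
        K * ∑' j : ℕ, 2 ^ ((δ + n * (1 - P / τ)) * j) *
          ⨍⁻ z in ball w (5 * t), doubleOsc σ μ u z (8 * t / 2 ^ j) ^ (P / σ) ∂μ := by
  have hτ : 0 < τ := hP.trans_le hPτ
  have hPτ1 : P / τ ≤ 1 := (div_le_one hτ).2 hPτ
  have he : 0 < P / τ := by positivity
  obtain ⟨K, hK, hsum⟩ := hμ.exists_doubleOsc_le_tsum_laverage hσ h1 hτ (half_pos hδ)
  obtain ⟨L, hL, hsobolev⟩ := hμ.exists_laverage_doubleOsc_rpow_le hσ hP hPτ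
  obtain ⟨M, hM, hMsum⟩ := exists_tsum_rpow_le he (half_pos hδ)
  refine ⟨(K * L) ^ (P / τ) * M, ENNReal.mul_ne_top (ENNReal.rpow_ne_top_of_nonneg he.le
    (ENNReal.mul_ne_top hK hL)) hM, fun u hu hloc w t ht => ?_⟩
  set A : ℕ → ℝ≥0∞ := fun j =>
    ⨍⁻ z in ball w (5 * t), doubleOsc σ μ u z (8 * t / 2 ^ j) ^ (P / σ) ∂μ
  calc doubleOsc τ μ u w t ^ (P / τ)
      ≤ (K * L * ∑' j : ℕ, 2 ^ (δ / 2 * j) *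
          (2 ^ (n * (τ / P - 1) * j) * A j ^ (τ / P))) ^ (P / τ) := by
        gcongr
        refine (hsum u hu hloc w t ht).trans ?_
        rw [mul_assoc, ← ENNReal.tsum_mul_left (a := L)]
        refine mul_le_mul' le_rfl (ENNReal.tsum_le_tsum fun j => ?_)
        rw [mul_left_comm L]
        gcongr
        exact hsobolev u hu w t ht j
    _ ≤ (K * L) ^ (P / τ) * (M * ∑' j : ℕ, 2 ^ (δ / 2 * j) * (2 ^ (δ / 2 * j) *
          (2 ^ (n * (τ / P - 1) * j) * A j ^ (τ / P))) ^ (P / τ)) := by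
        rw [ENNReal.mul_rpow_of_nonneg _ _ he.le]
        gcongr
        exact hMsum _
    _ ≤ _ := by
        rw [mul_assoc]
        gcongr _ * (_ * ∑' j, ?_) with j
        rw [ENNReal.mul_rpow_of_nonneg _ _ he.le, ENNReal.mul_rpow_of_nonneg _ _ he.le,
          ← ENNReal.rpow_mul, ← ENNReal.rpow_mul, ← ENNReal.rpow_mul,
          show τ / P * (P / τ) = 1 by field_simp, ENNReal.rpow_one, ← mul_assoc, ← mul_assoc,
          ← two_rpow_add, ← two_rpow_add,
          show n * (τ / P - 1) * j * (P / τ) = n * (1 - P / τ) * j by field_simp]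
        gcongr
        · norm_num
        · linarith [mul_le_of_le_one_right (show 0 ≤ δ / 2 * j by positivity) hPτ1]

theorem exists_oscNorm_rpow_le_tsum (hμ : IsDoubling μ C₁ n) {δ : ℝ} (hσ : 0 < σ) (h1 : σ ≤ 1)
    (hp : p ≠ 0) (hpt : p ≠ ∞) (hpτ : p.toReal ≤ τ) (hδ : 0 < δ) :
    ∃ K : ℝ≥0∞, K ≠ ∞ ∧ ∀ u : X → ℝ, Measurable u → MemLpLoc u (ENNReal.ofReal σ) μ →
      ∀ t : ℝ, 0 < t → oscNorm τ p μ u t ^ p.toReal ≤ K * ∑' j : ℕ,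
        2 ^ ((δ + n * (1 - p.toReal / τ)) * j) * oscNorm σ p μ u (8 * t / 2 ^ j) ^ p.toReal := by
  have := hμ.secondCountableTopology
  have := hμ.sigmaFinite
  have hP : 0 < p.toReal := ENNReal.toReal_pos hp hpt
  obtain ⟨K, hK, hpoint⟩ := hμ.exists_doubleOsc_rpow_le_tsum_laverage hσ h1 hP hpτ hδ
  set D := doublingFactor C₁ n 5 * doublingFactor C₁ n 2
  have hD : D ≠ ∞ := ENNReal.mul_ne_top (doublingFactor_ne_top _ _ _) (doublingFactor_ne_top _ _ _)
  refine ⟨K * D, ENNReal.mul_ne_top hK hD, fun u hu hloc t ht => ?_⟩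
  simp only [oscNorm, eLpNorm_rpow_eq_lintegral_rpow hp hpt, ← ENNReal.rpow_mul,
    div_mul_eq_mul_div, one_mul]
  have hmeas (j : ℕ) := measurable_doubleOsc_rpow (μ := μ) hu σ (8 * t / 2 ^ j) (p.toReal / σ)
  have hmean (j : ℕ) : Measurable fun w =>
      ⨍⁻ z in ball w (5 * t), doubleOsc σ μ u z (8 * t / 2 ^ j) ^ (p.toReal / σ) ∂μ :=
    measurable_laverage_ball measurable_id measurable_const ((hmeas j).comp measurable_snd)
  calc ∫⁻ w, doubleOsc τ μ u w t ^ (p.toReal / τ) ∂μ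
      ≤ ∫⁻ w, K * ∑' j : ℕ, 2 ^ ((δ + n * (1 - p.toReal / τ)) * j) *
          ⨍⁻ z in ball w (5 * t), doubleOsc σ μ u z (8 * t / 2 ^ j) ^ (p.toReal / σ) ∂μ ∂μ :=
        lintegral_mono fun w => hpoint u hu hloc w t ht
    _ = K * ∑' j : ℕ, 2 ^ ((δ + n * (1 - p.toReal / τ)) * j) * ∫⁻ w,
          ⨍⁻ z in ball w (5 * t), doubleOsc σ μ u z (8 * t / 2 ^ j) ^ (p.toReal / σ) ∂μ ∂μ := by
        rw [lintegral_const_mul' _ _ hK,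
          lintegral_tsum fun j => ((hmean j).const_mul _).aemeasurable]
        simp_rw [lintegral_const_mul' _ _ (two_rpow_ne_top _)]
    _ ≤ K * ∑' j : ℕ, 2 ^ ((δ + n * (1 - p.toReal / τ)) * j) *
          (D * ∫⁻ z, doubleOsc σ μ u z (8 * t / 2 ^ j) ^ (p.toReal / σ) ∂μ) := by
        gcongr with j
        refine (hμ.lintegral_laverage_le (by positivity) (hmeas j)).trans ?_
        gcongr
        exact le_mul_of_one_le_left zero_le (hμ.one_le_doublingFactor (by norm_num))
    _ = _ := by
        simp_rw [mul_left_comm _ D]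
        rw [ENNReal.tsum_mul_left, ← mul_assoc]

theorem exists_oscSeminorm_le_oscSeminorm (hμ : IsDoubling μ C₁ n) {s : ℝ} (hσ : 0 < σ)
    (h1 : σ ≤ 1) (hp : p ≠ 0) (hpt : p ≠ ∞) (hpτ : p.toReal ≤ τ) (hq : q ≠ 0)
    (hτs : n * (1 - p.toReal / τ) < s * p.toReal) :
    ∃ K : ℝ≥0∞, K ≠ ∞ ∧ ∀ u : X → ℝ, Measurable u → MemLpLoc u (ENNReal.ofReal σ) μ →
      oscSeminorm s τ p q μ u ≤ K * oscSeminorm s σ p q μ u := by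
  have := hμ.secondCountableTopology
  have := hμ.sigmaFinite
  obtain ⟨δ, hδ, hδs⟩ := exists_between (sub_pos.2 hτs)
  obtain ⟨K, hK, hsum⟩ := hμ.exists_oscNorm_rpow_le_tsum hσ h1 hp hpt hpτ hδ
  obtain ⟨K', hK', hhardy⟩ := exists_scaleNorm_weighted_le hq (s := s) (c := 8)
    (ENNReal.toReal_pos hp hpt) (lt_sub_iff_add_lt.1 hδs) (by norm_num) hK
  exact ⟨K', hK', fun u hu hloc => hhardy _ _ (measurable_oscNorm hu σ p) (hsum u hu hloc)⟩

end IsDoubling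

end Sobolev

section Embeddings

variable {X : Type*}

theorem FunctionSpace.embeds_of_le {A B : FunctionSpace X} {K : ℝ≥0∞} (hK : K ≠ ∞)
    (hA : ∀ u ∈ A.carrier, A.seminorm u < ∞)
    (hAB : ∀ u ∈ A.carrier, B.seminorm u ≤ K * A.seminorm u)
    (hB : ∀ u ∈ A.carrier, B.seminorm u < ∞ → u ∈ B.carrier) : A.Embeds B := by
  refine ⟨K.toReal + 1, by positivity, fun u hu => ⟨hB u hu ?_, (hAB u hu).trans ?_⟩⟩
  · exact (hAB u hu).trans_lt (ENNReal.mul_lt_top hK.lt_top (hA u hu))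
  · gcongr
    exact (ENNReal.le_ofReal_iff_toReal_le hK (by positivity)).2 (by linarith)

theorem FunctionSpace.Embeds.trans {A B C : FunctionSpace X} (hAB : A.Embeds B)
    (hBC : B.Embeds C) : A.Embeds C := by
  obtain ⟨K, hK, hAB⟩ := hAB
  obtain ⟨L, hL, hBC⟩ := hBC
  refine ⟨L * K, mul_pos hL hK, fun u hu => ⟨(hBC u (hAB u hu).1).1, ?_⟩⟩
  refine (hBC u (hAB u hu).1).2.trans ?_
  rw [ENNReal.ofReal_mul hL.le, mul_assoc]
  gcongr
  exact (hAB u hu).2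

end Embeddings

section BesovTypeNorm

variable {X : Type*} [MeasurableSpace X] {μ : Measure X} {p q : ℝ≥0∞} {E F : ℝ → X → ℝ≥0∞}

theorem besovTypeNorm_mono (h : ∀ t, 0 < t → ∀ x, E t x ≤ F t x) :
    besovTypeNorm p q μ E ≤ besovTypeNorm p q μ F :=
  scaleNorm_mono fun t ht => eLpNorm_mono_enorm_ae <| .of_forall <| by
    simpa only [enorm_eq_self] using h t ht

theorem besovTypeNorm_le_mul (hp : p ≠ 0) (hq : q ≠ 0) {K : ℝ≥0∞} (hK : K ≠ ∞)
    (h : ∀ t, 0 < t → ∀ x, E t x ≤ K * F t x) :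
    besovTypeNorm p q μ E ≤ K * besovTypeNorm p q μ F :=
  calc besovTypeNorm p q μ E ≤ besovTypeNorm p q μ fun t x => K * F t x := besovTypeNorm_mono h
    _ = scaleNorm q fun t => K * eLpNorm (F t) p μ := by
        simp only [besovTypeNorm, scaleNorm, eLpNorm_const_mul_ennreal hp hK]
    _ = K * besovTypeNorm p q μ F := scaleNorm_const_mul hq hK _

end BesovTypeNorm

section LocallyIntegrable

variable {X : Type*} [MetricSpace X] [MeasurableSpace X] {μ : Measure X} {C₁ n : ℝ} {u v : X → ℝ}
  {p : ℝ≥0∞}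

namespace IsDoubling

theorem isFiniteMeasure_restrict_ball (hμ : IsDoubling μ C₁ n) (x : X) {r : ℝ} (hr : 0 < r) :
    IsFiniteMeasure (μ.restrict (ball x r)) :=
  isFiniteMeasure_restrict.2 (hμ.ball_ne_top x hr)

theorem neZero_restrict_ball (hμ : IsDoubling μ C₁ n) (x : X) {r : ℝ} (hr : 0 < r) :
    NeZero (μ.restrict (ball x r)) :=
  ⟨by simpa using hμ.ball_ne_zero x hr⟩

theorem exists_mem_ball_of_ae (hμ : IsDoubling μ C₁ n) {P : X → Prop} (h : ∀ᵐ x ∂μ, P x) (x : X)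
    {r : ℝ} (hr : 0 < r) : ∃ y ∈ ball x r, P y := by
  by_contra! hP
  exact hμ.ball_ne_zero x hr (measure_mono_null (fun y hy => hP y hy) h)

end IsDoubling

namespace MemLpLoc

theorem aemeasurable (hu : MemLpLoc u p μ) : AEMeasurable u μ := by
  rcases isEmpty_or_nonempty X with h | ⟨⟨x⟩⟩
  · rw [Measure.eq_zero_of_isEmpty μ]
    exact aemeasurable_zero_measure
  · rw [← Measure.restrict_univ (μ := μ), ← iUnion_ball_nat_succ x, aemeasurable_iUnion_iff]
    exact fun k => (hu x (k + 1) (by positivity)).1.aemeasurable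

theorem congr (hu : MemLpLoc u p μ) (h : u =ᵐ[μ] v) : MemLpLoc v p μ :=
  fun x r hr => (memLp_congr_ae (ae_restrict_of_ae h)).1 (hu x r hr)

theorem mono_exponent (hμ : IsDoubling μ C₁ n) {p' : ℝ≥0∞} (hu : MemLpLoc u p μ)
    (h : p' ≤ p) : MemLpLoc u p' μ := fun x r hr =>
  have := hμ.isFiniteMeasure_restrict_ball x hr
  (hu x r hr).mono_exponent h

theorem of_ae_memLp_ball (hμ : IsDoubling μ C₁ n)
    (h : ∀ R, ∃ t, R < t ∧ ∀ᵐ x ∂μ, MemLp u p (μ.restrict (ball x t))) : MemLpLoc u p μ := by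
  intro x₀ r hr
  obtain ⟨t, hrt, hae⟩ := h (2 * r)
  obtain ⟨x, hx, hux⟩ := hμ.exists_mem_ball_of_ae hae x₀ hr
  have hsub : ball x₀ r ⊆ ball x t := ball_subset_ball' (by linarith [mem_ball'.1 hx])
  exact hux.mono_measure (Measure.restrict_mono hsub le_rfl)

end MemLpLoc

end LocallyIntegrable

section Congruence

variable {X : Type*} [MetricSpace X] [MeasurableSpace X] {μ : Measure X} {u v : X → ℝ}

theorem differenceModulus_congr (h : u =ᵐ[μ] v) (p : ℝ≥0∞) (t : ℝ) :
    differenceModulus u p μ t = differenceModulus v p μ t := by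
  unfold differenceModulus
  split_ifs
  · refine essSup_congr_ae ?_
    filter_upwards [h] with x hx
    refine essSup_congr_ae ?_
    filter_upwards [ae_restrict_of_ae h] with y hy
    rw [hx, hy]
  · congr 1
    refine lintegral_congr_ae ?_
    filter_upwards [h] with x hx
    refine laverage_congr ?_
    filter_upwards [ae_restrict_of_ae h] with y hy
    rw [hx, hy]

theorem besovNorm_congr (h : u =ᵐ[μ] v) (s : ℝ) (p q : ℝ≥0∞) :
    besovNorm s p q μ u = besovNorm s p q μ v := by
  simp only [besovNorm, differenceModulus_congr h]

theorem bestConst_congr (h : u =ᵐ[μ] v) (σ : ℝ) : bestConst σ μ u = bestConst σ μ v := by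
  funext t x
  refine iInf_congr fun c => laverage_congr ?_
  filter_upwards [ae_restrict_of_ae h] with y hy
  rw [hy]

theorem functionalI_congr (h : u =ᵐ[μ] v) (s σ : ℝ) :
    functionalI s σ μ u = functionalI s σ μ v := by
  unfold functionalI
  rw [bestConst_congr h]

theorem functionalS_congr (h : u =ᵐ[μ] v) (s ε σ : ℝ) :
    functionalS s ε σ μ u = functionalS s ε σ μ v := by
  unfold functionalS
  rw [bestConst_congr h]

theorem functionalA_congr (h : u =ᵐ[μ] v) (s σ : ℝ) :
    functionalA s σ μ u = functionalA s σ μ v := by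
  funext t x
  have havg : ⨍ z in ball x t, u z ∂μ = ⨍ z in ball x t, v z ∂μ :=
    average_congr (ae_restrict_of_ae h)
  unfold functionalA
  rw [havg]
  congr 2
  refine laverage_congr ?_
  filter_upwards [ae_restrict_of_ae h] with y hy
  rw [hy]

theorem besovTypeNorm_functionalC_congr (h : u =ᵐ[μ] v) (s σ : ℝ) (p q : ℝ≥0∞) :
    besovTypeNorm p q μ (functionalC s σ μ u) = besovTypeNorm p q μ (functionalC s σ μ v) := by
  have hnorm (t : ℝ) :
      eLpNorm (functionalC s σ μ u t) p μ = eLpNorm (functionalC s σ μ v t) p μ := by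
    refine eLpNorm_congr_ae ?_
    filter_upwards [h] with x hx
    unfold functionalC
    congr 2
    refine laverage_congr ?_
    filter_upwards [ae_restrict_of_ae h] with y hy
    rw [hx, hy]
  simp only [besovTypeNorm, hnorm]

end Congruence

section PowerMeans

theorem laverage_rpow_inv_mono {α : Type*} [MeasurableSpace α] {ν : Measure α} [IsFiniteMeasure ν]
    [NeZero ν] {a b : ℝ} (ha : 0 < a) (hab : a ≤ b) {g : α → ℝ≥0∞} (hg : Measurable g) :
    (⨍⁻ y, g y ^ a ∂ν) ^ (1 / a) ≤ (⨍⁻ y, g y ^ b ∂ν) ^ (1 / b) := by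
  simpa only [eLpNorm', enorm_eq_self, ← laverage_eq'] using
    eLpNorm'_le_eLpNorm'_of_exponent_le ha hab ((ν univ)⁻¹ • ν) hg.aestronglyMeasurable

theorem enorm_average_sub_rpow_le {α : Type*} [MeasurableSpace α] {ν : Measure α}
    [IsFiniteMeasure ν] [NeZero ν] {σ : ℝ} (hσ : 1 ≤ σ) {u : α → ℝ} (hu : Measurable u)
    (hint : Integrable u ν) (c : ℝ) :
    ‖(⨍ z, u z ∂ν) - c‖ₑ ^ σ ≤ ⨍⁻ y, ‖u y - c‖ₑ ^ σ ∂ν := by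
  have hsub : (⨍ z, u z ∂ν) - c = ⨍ z, (u z - c) ∂ν := by
    have hc : ⨍ _, c ∂ν = c := average_const _ c
    simp only [average] at hc ⊢
    rw [integral_sub hint.to_average (integrable_const c), hc]
  have hσ0 : 0 < σ := one_pos.trans_le hσ
  rw [← ENNReal.le_rpow_inv_iff hσ0, hsub, ← one_div]
  calc ‖⨍ z, (u z - c) ∂ν‖ₑ ≤ ⨍⁻ y, ‖u y - c‖ₑ ∂ν := enorm_integral_le_lintegral_enorm _
    _ ≤ (⨍⁻ y, ‖u y - c‖ₑ ^ σ ∂ν) ^ (1 / σ) := by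
        simpa only [ENNReal.rpow_one, div_one] using
          laverage_rpow_inv_mono one_pos hσ (ν := ν) (g := fun y => ‖u y - c‖ₑ) (by fun_prop)

end PowerMeans

section Comparison

variable {X : Type*} [MetricSpace X] [MeasurableSpace X] {μ : Measure X} {C₁ n : ℝ} {u : X → ℝ}
  {s σ t : ℝ} {p q : ℝ≥0∞}

theorem functionalI_le_functionalC (s : ℝ) (hσ : 0 < σ) (t : ℝ) (x : X) :
    functionalI s σ μ u t x ≤ functionalC s σ μ u t x := by
  unfold functionalI functionalC
  gcongr
  exact bestConst_le_pointOsc σ u x t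

theorem functionalI_le_functionalA (s : ℝ) (hσ : 0 < σ) (t : ℝ) (x : X) :
    functionalI s σ μ u t x ≤ functionalA s σ μ u t x := by
  unfold functionalI functionalA
  gcongr
  exact iInf_le _ _

theorem functionalI_le_functionalS (s ε σ : ℝ) (ht : 0 < t) (x : X) :
    functionalI s σ μ u t x ≤ functionalS s ε σ μ u t x := by
  unfold functionalI functionalS
  calc _ = ENNReal.ofReal (t ^ (ε - s)) *
        (ENNReal.ofReal (t ^ (-ε)) * bestConst σ μ u t x ^ (1 / σ)) := by
        rw [← mul_assoc, ← ENNReal.ofReal_mul (by positivity), ← Real.rpow_add ht]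
        congr 3
        ring
    _ ≤ _ := by
        gcongr
        exact le_iSup₂ (f := fun r (_ : r ∈ Ioc (0 : ℝ) t) =>
          ENNReal.ofReal (r ^ (-ε)) * bestConst σ μ u r x ^ (1 / σ)) t ⟨ht, le_rfl⟩

theorem eLpNorm_functionalC_toReal (hp : p ≠ 0) (hpt : p ≠ ∞) (s : ℝ) (u : X → ℝ) (t : ℝ) :
    eLpNorm (functionalC s p.toReal μ u t) p μ =
      ENNReal.ofReal (t ^ (-s)) * differenceModulus u p μ t := by
  have hP : 0 < p.toReal := ENNReal.toReal_pos hp hpt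
  unfold functionalC
  rw [eLpNorm_const_mul_ennreal hp ENNReal.ofReal_ne_top, eLpNorm_eq_lintegral_rpow hp hpt,
    differenceModulus, if_neg hpt]
  simp_rw [← ENNReal.rpow_mul, one_div_mul_cancel hP.ne', ENNReal.rpow_one]

/-- The constant in the comparison of double oscillations with oscillations about the best
constant, `doubleOsc_le_bestConst`, after taking roots. -/
noncomputable def oscConst (σ : ℝ) : ℝ≥0∞ := (2 ^ (σ + 1)) ^ (1 / σ)

theorem oscConst_ne_top (hσ : 0 < σ) : oscConst σ ≠ ∞ :=
  ENNReal.rpow_ne_top_of_nonneg (by positivity) (two_rpow_ne_top _)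

namespace IsDoubling

theorem functionalC_mono (hμ : IsDoubling μ C₁ n) (s : ℝ) {a b : ℝ} (ha : 0 < a) (hab : a ≤ b)
    (hu : Measurable u) (ht : 0 < t) (x : X) :
    functionalC s a μ u t x ≤ functionalC s b μ u t x := by
  have := hμ.isFiniteMeasure_restrict_ball x ht
  have := hμ.neZero_restrict_ball x ht
  unfold functionalC
  refine mul_le_mul' le_rfl ?_
  exact laverage_rpow_inv_mono (ν := μ.restrict (ball x t)) ha hab (g := fun y => ‖u x - u y‖ₑ)
    (by fun_prop)

theorem functionalA_mono (hμ : IsDoubling μ C₁ n) (s : ℝ) {a b : ℝ} (ha : 0 < a) (hab : a ≤ b)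
    (hu : Measurable u) (ht : 0 < t) (x : X) :
    functionalA s a μ u t x ≤ functionalA s b μ u t x := by
  have := hμ.isFiniteMeasure_restrict_ball x ht
  have := hμ.neZero_restrict_ball x ht
  unfold functionalA
  refine mul_le_mul' le_rfl ?_
  exact laverage_rpow_inv_mono (ν := μ.restrict (ball x t)) ha hab
    (g := fun y => ‖u y - ⨍ z in ball x t, u z ∂μ‖ₑ) (by fun_prop)

theorem functionalA_le_functionalI (hμ : IsDoubling μ C₁ n) (s : ℝ) (hσ : 1 ≤ σ)
    (hu : Measurable u) (hloc : MemLpLoc u 1 μ) (ht : 0 < t) (x : X) :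
    functionalA s σ μ u t x ≤ oscConst σ * functionalI s σ μ u t x := by
  have := hμ.isFiniteMeasure_restrict_ball x ht
  have := hμ.neZero_restrict_ball x ht
  have hσ0 : 0 < σ := one_pos.trans_le hσ
  unfold functionalA functionalI oscConst
  rw [mul_left_comm, ← ENNReal.mul_rpow_of_nonneg _ _ (by positivity)]
  gcongr
  rw [bestConst, ENNReal.mul_iInf_of_ne (by simp) (two_rpow_ne_top _)]
  refine le_iInf fun c => ?_
  set m := ⨍ z in ball x t, u z ∂μ
  have hm : ‖m - c‖ₑ ^ σ ≤ ⨍⁻ y in ball x t, ‖u y - c‖ₑ ^ σ ∂μ :=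
    enorm_average_sub_rpow_le hσ hu (memLp_one_iff_integrable.1 (hloc x t ht)) c
  calc ⨍⁻ y in ball x t, ‖u y - m‖ₑ ^ σ ∂μ = ⨍⁻ y in ball x t, ‖m - u y‖ₑ ^ σ ∂μ := by
        simp_rw [enorm_sub_rev]
    _ ≤ 2 ^ σ * (‖m - c‖ₑ ^ σ + ⨍⁻ y in ball x t, ‖u y - c‖ₑ ^ σ ∂μ) :=
        hμ.laverage_enorm_sub_rpow_le hσ0.le u x ht m c
    _ ≤ 2 ^ σ * (2 * ⨍⁻ y in ball x t, ‖u y - c‖ₑ ^ σ ∂μ) := by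
        rw [two_mul]
        gcongr
    _ = 2 ^ (σ + 1) * ⨍⁻ y in ball x t, ‖u y - c‖ₑ ^ σ ∂μ := by
        rw [two_rpow_add, ENNReal.rpow_one, mul_assoc]

theorem besovTypeNorm_functionalI_le_oscSeminorm (hμ : IsDoubling μ C₁ n) (s : ℝ) (hσ : 0 < σ)
    (hp : p ≠ 0) (q : ℝ≥0∞) (u : X → ℝ) :
    besovTypeNorm p q μ (functionalI s σ μ u) ≤ oscSeminorm s σ p q μ u := by
  refine scaleNorm_mono fun t ht => ?_
  rw [oscNorm, ← eLpNorm_const_mul_ennreal hp ENNReal.ofReal_ne_top]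
  refine eLpNorm_mono_enorm_ae (.of_forall fun x => ?_)
  simp only [functionalI, enorm_eq_self]
  gcongr
  exact hμ.bestConst_le_doubleOsc σ u x ht

theorem oscSeminorm_le_besovTypeNorm_functionalI (hμ : IsDoubling μ C₁ n) (s : ℝ) (hσ : 0 < σ)
    (hp : p ≠ 0) (hq : q ≠ 0) (hu : Measurable u) :
    oscSeminorm s σ p q μ u ≤ oscConst σ * besovTypeNorm p q μ (functionalI s σ μ u) := by
  calc oscSeminorm s σ p q μ u
      = besovTypeNorm p q μ fun t x =>
          ENNReal.ofReal (t ^ (-s)) * doubleOsc σ μ u x t ^ (1 / σ) := by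
        simp only [oscSeminorm, oscNorm, besovTypeNorm, scaleNorm,
          eLpNorm_const_mul_ennreal hp ENNReal.ofReal_ne_top]
    _ ≤ oscConst σ * besovTypeNorm p q μ (functionalI s σ μ u) :=
        besovTypeNorm_le_mul hp hq (oscConst_ne_top hσ) fun t ht x => ?_
  rw [functionalI, oscConst, mul_left_comm, ← ENNReal.mul_rpow_of_nonneg _ _ (by positivity)]
  gcongr
  exact hμ.doubleOsc_le_bestConst hσ.le hu x ht

theorem laverage_rpow_inv_le_essSup (hμ : IsDoubling μ C₁ n) (hσ : 0 < σ) (g : X → ℝ≥0∞) (x : X)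
    (ht : 0 < t) :
    (⨍⁻ y in ball x t, g y ^ σ ∂μ) ^ (1 / σ) ≤ essSup g (μ.restrict (ball x t)) := by
  rw [one_div, ENNReal.rpow_inv_le_iff hσ, ← hμ.laverage_ball_const x ht (_ ^ σ)]
  refine laverage_mono_ae ?_
  filter_upwards [ENNReal.ae_le_essSup g] with y hy
  gcongr

theorem besovTypeNorm_functionalC_le_besovNorm (hμ : IsDoubling μ C₁ n) (s : ℝ) (hσ : 0 < σ)
    (hσp : ENNReal.ofReal σ ≤ p) (q : ℝ≥0∞) (hu : Measurable u) :
    besovTypeNorm p q μ (functionalC s σ μ u) ≤ besovNorm s p q μ u := by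
  have hp : p ≠ 0 := ((ENNReal.ofReal_pos.2 hσ).trans_le hσp).ne'
  rw [besovNorm_eq_scaleNorm]
  refine scaleNorm_mono fun t ht => ?_
  by_cases hpt : p = ∞
  · subst hpt
    unfold functionalC
    rw [eLpNorm_const_mul_ennreal hp ENNReal.ofReal_ne_top]
    gcongr
    simp only [eLpNorm_exponent_top, eLpNormEssSup, enorm_eq_self, differenceModulus, if_true]
    exact essSup_mono_ae (.of_forall fun x => hμ.laverage_rpow_inv_le_essSup hσ _ x ht)
  · rw [← eLpNorm_functionalC_toReal hp hpt]
    refine eLpNorm_mono_enorm_ae (.of_forall fun x => ?_)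
    simpa only [enorm_eq_self] using
      hμ.functionalC_mono s hσ ((ENNReal.ofReal_le_iff_le_toReal hpt).1 hσp) hu ht x

theorem oscSeminorm_le_besovNorm_of_le (hμ : IsDoubling μ C₁ n) (s : ℝ) (hσ : 0 < σ)
    (hσp : ENNReal.ofReal σ ≤ p) (hq : q ≠ 0) (hu : Measurable u) :
    oscSeminorm s σ p q μ u ≤ oscConst σ * besovNorm s p q μ u := by
  have hp : p ≠ 0 := ((ENNReal.ofReal_pos.2 hσ).trans_le hσp).ne'
  refine (hμ.oscSeminorm_le_besovTypeNorm_functionalI s hσ hp hq hu).trans ?_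
  gcongr
  exact (besovTypeNorm_mono fun t _ x => functionalI_le_functionalC s hσ t x).trans
    (hμ.besovTypeNorm_functionalC_le_besovNorm s hσ hσp q hu)

variable [BorelSpace X]

theorem doubleOsc_mono_exponent (hμ : IsDoubling μ C₁ n) {a b : ℝ} (ha : 0 < a)
    (hab : a ≤ b) (hu : Measurable u) (ht : 0 < t) (x : X) :
    doubleOsc a μ u x t ^ (1 / a) ≤ doubleOsc b μ u x t ^ (1 / b) := by
  have := hμ.secondCountableTopology
  have := hμ.sigmaFinite
  have := hμ.isFiniteMeasure_restrict_ball x ht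
  have := hμ.neZero_restrict_ball x ht
  have hb := ha.trans_le hab
  let mean (e : ℝ) (y : X) : ℝ≥0∞ := (⨍⁻ z in ball x t, ‖u y - u z‖ₑ ^ e ∂μ) ^ (1 / e)
  have hmean {e : ℝ} (he : 0 < e) : doubleOsc e μ u x t = ⨍⁻ y in ball x t, mean e y ^ e ∂μ := by
    simp_rw [mean, ← ENNReal.rpow_mul, one_div_mul_cancel he.ne', ENNReal.rpow_one]
    rfl
  have hmeas : Measurable (mean b) :=
    (measurable_laverage_ball (c := fun _ : X => x) (r := fun _ => t)
      (f := fun y z => ‖u y - u z‖ₑ ^ b) measurable_const measurable_const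
      (by fun_prop)).pow_const _
  calc doubleOsc a μ u x t ^ (1 / a) = (⨍⁻ y in ball x t, mean a y ^ a ∂μ) ^ (1 / a) := by
        rw [hmean ha]
    _ ≤ (⨍⁻ y in ball x t, mean b y ^ a ∂μ) ^ (1 / a) := by
        refine ENNReal.rpow_le_rpow (laverage_mono fun y => ENNReal.rpow_le_rpow ?_ ha.le)
          (by positivity)
        exact laverage_rpow_inv_mono ha hab (g := fun z => ‖u y - u z‖ₑ) (by fun_prop)
    _ ≤ (⨍⁻ y in ball x t, mean b y ^ b ∂μ) ^ (1 / b) := laverage_rpow_inv_mono ha hab hmeas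
    _ = doubleOsc b μ u x t ^ (1 / b) := by rw [hmean hb]

theorem oscSeminorm_mono (hμ : IsDoubling μ C₁ n) (s : ℝ) {a b : ℝ} (ha : 0 < a)
    (hab : a ≤ b) (p q : ℝ≥0∞) (hu : Measurable u) :
    oscSeminorm s a p q μ u ≤ oscSeminorm s b p q μ u :=
  scaleNorm_mono fun t ht => by
    gcongr
    refine eLpNorm_mono_enorm_ae (.of_forall fun x => ?_)
    simpa only [enorm_eq_self] using hμ.doubleOsc_mono_exponent ha hab hu ht x

end IsDoubling

end Comparison

section PStar

variable {n s : ℝ} {p : ℝ≥0∞}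

theorem mul_one_sub_div_max_lt_of_lt_pStar (hn : 0 < n) (hs : 0 < s) (hp : p ≠ 0) (hpt : p ≠ ∞)
    {σ : ℝ} (hσ : ENNReal.ofReal σ < pStar n s p) :
    n * (1 - p.toReal / max σ p.toReal) < s * p.toReal := by
  have hP : 0 < p.toReal := ENNReal.toReal_pos hp hpt
  set P := p.toReal with hPdef
  by_cases h : p < ENNReal.ofReal (n / s)
  · rw [pStar, if_pos h, ← hPdef] at hσ
    have hPn : P < n / s := (ENNReal.lt_ofReal_iff_toReal_lt hpt).1 h
    have hd : 0 < n - P * s := by rw [lt_div_iff₀ hs] at hPn; linarith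
    rw [ENNReal.ofReal_lt_ofReal_iff (by positivity), lt_div_iff₀ hd] at hσ
    rcases le_total σ P with hσP | hPσ
    · rw [max_eq_right hσP, div_self hP.ne', sub_self, mul_zero]
      positivity
    · have hσ0 : 0 < σ := hP.trans_le hPσ
      rw [max_eq_left hPσ, one_sub_div hσ0.ne', ← mul_div_assoc, div_lt_iff₀ hσ0]
      linarith
  · have hnP : n ≤ P * s := by
      rwa [not_lt, ENNReal.ofReal_le_iff_le_toReal hpt, div_le_iff₀ hs] at h
    have : 0 < P / max σ P := div_pos hP (hP.trans_le (le_max_right _ _))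
    nlinarith

theorem one_lt_pStar (hn : 0 < n) (hs : 0 < s) (hp : ENNReal.ofReal (n / (n + s)) < p) :
    1 < pStar n s p := by
  rw [pStar]
  split_ifs with h
  · have hpt : p ≠ ∞ := h.ne_top
    have hlt : p.toReal < n / s := (ENNReal.lt_ofReal_iff_toReal_lt hpt).1 h
    have hgt : n / (n + s) < p.toReal :=
      (ENNReal.ofReal_lt_iff_lt_toReal (by positivity) hpt).1 hp
    rw [lt_div_iff₀ hs] at hlt
    rw [div_lt_iff₀ (by positivity)] at hgt
    rw [ENNReal.one_lt_ofReal, one_lt_div (by linarith)]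
    linarith
  · exact ENNReal.one_lt_top

end PStar

section Finiteness

theorem setLIntegral_Ioi_ofReal_inv {R : ℝ} (hR : 0 ≤ R) :
    ∫⁻ t in Ioi R, ENNReal.ofReal t⁻¹ = ∞ := by
  by_contra h
  refine not_integrableOn_Ioi_inv (a := R)
    ((lintegral_ofReal_ne_top_iff_integrable (by fun_prop) ?_).1 h)
  filter_upwards [ae_restrict_mem measurableSet_Ioi] with t ht
  exact inv_nonneg.2 (hR.trans ht.le)

theorem scaleNorm_eq_top_of_le {q : ℝ≥0∞} (hq : q ≠ 0) (hqt : q ≠ ∞) {φ : ℝ → ℝ≥0∞} {R : ℝ}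
    (hR : 0 ≤ R) {c : ℝ≥0∞} (hc : c ≠ 0) (h : ∀ t, R < t → c ≤ φ t) : scaleNorm q φ = ∞ := by
  have hq' : 0 < q.toReal := ENNReal.toReal_pos hq hqt
  have hint : ∞ ≤ ∫⁻ t in Ioi (0 : ℝ), φ t ^ q.toReal * ENNReal.ofReal t⁻¹ :=
    calc ∞ = c ^ q.toReal * ∫⁻ t in Ioi R, ENNReal.ofReal t⁻¹ := by
          rw [setLIntegral_Ioi_ofReal_inv hR, ENNReal.mul_top]
          simp [ENNReal.rpow_eq_zero_iff, hc, hq'.le]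
      _ = ∫⁻ t in Ioi R, c ^ q.toReal * ENNReal.ofReal t⁻¹ :=
          (lintegral_const_mul _ (by fun_prop)).symm
      _ ≤ ∫⁻ t in Ioi R, φ t ^ q.toReal * ENNReal.ofReal t⁻¹ :=
          setLIntegral_mono' measurableSet_Ioi fun t ht => by gcongr; exact h t ht
      _ ≤ _ := lintegral_mono_set (Ioi_subset_Ioi hR)
  rw [scaleNorm, if_neg hqt, top_le_iff.1 hint, ENNReal.top_rpow_of_pos (by positivity)]

theorem scaleNorm_eq_top {q : ℝ≥0∞} (hq : q ≠ 0) {φ : ℝ → ℝ≥0∞} {R : ℝ} (hR : 0 ≤ R)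
    (h : ∀ t, R < t → φ t = ∞) : scaleNorm q φ = ∞ := by
  by_cases hqt : q = ∞
  · rw [hqt]
    exact top_le_iff.1 ((h _ (lt_add_one R)).ge.trans (le_scaleNorm_top (by positivity)))
  · exact scaleNorm_eq_top_of_le hq hqt hR ENNReal.top_ne_zero fun t ht => (h t ht).ge

theorem exists_lt_top_of_scaleNorm_lt_top {q : ℝ≥0∞} (hq : q ≠ 0) {s : ℝ} {φ : ℝ → ℝ≥0∞}
    (h : scaleNorm q (fun t => ENNReal.ofReal (t ^ (-s)) * φ t) < ∞) (R : ℝ) :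
    ∃ t, R < t ∧ 0 < t ∧ φ t < ∞ := by
  by_contra! hφ
  refine h.ne (scaleNorm_eq_top hq (le_max_right R 0) fun t ht => ?_)
  obtain ⟨hRt, ht0⟩ := max_lt_iff.1 ht
  rw [top_le_iff.1 (hφ t hRt ht0), ENNReal.mul_top]
  simpa using Real.rpow_pos_of_pos ht0 (-s)

theorem ae_lt_top_of_eLpNorm_lt_top {α : Type*} [MeasurableSpace α] {ν : Measure α} {p : ℝ≥0∞}
    (hp : p ≠ 0) {f : α → ℝ≥0∞} (hf : Measurable f) (h : eLpNorm f p ν < ∞) :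
    ∀ᵐ x ∂ν, f x < ∞ := by
  by_cases hpt : p = ∞
  · subst hpt
    filter_upwards [ENNReal.ae_le_essSup f] with x hx
    exact hx.trans_lt (by simpa only [eLpNorm_exponent_top, eLpNormEssSup, enorm_eq_self] using h)
  · have hP := ENNReal.toReal_pos hp hpt
    have hint := ENNReal.rpow_lt_top_of_nonneg hP.le h.ne
    rw [eLpNorm_rpow_eq_lintegral_rpow hp hpt] at hint
    filter_upwards [ae_lt_top (hf.pow_const _) hint.ne] with x hx
    exact (ENNReal.rpow_lt_top_iff_of_pos hP).1 hx

theorem memLp_of_lintegral_enorm_sub_rpow_lt_top {α : Type*} [MeasurableSpace α] {ν : Measure α}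
    [IsFiniteMeasure ν] {p : ℝ≥0∞} (hp : p ≠ 0) (hpt : p ≠ ∞) {u : α → ℝ} (hu : Measurable u)
    {c : ℝ} (h : ∫⁻ y, ‖u y - c‖ₑ ^ p.toReal ∂ν < ∞) : MemLp u p ν := by
  have hsub : MemLp (fun y => u y - c) p ν :=
    ⟨by fun_prop, by
      rw [eLpNorm_eq_lintegral_rpow_enorm_toReal hp hpt]
      exact ENNReal.rpow_lt_top_of_nonneg (by positivity) h.ne⟩
  simpa [Pi.add_def] using hsub.add (memLp_const c)

variable {X : Type*} [MetricSpace X] [MeasurableSpace X] {μ : Measure X} {C₁ n : ℝ} {u : X → ℝ}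
  {s : ℝ} {p q : ℝ≥0∞}

namespace IsDoubling

theorem memLp_ball_of_laverage_lt_top (hμ : IsDoubling μ C₁ n) (hp : p ≠ 0) (hpt : p ≠ ∞)
    (hu : Measurable u) {x : X} {t : ℝ} (ht : 0 < t) {c : ℝ}
    (h : ⨍⁻ y in ball x t, ‖u y - c‖ₑ ^ p.toReal ∂μ < ∞) : MemLp u p (μ.restrict (ball x t)) := by
  have := hμ.isFiniteMeasure_restrict_ball x ht
  refine memLp_of_lintegral_enorm_sub_rpow_lt_top hp hpt hu (c := c) ?_
  contrapose! h
  rw [setLAverage_eq, top_le_iff.1 h, ENNReal.top_div_of_ne_top (hμ.ball_ne_top x ht)]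

variable [BorelSpace X]

theorem memLpLoc_of_oscSeminorm_lt_top (hμ : IsDoubling μ C₁ n) {τ : ℝ} (hτ : 0 < τ)
    (hp : p ≠ 0) (hq : q ≠ 0) (hu : Measurable u) (h : oscSeminorm s τ p q μ u < ∞) :
    MemLpLoc u (ENNReal.ofReal τ) μ := by
  have := hμ.secondCountableTopology
  have := hμ.sigmaFinite
  refine MemLpLoc.of_ae_memLp_ball hμ fun R => ?_
  obtain ⟨t, hRt, ht, hfin⟩ := exists_lt_top_of_scaleNorm_lt_top hq h R
  refine ⟨t, hRt, ?_⟩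
  filter_upwards [ae_lt_top_of_eLpNorm_lt_top hp (measurable_doubleOsc_rpow hu τ t _) hfin]
    with x hx
  have hbest : bestConst τ μ u t x < ∞ := (hμ.bestConst_le_doubleOsc τ u x ht).trans_lt
    ((ENNReal.rpow_lt_top_iff_of_pos (by positivity)).1 hx)
  obtain ⟨c, hc⟩ := iInf_lt_iff.1 hbest
  exact hμ.memLp_ball_of_laverage_lt_top (ENNReal.ofReal_pos.2 hτ).ne' ENNReal.ofReal_ne_top hu ht
    (c := c) (by rwa [ENNReal.toReal_ofReal hτ.le])

theorem ae_memLp_ball_of_differenceModulus_lt_top (hμ : IsDoubling μ C₁ n) (hp : p ≠ 0)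
    (hu : Measurable u) {t : ℝ} (ht : 0 < t) (h : differenceModulus u p μ t < ∞) :
    ∀ᵐ x ∂μ, MemLp u p (μ.restrict (ball x t)) := by
  have := hμ.secondCountableTopology
  have := hμ.sigmaFinite
  by_cases hpt : p = ∞
  · subst hpt
    rw [differenceModulus, if_pos rfl] at h
    filter_upwards [ENNReal.ae_le_essSup fun x =>
      essSup (fun y => ‖u x - u y‖ₑ) (μ.restrict (ball x t))] with x hx
    have := hμ.isFiniteMeasure_restrict_ball x ht
    have hsub : MemLp (fun y => u x - u y) ∞ (μ.restrict (ball x t)) :=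
      ⟨by fun_prop, by simpa only [eLpNorm_exponent_top, eLpNormEssSup] using hx.trans_lt h⟩
    simpa [Pi.sub_def] using (memLp_const (u x)).sub hsub
  · rw [differenceModulus, if_neg hpt, ENNReal.rpow_lt_top_iff_of_pos
      (one_div_pos.2 (ENNReal.toReal_pos hp hpt))] at h
    filter_upwards [ae_lt_top (measurable_pointOsc_rpow hu p.toReal t 1)
      (by simpa only [ENNReal.rpow_one, pointOsc] using h.ne)] with x hx
    refine hμ.memLp_ball_of_laverage_lt_top hp hpt hu ht (c := u x) ?_
    simpa only [ENNReal.rpow_one, pointOsc, enorm_sub_rev] using hx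

theorem memLpLoc_of_besovNorm_lt_top (hμ : IsDoubling μ C₁ n) (hp : p ≠ 0) (hq : q ≠ 0)
    (hu : Measurable u) (h : besovNorm s p q μ u < ∞) : MemLpLoc u p μ := by
  rw [besovNorm_eq_scaleNorm] at h
  refine MemLpLoc.of_ae_memLp_ball hμ fun R => ?_
  obtain ⟨t, hRt, ht, hfin⟩ := exists_lt_top_of_scaleNorm_lt_top hq h R
  exact ⟨t, hRt, hμ.ae_memLp_ball_of_differenceModulus_lt_top hp hu ht hfin⟩

end IsDoubling

end Finiteness

section SeminormEquivalence

variable {X : Type*} [MetricSpace X] [MeasurableSpace X] [BorelSpace X] {μ : Measure X} {C₁ n : ℝ}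
  {s σ : ℝ} {p q : ℝ≥0∞}

namespace IsDoubling

theorem exists_besovNorm_le_oscSeminorm (hμ : IsDoubling μ C₁ n) (hσ : 0 < σ) (hs : 0 < s)
    (hp : p ≠ 0) (hq : q ≠ 0) :
    ∃ K : ℝ≥0∞, K ≠ ∞ ∧ ∀ u : X → ℝ, Measurable u → MemLpLoc u (ENNReal.ofReal σ) μ →
      besovNorm s p q μ u ≤ K * oscSeminorm s σ p q μ u := by
  have hmin : 0 < min σ 1 := lt_min hσ one_pos
  obtain ⟨K, hK, hbound⟩ :=
    hμ.exists_besovNorm_le_oscSeminorm_of_le_one hmin (min_le_right _ _) hs hp hq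
  refine ⟨K, hK, fun u hu hloc => ?_⟩
  refine (hbound u hu
    (hloc.mono_exponent hμ (ENNReal.ofReal_le_ofReal (min_le_left _ _)))).trans ?_
  gcongr
  exact hμ.oscSeminorm_mono s hmin (min_le_left _ _) p q hu

theorem exists_oscSeminorm_le_besovNorm (hμ : IsDoubling μ C₁ n) (hσ : 0 < σ) (hs : 0 < s)
    (hp : p ≠ 0) (hq : q ≠ 0) (hσp : ENNReal.ofReal σ < pStar n s p) :
    ∃ K : ℝ≥0∞, K ≠ ∞ ∧ ∀ u : X → ℝ, Measurable u → MemLpLoc u p μ →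
      oscSeminorm s σ p q μ u ≤ K * besovNorm s p q μ u := by
  by_cases hpt : p = ∞
  · subst hpt
    exact ⟨_, oscConst_ne_top hσ,
      fun u hu _ => hμ.oscSeminorm_le_besovNorm_of_le s hσ le_top hq hu⟩
  · have hP : 0 < p.toReal := ENNReal.toReal_pos hp hpt
    have hmin : 0 < min p.toReal 1 := lt_min hP one_pos
    have hle : ENNReal.ofReal (min p.toReal 1) ≤ p :=
      (ENNReal.ofReal_le_iff_le_toReal hpt).2 (min_le_left _ _)
    obtain ⟨K, hK, hbound⟩ := hμ.exists_oscSeminorm_le_oscSeminorm (s := s) hmin (min_le_right _ _)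
      hp hpt (le_max_right σ _) hq
      (mul_one_sub_div_max_lt_of_lt_pStar hμ.exponent_pos hs hp hpt hσp)
    refine ⟨_, ENNReal.mul_ne_top hK (oscConst_ne_top hmin), fun u hu hloc => ?_⟩
    calc oscSeminorm s σ p q μ u ≤ oscSeminorm s (max σ p.toReal) p q μ u :=
          hμ.oscSeminorm_mono s hσ (le_max_left _ _) p q hu
      _ ≤ K * oscSeminorm s (min p.toReal 1) p q μ u :=
          hbound u hu (hloc.mono_exponent hμ hle)
      _ ≤ K * (oscConst (min p.toReal 1) * besovNorm s p q μ u) := by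
          gcongr
          exact hμ.oscSeminorm_le_besovNorm_of_le s hmin hle hq hu
      _ = _ := (mul_assoc _ _ _).symm

end IsDoubling

end SeminormEquivalence

section SpaceEquivalence

variable {X : Type*} [MetricSpace X] [MeasurableSpace X] {μ : Measure X} {C₁ n : ℝ}
  {s σ ε : ℝ} {p q : ℝ≥0∞}

theorem spaceC_embeds_spaceI (hσ : 0 < σ) : (spaceC s σ p q μ).Embeds (spaceI s σ p q μ) :=
  FunctionSpace.embeds_of_le ENNReal.one_ne_top (fun _ hu => hu.2)
    (fun _ _ => (one_mul (_ : ℝ≥0∞)).symm ▸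
      besovTypeNorm_mono fun t _ x => functionalI_le_functionalC s hσ t x)
    fun _ hu hfin => ⟨hu.1, hfin⟩

theorem spaceA_embeds_spaceI (hσ : 0 < σ) : (spaceA s σ p q μ).Embeds (spaceI s σ p q μ) :=
  FunctionSpace.embeds_of_le ENNReal.one_ne_top (fun _ hu => hu.2.2)
    (fun _ _ => (one_mul (_ : ℝ≥0∞)).symm ▸
      besovTypeNorm_mono fun t _ x => functionalI_le_functionalA s hσ t x)
    fun _ hu hfin => ⟨hu.1, hfin⟩

theorem spaceS_embeds_spaceI (ε : ℝ) : (spaceS s ε σ p q μ).Embeds (spaceI s σ p q μ) :=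
  FunctionSpace.embeds_of_le ENNReal.one_ne_top (fun _ hu => hu.2)
    (fun _ _ => (one_mul (_ : ℝ≥0∞)).symm ▸
      besovTypeNorm_mono fun _ ht x => functionalI_le_functionalS s ε σ ht x)
    fun _ hu hfin => ⟨hu.1, hfin⟩

namespace IsDoubling

theorem spaceI_embeds_spaceA (hμ : IsDoubling μ C₁ n) {τ : ℝ} (hσ : 0 < σ) (hστ : σ ≤ τ)
    (hτ : 1 ≤ τ) (hp : p ≠ 0) (hq : q ≠ 0) :
    (spaceI s τ p q μ).Embeds (spaceA s σ p q μ) := by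
  have hK : oscConst τ ≠ ∞ := oscConst_ne_top (one_pos.trans_le hτ)
  have hloc {u : X → ℝ} (hu : u ∈ (spaceI s τ p q μ).carrier) : MemLpLoc u 1 μ :=
    hu.1.mono_exponent hμ (by simpa using hτ)
  refine FunctionSpace.embeds_of_le hK (fun u hu => hu.2) (fun u hu => ?_) fun u hu hfin =>
    ⟨hu.1.mono_exponent hμ (ENNReal.ofReal_le_ofReal hστ), hloc hu, hfin⟩
  obtain ⟨v, hv, huv⟩ := hu.1.aemeasurable
  simp only [spaceA, spaceI, functionalA_congr huv, functionalI_congr huv]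
  exact besovTypeNorm_le_mul hp hq hK fun t ht x => (hμ.functionalA_mono s hσ hστ hv ht x).trans
    (hμ.functionalA_le_functionalI s hτ hv ((hloc hu).congr huv) ht x)

theorem besovSpace_embeds_spaceC (hμ : IsDoubling μ C₁ n) (hσ : 0 < σ)
    (hσp : ENNReal.ofReal σ ≤ p) : (besovSpace s p q μ).Embeds (spaceC s σ p q μ) := by
  refine FunctionSpace.embeds_of_le ENNReal.one_ne_top (fun _ hu => hu.2) (fun u hu => ?_)
    fun u hu hfin => ⟨hu.1.mono_exponent hμ hσp, hfin⟩
  obtain ⟨v, hv, huv⟩ := hu.1.aemeasurable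
  simp only [besovSpace, spaceC, one_mul, besovNorm_congr huv, besovTypeNorm_functionalC_congr huv]
  exact hμ.besovTypeNorm_functionalC_le_besovNorm s hσ hσp q hv

variable [BorelSpace X]

theorem spaceI_embeds_spaceS (hμ : IsDoubling μ C₁ n) (hε : 0 ≤ ε) (hεs : ε < s) (hp : p ≠ 0)
    (hq : q ≠ 0) (hσ : 0 < σ) : (spaceI s σ p q μ).Embeds (spaceS s ε σ p q μ) := by
  obtain ⟨K, hK, hbound⟩ :=
    hμ.exists_besovTypeNorm_functionalS_le_oscSeminorm hσ hε hεs hp hq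
  refine FunctionSpace.embeds_of_le (ENNReal.mul_ne_top hK (oscConst_ne_top hσ))
    (fun u hu => hu.2) (fun u hu => ?_) fun u hu hfin => ⟨hu.1, hfin⟩
  obtain ⟨v, hv, huv⟩ := hu.1.aemeasurable
  simp only [spaceS, spaceI, functionalS_congr huv, functionalI_congr huv, mul_assoc]
  refine (hbound v hv).trans ?_
  gcongr
  exact hμ.oscSeminorm_le_besovTypeNorm_functionalI s hσ hp hq hv

theorem spaceI_embeds_besovSpace (hμ : IsDoubling μ C₁ n) (hs : 0 < s) (hp : p ≠ 0)
    (hq : q ≠ 0) (hσ : 0 < σ) : (spaceI s σ p q μ).Embeds (besovSpace s p q μ) := by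
  obtain ⟨K, hK, hbound⟩ := hμ.exists_besovNorm_le_oscSeminorm hσ hs hp hq
  refine FunctionSpace.embeds_of_le (ENNReal.mul_ne_top hK (oscConst_ne_top hσ))
    (fun u hu => hu.2) (fun u hu => ?_) fun u hu hfin => ⟨?_, hfin⟩
  all_goals obtain ⟨v, hv, huv⟩ := hu.1.aemeasurable
  · simp only [besovSpace, spaceI, besovNorm_congr huv, functionalI_congr huv, mul_assoc]
    refine (hbound v hv (hu.1.congr huv)).trans ?_
    gcongr
    exact hμ.oscSeminorm_le_besovTypeNorm_functionalI s hσ hp hq hv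
  · exact (hμ.memLpLoc_of_besovNorm_lt_top hp hq hv
      ((besovNorm_congr huv.symm s p q).trans_lt hfin)).congr huv.symm

theorem besovSpace_embeds_spaceI (hμ : IsDoubling μ C₁ n) (hs : 0 < s) (hp : p ≠ 0)
    (hq : q ≠ 0) (hσ : 0 < σ) (hσp : ENNReal.ofReal σ < pStar n s p) :
    (besovSpace s p q μ).Embeds (spaceI s σ p q μ) := by
  obtain ⟨K, hK, hbound⟩ := hμ.exists_oscSeminorm_le_besovNorm hσ hs hp hq hσp
  have hosc {u v : X → ℝ} (hu : u ∈ (besovSpace s p q μ).carrier) (hv : Measurable v)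
      (huv : u =ᵐ[μ] v) : oscSeminorm s σ p q μ v ≤ K * besovNorm s p q μ u := by
    rw [besovNorm_congr huv]
    exact hbound v hv (hu.1.congr huv)
  refine FunctionSpace.embeds_of_le hK (fun u hu => hu.2) (fun u hu => ?_)
    fun u hu hfin => ⟨?_, hfin⟩
  all_goals obtain ⟨v, hv, huv⟩ := hu.1.aemeasurable
  · simp only [besovSpace, spaceI, functionalI_congr huv]
    exact (hμ.besovTypeNorm_functionalI_le_oscSeminorm s hσ hp q v).trans (hosc hu hv huv)
  · exact (hμ.memLpLoc_of_oscSeminorm_lt_top hσ hp hq hv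
      ((hosc hu hv huv).trans_lt (ENNReal.mul_lt_top hK.lt_top hu.2))).congr huv.symm

theorem besovSpace_equivalent_spaceI (hμ : IsDoubling μ C₁ n) (hs : 0 < s)
    (hp : p ≠ 0) (hq : q ≠ 0) (hσ : 0 < σ) (hσp : ENNReal.ofReal σ < pStar n s p) :
    (besovSpace s p q μ).Equivalent (spaceI s σ p q μ) :=
  ⟨hμ.besovSpace_embeds_spaceI hs hp hq hσ hσp, hμ.spaceI_embeds_besovSpace hs hp hq hσ⟩

theorem besovSpace_equivalent_spaceC (hμ : IsDoubling μ C₁ n) (hs : 0 < s)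
    (hq : q ≠ 0) (hσ : 0 < σ) (hσp : ENNReal.ofReal σ ≤ p) :
    (besovSpace s p q μ).Equivalent (spaceC s σ p q μ) :=
  ⟨hμ.besovSpace_embeds_spaceC hσ hσp, (spaceC_embeds_spaceI hσ).trans
    (hμ.spaceI_embeds_besovSpace hs ((ENNReal.ofReal_pos.2 hσ).trans_le hσp).ne' hq hσ)⟩

theorem besovSpace_equivalent_spaceS (hμ : IsDoubling μ C₁ n) (hε : 0 ≤ ε)
    (hεs : ε < s) (hp : p ≠ 0) (hq : q ≠ 0) (hσ : 0 < σ)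
    (hσp : ENNReal.ofReal σ < pStar n s p) :
    (besovSpace s p q μ).Equivalent (spaceS s ε σ p q μ) :=
  ⟨(hμ.besovSpace_embeds_spaceI (hε.trans_lt hεs) hp hq hσ hσp).trans
    (hμ.spaceI_embeds_spaceS hε hεs hp hq hσ),
    (spaceS_embeds_spaceI ε).trans (hμ.spaceI_embeds_besovSpace (hε.trans_lt hεs) hp hq hσ)⟩

theorem besovSpace_equivalent_spaceA (hμ : IsDoubling μ C₁ n) (hs : 0 < s)
    (hp : ENNReal.ofReal (n / (n + s)) < p) (hq : q ≠ 0) (hσ : 0 < σ)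
    (hσp : ENNReal.ofReal σ < pStar n s p) :
    (besovSpace s p q μ).Equivalent (spaceA s σ p q μ) := by
  have hp0 : p ≠ 0 := hp.ne_bot
  have hmax : ENNReal.ofReal (max σ 1) < pStar n s p := by
    rw [ENNReal.ofReal_max, ENNReal.ofReal_one]
    exact max_lt hσp (one_lt_pStar hμ.exponent_pos hs hp)
  exact ⟨(hμ.besovSpace_embeds_spaceI hs hp0 hq (one_pos.trans_le (le_max_right _ _)) hmax).trans
    (hμ.spaceI_embeds_spaceA hσ (le_max_left _ _) (le_max_right _ _) hp0 hq),
    (spaceA_embeds_spaceI hσ).trans (hμ.spaceI_embeds_besovSpace hs hp0 hq hσ)⟩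

end IsDoubling

end SpaceEquivalence

theorem scaleNorm_min_rpow_one_lt_top {s s' : ℝ} (hs : 0 < s) (hss' : s < s') {q : ℝ≥0∞}
    (hq : q ≠ 0) :
    scaleNorm q (fun t => ENNReal.ofReal (t ^ (-s)) * ENNReal.ofReal (min (t ^ s') 1)) < ∞ := by
  have hpow : ∀ t : ℝ, 0 < t → t ^ (-s) * min (t ^ s') 1 ≤ min (t ^ (s' - s)) (t ^ (-s)) := by
    intro t ht
    rw [mul_min_of_nonneg _ _ (by positivity), mul_one, ← Real.rpow_add ht, neg_add_eq_sub]
  unfold scaleNorm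
  split_ifs with hqt
  · refine (iSup₂_le fun t (ht : 0 < t) => ?_).trans_lt ENNReal.one_lt_top
    beta_reduce
    rw [← ENNReal.ofReal_mul (by positivity), ENNReal.ofReal_le_one]
    refine (hpow t ht).trans (min_le_iff.2 ((le_total t 1).imp (fun h => ?_) fun h => ?_))
    · exact Real.rpow_le_one ht.le h (sub_nonneg.2 hss'.le)
    · exact Real.rpow_le_one_of_one_le_of_nonpos h (neg_nonpos.2 hs.le)
  · have hQ : 0 < q.toReal := ENNReal.toReal_pos hq hqt
    have hle : ∀ t : ℝ, 0 < t → ∀ a : ℝ, min (t ^ (s' - s)) (t ^ (-s)) ≤ t ^ a →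
        (ENNReal.ofReal (t ^ (-s)) * ENNReal.ofReal (min (t ^ s') 1)) ^ q.toReal *
          ENNReal.ofReal t⁻¹ ≤ ENNReal.ofReal (t ^ (a * q.toReal - 1)) := by
      intro t ht a ha
      rw [← ENNReal.ofReal_mul (by positivity), ENNReal.ofReal_rpow_of_nonneg (by positivity) hQ.le,
        ← ENNReal.ofReal_mul (by positivity), Real.rpow_sub_one ht.ne', Real.rpow_mul ht.le,
        div_eq_mul_inv]
      gcongr
      exact (hpow t ht).trans ha
    have hsmall : IntegrableOn (fun t : ℝ => t ^ ((s' - s) * q.toReal - 1)) (Ioc 0 1) :=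
      (integrableOn_Ioc_iff_integrableOn_Ioo).2 <|
        (intervalIntegral.integrableOn_Ioo_rpow_iff one_pos).2
          (by linarith [mul_pos (sub_pos.2 hss') hQ])
    have hlarge : IntegrableOn (fun t : ℝ => t ^ (-s * q.toReal - 1)) (Ioi 1) :=
      integrableOn_Ioi_rpow_of_lt (by linarith [mul_pos hs hQ]) one_pos
    rw [← Ioc_union_Ioi_eq_Ioi zero_le_one]
    refine ENNReal.rpow_lt_top_of_nonneg (by positivity)
      ((lintegral_union_le _ _ _).trans_lt (ENNReal.add_lt_top.2 ⟨?_, ?_⟩)).ne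
    · exact (setLIntegral_mono' measurableSet_Ioc fun t ht =>
        hle t ht.1 _ (min_le_left _ _)).trans_lt hsmall.lintegral_lt_top
    · exact (setLIntegral_mono' measurableSet_Ioi fun t ht =>
        hle t (one_pos.trans ht) _ (min_le_right _ _)).trans_lt hlarge.lintegral_lt_top

/-- `g` is a Hajłasz gradient of order `s` of `u`: differences of `u` are controlled by `g` at the
two points and the power `s` of the distance. -/
def IsHajlaszGradient {X : Type*} [PseudoMetricSpace X] (s : ℝ) (u : X → ℝ) (g : X → ℝ≥0∞) :
    Prop :=
  ∀ x y, ‖u x - u y‖ₑ ≤ ENNReal.ofReal (dist x y ^ s) * (g x + g y)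

section HajlaszGradient

variable {X : Type*} [MetricSpace X] [MeasurableSpace X] {μ : Measure X} {C₁ n s s' : ℝ}
  {p q : ℝ≥0∞} {u : X → ℝ} {g : X → ℝ≥0∞}

namespace IsDoubling

variable [BorelSpace X]

theorem differenceModulus_le_of_enorm_sub_le (hμ : IsDoubling μ C₁ n) (hp : p ≠ 0) (hpt : p ≠ ∞)
    {t : ℝ} (ht : 0 < t) (hg : Measurable g)
    (h : ∀ x, ∀ y ∈ ball x t, ‖u x - u y‖ₑ ≤ g x + g y) :
    differenceModulus u p μ t ≤
      (2 ^ p.toReal * (1 + doublingFactor C₁ n 2)) ^ (1 / p.toReal) * eLpNorm g p μ := by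
  have hP : 0 < p.toReal := ENNReal.toReal_pos hp hpt
  have hgP : Measurable fun x => g x ^ p.toReal := hg.pow_const _
  rw [differenceModulus, if_neg hpt, eLpNorm_eq_lintegral_rpow hp hpt,
    ← ENNReal.mul_rpow_of_nonneg _ _ (by positivity)]
  gcongr
  calc ∫⁻ x, ⨍⁻ y in ball x t, ‖u x - u y‖ₑ ^ p.toReal ∂μ ∂μ
      ≤ ∫⁻ x, ⨍⁻ y in ball x t, 2 ^ p.toReal * (g x ^ p.toReal + g y ^ p.toReal) ∂μ ∂μ :=
        lintegral_mono fun x => setLAverage_mono_on measurableSet_ball fun y hy =>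
          (ENNReal.rpow_le_rpow (h x y hy) hP.le).trans
            (ENNReal.add_rpow_le_two_rpow_mul_rpow_add_rpow _ _ hP.le)
    _ = 2 ^ p.toReal * (∫⁻ x, g x ^ p.toReal ∂μ +
          ∫⁻ x, ⨍⁻ y in ball x t, g y ^ p.toReal ∂μ ∂μ) := by
        simp only [laverage_const_mul (two_rpow_ne_top _), laverage_add_left measurable_const,
          hμ.laverage_ball_const _ ht]
        rw [lintegral_const_mul' _ _ (two_rpow_ne_top _), lintegral_add_left hgP]
    _ ≤ 2 ^ p.toReal * (1 + doublingFactor C₁ n 2) * ∫⁻ x, g x ^ p.toReal ∂μ := by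
        rw [mul_assoc, add_mul, one_mul]
        gcongr
        exact hμ.lintegral_laverage_le ht hgP

theorem exists_differenceModulus_le_mul_min (hμ : IsDoubling μ C₁ n) (hp : p ≠ 0) (hpt : p ≠ ∞)
    (hs : 0 ≤ s) (hu : Measurable u) (hup : eLpNorm u p μ ≠ ∞) (hg : Measurable g)
    (hgp : eLpNorm g p μ ≠ ∞) (hug : IsHajlaszGradient s u g) :
    ∃ K : ℝ≥0∞, K ≠ ∞ ∧ ∀ t : ℝ, 0 < t →
      differenceModulus u p μ t ≤ K * ENNReal.ofReal (min (t ^ s) 1) := by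
  set D := (2 ^ p.toReal * (1 + doublingFactor C₁ n 2)) ^ (1 / p.toReal)
  have hD : D ≠ ∞ := ENNReal.rpow_ne_top_of_nonneg (by positivity) <| ENNReal.mul_ne_top
    (two_rpow_ne_top _) (ENNReal.add_ne_top.2 ⟨ENNReal.one_ne_top, doublingFactor_ne_top _ _ _⟩)
  refine ⟨D * (eLpNorm u p μ + eLpNorm g p μ),
    ENNReal.mul_ne_top hD (ENNReal.add_ne_top.2 ⟨hup, hgp⟩), fun t ht => ?_⟩
  have hsize : differenceModulus u p μ t ≤ D * eLpNorm u p μ := by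
    rw [← eLpNorm_enorm]
    exact hμ.differenceModulus_le_of_enorm_sub_le hp hpt ht hu.enorm fun x y _ => enorm_sub_le
  have hgrad : differenceModulus u p μ t ≤ D * (ENNReal.ofReal (t ^ s) * eLpNorm g p μ) := by
    rw [← eLpNorm_const_mul_ennreal hp ENNReal.ofReal_ne_top]
    refine hμ.differenceModulus_le_of_enorm_sub_le hp hpt ht (hg.const_mul _) fun x y hy => ?_
    rw [← mul_add]
    refine (hug x y).trans ?_
    gcongr
    exact (mem_ball'.1 hy).le
  rw [mul_assoc]
  rcases le_total (t ^ s) 1 with h | h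
  · rw [min_eq_left h, mul_comm (_ + _)]
    refine hgrad.trans ?_
    gcongr
    exact le_add_self
  · rw [min_eq_right h, ENNReal.ofReal_one, mul_one]
    refine hsize.trans ?_
    gcongr
    exact le_self_add

theorem mem_besovSpace_of_isHajlaszGradient (hμ : IsDoubling μ C₁ n) (hs : 0 < s) (hss' : s < s')
    (hp : p ≠ 0) (hpt : p ≠ ∞) (hq : q ≠ 0) (hu : Measurable u) (hup : eLpNorm u p μ ≠ ∞)
    (hg : Measurable g) (hgp : eLpNorm g p μ ≠ ∞) (hug : IsHajlaszGradient s' u g) :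
    u ∈ (besovSpace s p q μ).carrier := by
  obtain ⟨K, hK, h⟩ :=
    hμ.exists_differenceModulus_le_mul_min hp hpt (hs.trans hss').le hu hup hg hgp hug
  refine ⟨fun x r _ => MemLp.restrict _ ⟨hu.aestronglyMeasurable, hup.lt_top⟩, ?_⟩
  calc besovNorm s p q μ u
      ≤ scaleNorm q fun t =>
          K * (ENNReal.ofReal (t ^ (-s)) * ENNReal.ofReal (min (t ^ s') 1)) := by
        rw [besovNorm_eq_scaleNorm]
        refine scaleNorm_mono fun t ht => ?_
        rw [mul_left_comm]
        gcongr
        exact h t ht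
    _ = K * scaleNorm q fun t =>
          ENNReal.ofReal (t ^ (-s)) * ENNReal.ofReal (min (t ^ s') 1) :=
        scaleNorm_const_mul hq hK _
    _ < ∞ := ENNReal.mul_lt_top hK.lt_top (scaleNorm_min_rpow_one_lt_top hs hss' hq)

end IsDoubling

end HajlaszGradient

section PowerSingularity

theorem div_lt_div_sub_of_pStar_lt {n s σ : ℝ} {p : ℝ≥0∞} (hs : 0 < s) (hp : p ≠ 0)
    (h : pStar n s p < ENNReal.ofReal σ) : n / σ < n / p.toReal - s := by
  have hσ : 0 < σ := ENNReal.ofReal_pos.1 (zero_le.trans_lt h)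
  have hpn : p < ENNReal.ofReal (n / s) := by
    by_contra hpn
    rw [pStar, if_neg hpn] at h
    exact not_top_lt h
  have hP : 0 < p.toReal := ENNReal.toReal_pos hp hpn.ne_top
  have hd : 0 < n - p.toReal * s := by
    have := (ENNReal.lt_ofReal_iff_toReal_lt hpn.ne_top).1 hpn
    rw [lt_div_iff₀ hs] at this
    linarith
  rw [pStar, if_pos hpn, ENNReal.ofReal_lt_ofReal_iff hσ, div_lt_iff₀ hd] at h
  rw [div_sub' hP.ne', div_lt_div_iff₀ hσ hP]
  linarith

theorem one_sub_one_sub_rpow_le {α z : ℝ} (hα : 0 < α) (hz0 : 0 ≤ z) (hz1 : z ≤ 1) :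
    1 - (1 - z) ^ α ≤ max α 1 * z := by
  rcases le_total 1 α with h | h
  · have bernoulli := one_add_mul_self_le_rpow_one_add (s := -z) (by linarith) h
    rw [max_eq_left h]
    rw [← sub_eq_add_neg] at bernoulli
    linarith
  · have hpow := Real.rpow_le_rpow_of_exponent_ge' (x := 1 - z) (by linarith) (by linarith) hα.le h
    rw [max_eq_right h]
    rw [Real.rpow_one] at hpow
    linarith

theorem rpow_neg_sub_rpow_neg_le {α κ a b : ℝ} (hα : 0 < α) (hκ0 : 0 ≤ κ) (hκ : κ ≤ 1)
    (ha : 0 < a) (hab : a ≤ b) :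
    a ^ (-α) - b ^ (-α) ≤ max α 1 * ((b - a) ^ κ * a ^ (-(α + κ))) := by
  have hb : 0 < b := ha.trans_le hab
  have hba : 0 ≤ b - a := sub_nonneg.2 hab
  have hz0 : 0 ≤ (b - a) / b := by positivity
  have hz1 : (b - a) / b ≤ 1 := by rw [div_le_one hb]; linarith
  have hratio : (b - a) / b ≤ ((b - a) / a) ^ κ :=
    calc (b - a) / b ≤ ((b - a) / b) ^ κ := by
          simpa only [Real.rpow_one] using Real.rpow_le_rpow_of_exponent_ge' hz0 hz1 hκ0 hκ
      _ ≤ ((b - a) / a) ^ κ := by gcongr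
  calc a ^ (-α) - b ^ (-α) = a ^ (-α) * (1 - (1 - (b - a) / b) ^ α) := by
        rw [one_sub_div hb.ne', sub_sub_cancel, Real.div_rpow ha.le hb.le, Real.rpow_neg ha.le,
          Real.rpow_neg hb.le]
        field_simp
    _ ≤ a ^ (-α) * (max α 1 * ((b - a) / a) ^ κ) := by
        gcongr
        exact (one_sub_one_sub_rpow_le hα hz0 hz1).trans (by gcongr)
    _ = max α 1 * ((b - a) ^ κ * a ^ (-(α + κ))) := by
        rw [Real.div_rpow hba ha.le, neg_add, Real.rpow_add ha, Real.rpow_neg ha.le κ]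
        ring

end PowerSingularity

section NormedSpace

variable {E : Type*} [NormedAddCommGroup E]

/-- The function `max (‖x‖⁻ᵅ - 1) 0`, which has a power singularity at the origin and vanishes
outside the unit ball. As `0 ^ (-α) = 0` for `α ≠ 0`, its value at the origin is `0`. -/
noncomputable def truncatedPower (α : ℝ) (x : E) : ℝ := max (‖x‖ ^ (-α) - 1) 0

/-- The function `max (1 - ‖x‖) 0`, a Lipschitz bump supported in the unit ball. -/
noncomputable def coneFunction (x : E) : ℝ := max (1 - ‖x‖) 0

theorem truncatedPower_eq_zero {α : ℝ} (hα : 0 ≤ α) {x : E} (hx : 1 ≤ ‖x‖) :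
    truncatedPower α x = 0 :=
  max_eq_right (sub_nonpos.2 (Real.rpow_le_one_of_one_le_of_nonpos hx (neg_nonpos.2 hα)))

theorem coneFunction_eq_zero {x : E} (hx : 1 ≤ ‖x‖) : coneFunction x = 0 :=
  max_eq_right (sub_nonpos.2 hx)

theorem truncatedPower_add_one {α : ℝ} (hα : 0 ≤ α) {x : E} (hx0 : x ≠ 0) (hx1 : ‖x‖ ≤ 1) :
    truncatedPower α x + 1 = ‖x‖ ^ (-α) := by
  rw [truncatedPower, max_eq_left (sub_nonneg.2 (Real.one_le_rpow_of_pos_of_le_one_of_nonpos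
    (norm_pos_iff.2 hx0) hx1 (neg_nonpos.2 hα))), sub_add_cancel]

theorem enorm_rpow_eq_ofReal {x : E} (hx : x ≠ 0) (β : ℝ) :
    ‖x‖ₑ ^ β = ENNReal.ofReal (‖x‖ ^ β) := by
  rw [← ofReal_norm, ENNReal.ofReal_rpow_of_pos (norm_pos_iff.2 hx)]

theorem enorm_truncatedPower_le {α : ℝ} (hα : 0 < α) (x : E) :
    ‖truncatedPower α x‖ₑ ≤ (ball 0 1).indicator (fun z => ‖z‖ₑ ^ (-α)) x := by
  rcases lt_or_ge ‖x‖ 1 with hx1 | hx1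
  · rw [indicator_of_mem (mem_ball_zero_iff.2 hx1)]
    rcases eq_or_ne x 0 with rfl | hx0
    · rw [enorm_zero, ENNReal.zero_rpow_of_neg (neg_neg_of_pos hα)]
      exact le_top
    · rw [enorm_rpow_eq_ofReal hx0, ← ofReal_norm, truncatedPower,
        Real.norm_of_nonneg (le_max_right _ _)]
      exact ENNReal.ofReal_le_ofReal (max_le (by linarith) (by positivity))
  · rw [truncatedPower_eq_zero hα.le hx1, enorm_zero]
    exact zero_le

theorem enorm_truncatedPower_sub_le {α κ : ℝ} (hα : 0 < α) (hκ0 : 0 < κ) (hκ : κ ≤ 1)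
    {x y : E} (hxy : ‖x‖ ≤ ‖y‖) :
    ‖truncatedPower α x - truncatedPower α y‖ₑ ≤ ENNReal.ofReal (dist x y ^ κ) *
      (ENNReal.ofReal (max α 1) * (ball 0 1).indicator (fun z => ‖z‖ₑ ^ (-(α + κ))) x) := by
  rcases lt_or_ge ‖x‖ 1 with hx1 | hx1
  · rw [indicator_of_mem (mem_ball_zero_iff.2 hx1)]
    rcases eq_or_ne x y with rfl | hne
    · simp
    rcases eq_or_ne x 0 with rfl | hx0
    · have hd : 0 < dist 0 y ^ κ := Real.rpow_pos_of_pos (dist_pos.2 hne) κ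
      rw [enorm_zero, ENNReal.zero_rpow_of_neg (by linarith), ENNReal.mul_top (by simp),
        ENNReal.mul_top (ENNReal.ofReal_pos.2 hd).ne']
      exact le_top
    have hx : 0 < ‖x‖ := norm_pos_iff.2 hx0
    have hdist : ‖y‖ - ‖x‖ ≤ dist x y := by
      rw [dist_comm, dist_eq_norm]
      exact norm_sub_norm_le y x
    rw [enorm_rpow_eq_ofReal hx0, ← ENNReal.ofReal_mul (by positivity),
      ← ENNReal.ofReal_mul (by positivity), ← ofReal_norm]
    refine ENNReal.ofReal_le_ofReal ?_
    calc ‖truncatedPower α x - truncatedPower α y‖ ≤ |‖x‖ ^ (-α) - 1 - (‖y‖ ^ (-α) - 1)| :=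
          abs_max_sub_max_le_abs _ _ _
      _ = ‖x‖ ^ (-α) - ‖y‖ ^ (-α) := by
          rw [sub_sub_sub_cancel_right, abs_of_nonneg (sub_nonneg.2
            (Real.rpow_le_rpow_of_nonpos hx hxy (neg_nonpos.2 hα.le)))]
      _ ≤ max α 1 * ((‖y‖ - ‖x‖) ^ κ * ‖x‖ ^ (-(α + κ))) :=
          rpow_neg_sub_rpow_neg_le hα hκ0.le hκ hx hxy
      _ ≤ dist x y ^ κ * (max α 1 * ‖x‖ ^ (-(α + κ))) := by
          rw [mul_left_comm]
          have := sub_nonneg.2 hxy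
          gcongr
  · rw [truncatedPower_eq_zero hα.le hx1, truncatedPower_eq_zero hα.le (hx1.trans hxy), sub_zero,
      enorm_zero]
    exact zero_le

theorem isHajlaszGradient_of_norm_le {s : ℝ} {u : E → ℝ} {g : E → ℝ≥0∞}
    (h : ∀ x y, ‖x‖ ≤ ‖y‖ → ‖u x - u y‖ₑ ≤ ENNReal.ofReal (dist x y ^ s) * g x) :
    IsHajlaszGradient s u g := by
  intro x y
  rw [mul_add]
  rcases le_total ‖x‖ ‖y‖ with hxy | hxy
  · exact (h x y hxy).trans le_self_add
  · rw [enorm_sub_rev, dist_comm]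
    exact (h y x hxy).trans le_add_self

theorem isHajlaszGradient_coneFunction :
    IsHajlaszGradient 1 (coneFunction : E → ℝ) ((ball 0 1).indicator 1) := by
  refine isHajlaszGradient_of_norm_le fun x y hxy => ?_
  rcases lt_or_ge ‖x‖ 1 with hx1 | hx1
  · rw [indicator_of_mem (mem_ball_zero_iff.2 hx1), Pi.one_apply, mul_one, Real.rpow_one,
      ← ofReal_norm]
    refine ENNReal.ofReal_le_ofReal ((abs_max_sub_max_le_abs (1 - ‖x‖) (1 - ‖y‖) 0).trans ?_)
    rw [sub_sub_sub_cancel_left, abs_sub_comm, dist_eq_norm]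
    exact abs_norm_sub_norm_le x y
  · rw [coneFunction_eq_zero hx1, coneFunction_eq_zero (hx1.trans hxy), sub_zero, enorm_zero]
    exact zero_le

theorem enorm_coneFunction_le (x : E) :
    ‖coneFunction x‖ₑ ≤ (ball 0 1).indicator (1 : E → ℝ≥0∞) x := by
  rcases lt_or_ge ‖x‖ 1 with hx1 | hx1
  · rw [indicator_of_mem (mem_ball_zero_iff.2 hx1), Pi.one_apply, ← ofReal_norm,
      ENNReal.ofReal_le_one, coneFunction, Real.norm_of_nonneg (le_max_right _ _)]
    exact max_le (by linarith [norm_nonneg x]) zero_le_one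
  · rw [coneFunction_eq_zero hx1, enorm_zero]
    exact zero_le

theorem exists_ball_le_abs_coneFunction_sub [NormedSpace ℝ E] [Nontrivial E] (c : ℝ) :
    ∃ y : E, ‖y‖ ≤ 3 / 2 ∧ ∀ z ∈ ball y (1 / 2), 1 / 4 ≤ |coneFunction z - c| := by
  rcases lt_or_ge |c| (1 / 4) with hc | hc
  · refine ⟨0, by norm_num, fun z hz => ?_⟩
    have hcone : 1 / 2 ≤ coneFunction z :=
      le_max_of_le_left (by linarith [mem_ball_zero_iff.1 hz])
    exact (by linarith [(abs_lt.1 hc).2] : 1 / 4 ≤ coneFunction z - c).trans (le_abs_self _)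
  · obtain ⟨y, hy⟩ := exists_norm_eq E (c := 3 / 2) (by norm_num)
    refine ⟨y, hy.le, fun z hz => ?_⟩
    have hz1 : 1 ≤ ‖z‖ := by
      rw [mem_ball, dist_comm, dist_eq_norm] at hz
      linarith [norm_sub_norm_le y z]
    rwa [coneFunction_eq_zero hz1, zero_sub, abs_neg]

theorem le_bestConst_coneFunction [NormedSpace ℝ E] [Nontrivial E] [MeasurableSpace E]
    [BorelSpace E] {μ : Measure E} [μ.IsAddHaarMeasure] {σ : ℝ} (hσ : 0 ≤ σ) {x : E}
    (hx : x ∈ ball 0 1) :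
    ENNReal.ofReal (1 / 4) ^ σ * μ (ball 0 (1 / 2)) / μ (ball 0 3) ≤
      bestConst σ μ coneFunction 3 x := by
  refine le_iInf fun c => ?_
  obtain ⟨y, hy, hyc⟩ := exists_ball_le_abs_coneFunction_sub (E := E) c
  have hsub : ball y (1 / 2) ⊆ ball x 3 := ball_subset_ball' <| by
    linarith [dist_le_norm_add_norm y x, mem_ball_zero_iff.1 hx]
  rw [setLAverage_eq, Measure.addHaar_ball_center μ x, ← Measure.addHaar_ball_center μ y,
    ← setLIntegral_const]
  refine ENNReal.div_le_div_right ((setLIntegral_mono' measurableSet_ball fun z hz => ?_).trans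
    (lintegral_mono_set hsub)) _
  gcongr
  rw [← ofReal_norm]
  exact ENNReal.ofReal_le_ofReal (hyc z hz)

variable [NormedSpace ℝ E] [FiniteDimensional ℝ E] [Nontrivial E] [MeasurableSpace E]
  [BorelSpace E] {μ : Measure E} [μ.IsAddHaarMeasure] {s σ α β : ℝ} {p q : ℝ≥0∞}

theorem isDoubling_addHaar (μ : Measure E) [μ.IsAddHaarMeasure] :
    IsDoubling μ 2 (Module.finrank ℝ E) where
  one_lt := one_lt_two
  exponent_pos := mod_cast Module.finrank_pos
  ball_pos x r hr := measure_ball_pos _ _ hr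
  ball_lt_top x r _ := measure_ball_lt_top
  doubling x r lam hr hlam := by
    have hl : 0 < lam := one_pos.trans hlam
    rw [Measure.addHaar_ball_of_pos _ _ (mul_pos hl hr), Measure.addHaar_ball_of_pos _ _ hr,
      ← mul_assoc, ← ENNReal.ofReal_mul (by positivity), mul_pow, Real.rpow_natCast]
    gcongr
    linarith [pow_pos hl (Module.finrank ℝ E)]

theorem integrableOn_ball_norm_rpow_neg_iff :
    IntegrableOn (fun x : E => ‖x‖ ^ (-β)) (ball 0 1) μ ↔ β < Module.finrank ℝ E := by
  have hn : 1 ≤ Module.finrank ℝ E := Module.finrank_pos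
  have hpow : EqOn (fun t : ℝ => t ^ (Module.finrank ℝ E - 1) • t ^ (-β))
      (fun t => t ^ ((Module.finrank ℝ E : ℝ) - 1 - β)) (Ioo 0 1) := by
    intro t ht
    simp only [smul_eq_mul]
    rw [← Real.rpow_natCast, ← Real.rpow_add ht.1, Nat.cast_sub hn, Nat.cast_one, ← sub_eq_add_neg]
  rw [integrableOn_fun_norm_addHaar μ (f := fun t : ℝ => t ^ (-β)) (r := 1),
    integrableOn_congr_fun hpow measurableSet_Ioo,
    intervalIntegral.integrableOn_Ioo_rpow_iff one_pos]
  constructor <;> intro h <;> linarith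

theorem ae_ne_zero_addHaar (μ : Measure E) [μ.IsAddHaarMeasure] : ∀ᵐ x ∂μ, x ≠ 0 := by
  simp [ae_iff]

theorem eLpNorm_indicator_ball_enorm_rpow_neg_ne_top (hp : p ≠ 0) (hpt : p ≠ ∞)
    (hβ : β * p.toReal < Module.finrank ℝ E) :
    eLpNorm ((ball 0 1).indicator fun z : E => ‖z‖ₑ ^ (-β)) p μ ≠ ∞ := by
  rw [eLpNorm_indicator_eq_eLpNorm_restrict measurableSet_ball, eLpNorm_eq_lintegral_rpow hp hpt]
  refine ENNReal.rpow_ne_top_of_nonneg (by positivity) (ne_top_of_le_ne_top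
    (integrableOn_ball_norm_rpow_neg_iff.2 hβ).lintegral_lt_top.ne
    (lintegral_mono_ae (ae_restrict_of_ae ?_)))
  filter_upwards [ae_ne_zero_addHaar μ] with x hx
  rw [← ENNReal.rpow_mul, neg_mul, enorm_rpow_eq_ofReal hx]

theorem truncatedPower_mem_besovSpace (hs : 0 < s) (hs1 : s < 1) (hp : p ≠ 0) (hpt : p ≠ ∞)
    (hα : 0 < α) (hαs : α < Module.finrank ℝ E / p.toReal - s) (hq : q ≠ 0) :
    (truncatedPower α : E → ℝ) ∈ (besovSpace s p q μ).carrier := by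
  have hP : 0 < p.toReal := ENNReal.toReal_pos hp hpt
  obtain ⟨κ, hsκ, hκ⟩ := exists_between (lt_min hs1 (lt_sub_comm.1 hαs))
  obtain ⟨hκ1, hκα⟩ := lt_min_iff.1 hκ
  have hακ : (α + κ) * p.toReal < Module.finrank ℝ E := by
    rw [← lt_div_iff₀ hP]
    linarith
  have hα' : α * p.toReal < Module.finrank ℝ E :=
    lt_of_le_of_lt (by gcongr; linarith) hακ
  have hmeas : ∀ β : ℝ, Measurable ((ball (0 : E) 1).indicator fun z => ‖z‖ₑ ^ (-β)) := fun β =>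
    Measurable.indicator (by fun_prop) measurableSet_ball
  refine (isDoubling_addHaar μ).mem_besovSpace_of_isHajlaszGradient hs hsκ hp hpt hq
    (by unfold truncatedPower; fun_prop) ?_ ((hmeas (α + κ)).const_mul (ENNReal.ofReal (max α 1)))
    ?_ (isHajlaszGradient_of_norm_le fun x y =>
      enorm_truncatedPower_sub_le hα (hs.trans hsκ) hκ1.le)
  · refine ne_top_of_le_ne_top (eLpNorm_indicator_ball_enorm_rpow_neg_ne_top hp hpt hα')
      (eLpNorm_mono_enorm fun x => ?_)
    exact enorm_truncatedPower_le hα x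
  · rw [eLpNorm_const_mul_ennreal hp ENNReal.ofReal_ne_top]
    exact ENNReal.mul_ne_top ENNReal.ofReal_ne_top
      (eLpNorm_indicator_ball_enorm_rpow_neg_ne_top hp hpt hακ)

theorem not_memLpLoc_truncatedPower (hσ : 0 < σ) (hα : 0 ≤ α)
    (hασ : Module.finrank ℝ E ≤ α * σ) :
    ¬ MemLpLoc (truncatedPower α : E → ℝ) (ENNReal.ofReal σ) μ := by
  intro h
  have := (isDoubling_addHaar μ).isFiniteMeasure_restrict_ball 0 one_pos
  have hint := ((h 0 1 one_pos).add (memLp_const 1)).integrable_norm_rpow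
    (by simpa using hσ) ENNReal.ofReal_ne_top
  rw [ENNReal.toReal_ofReal hσ.le] at hint
  refine hασ.not_gt (integrableOn_ball_norm_rpow_neg_iff (μ := μ).1 (hint.congr ?_))
  filter_upwards [ae_restrict_of_ae (ae_ne_zero_addHaar μ), ae_restrict_mem measurableSet_ball]
    with x hx0 hx1
  rw [Pi.add_apply, truncatedPower_add_one hα hx0 (mem_ball_zero_iff.1 hx1).le,
    Real.norm_of_nonneg (by positivity), ← Real.rpow_mul (norm_nonneg x), neg_mul]

theorem exists_mem_besovSpace_not_memLpLoc (μ : Measure E) [μ.IsAddHaarMeasure] (hs : 0 < s)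
    (hs1 : s < 1) (hp : p ≠ 0) (hpt : p ≠ ∞) (hσ : 0 < σ)
    (h : Module.finrank ℝ E / σ < Module.finrank ℝ E / p.toReal - s) :
    ∃ u : E → ℝ, (∀ q : ℝ≥0∞, q ≠ 0 → u ∈ (besovSpace s p q μ).carrier) ∧
      ¬ MemLpLoc u (ENNReal.ofReal σ) μ := by
  have hα : 0 < Module.finrank ℝ E / σ := div_pos (isDoubling_addHaar μ).exponent_pos hσ
  exact ⟨truncatedPower (Module.finrank ℝ E / σ),
    fun q hq => truncatedPower_mem_besovSpace hs hs1 hp hpt hα h hq,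
    not_memLpLoc_truncatedPower hσ hα.le (div_mul_cancel₀ _ hσ.ne').ge⟩

theorem coneFunction_mem_besovSpace (hs : 0 < s) (hs1 : s < 1) (hp : p ≠ 0) (hpt : p ≠ ∞)
    (hq : q ≠ 0) : (coneFunction : E → ℝ) ∈ (besovSpace s p q μ).carrier := by
  have hind : eLpNorm ((ball (0 : E) 1).indicator (1 : E → ℝ≥0∞)) p μ ≠ ∞ := by
    rw [Pi.one_def, eLpNorm_indicator_const measurableSet_ball hp hpt]
    exact ENNReal.mul_ne_top (by simp)
      (ENNReal.rpow_ne_top_of_nonneg (by positivity) measure_ball_lt_top.ne)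
  exact (isDoubling_addHaar μ).mem_besovSpace_of_isHajlaszGradient hs hs1 hp hpt hq
    (by unfold coneFunction; fun_prop)
    (ne_top_of_le_ne_top hind (eLpNorm_mono_enorm fun x => enorm_coneFunction_le x))
    (measurable_one.indicator measurableSet_ball) hind isHajlaszGradient_coneFunction

theorem exists_le_functionalS_coneFunction (μ : Measure E) [μ.IsAddHaarMeasure] (s : ℝ)
    (hσ : 0 < σ) : ∃ c ≠ 0, ∀ t : ℝ, 3 ≤ t → ∀ x : E, x ∈ ball 0 1 →
      c ≤ functionalS s s σ μ coneFunction t x := by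
  have hm : ENNReal.ofReal (1 / 4) ^ σ * μ (ball (0 : E) (1 / 2)) / μ (ball (0 : E) 3) ≠ 0 :=
    ENNReal.div_ne_zero.2 ⟨mul_ne_zero (ENNReal.rpow_pos (by simp) (by simp)).ne'
      (measure_ball_pos _ _ (by norm_num)).ne', measure_ball_lt_top.ne⟩
  refine ⟨ENNReal.ofReal (3 ^ (-s)) * (ENNReal.ofReal (1 / 4) ^ σ * μ (ball (0 : E) (1 / 2)) /
    μ (ball (0 : E) 3)) ^ (1 / σ), mul_ne_zero ?_ ?_, fun t ht x hx => ?_⟩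
  · simpa using Real.rpow_pos_of_pos three_pos (-s)
  · exact fun h => hm ((ENNReal.rpow_eq_zero_iff_of_pos (by positivity)).1 h)
  · rw [functionalS, sub_self, Real.rpow_zero, ENNReal.ofReal_one, one_mul]
    refine le_iSup₂_of_le 3 ⟨three_pos, ht⟩ ?_
    gcongr
    exact le_bestConst_coneFunction hσ.le hx

theorem coneFunction_notMem_spaceS (hσ : 0 < σ) (hp : p ≠ 0) (hq : q ≠ 0) (hqt : q ≠ ∞) :
    (coneFunction : E → ℝ) ∉ (spaceS s s σ p q μ).carrier := by
  obtain ⟨c, hc, hcS⟩ := exists_le_functionalS_coneFunction μ s hσ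
  have hnorm : ∀ t, 3 < t → eLpNorm ((ball (0 : E) 1).indicator fun _ => c) p μ ≤
      eLpNorm (functionalS s s σ μ (coneFunction : E → ℝ) t) p μ := fun t ht =>
    eLpNorm_mono_enorm fun x => indicator_le (fun y hy => hcS t ht.le y hy) x
  refine fun hmem => hmem.2.ne (scaleNorm_eq_top_of_le hq hqt three_pos.le ?_ hnorm)
  have hμ : μ (ball (0 : E) 1) ≠ 0 := (measure_ball_pos _ _ one_pos).ne'
  rw [eLpNorm_indicator_const' measurableSet_ball hμ hp]
  exact mul_ne_zero hc (ENNReal.rpow_pos hμ.bot_lt measure_ball_lt_top.ne).ne'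

end NormedSpace

end BesovMMS

theorem theorem1p1 :
    -- (i)-(iv): the characterizations on doubling metric measure spaces
    (∀ (X : Type*) [MetricSpace X] [MeasurableSpace X] [BorelSpace X] (μ : Measure X)
      (C₁ n : ℝ), IsDoubling μ C₁ n →
      ∀ (s : ℝ) (p q : ℝ≥0∞), 0 < s → 0 < p → 0 < q →
        (∀ σ : ℝ, 0 < σ → ENNReal.ofReal σ ≤ p →
          (besovSpace s p q μ).Equivalent (spaceC s σ p q μ)) ∧
        (∀ σ : ℝ, 0 < σ → ENNReal.ofReal σ < pStar n s p →
          (besovSpace s p q μ).Equivalent (spaceI s σ p q μ)) ∧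
        (∀ ε σ : ℝ, 0 ≤ ε → ε < s → 0 < σ → ENNReal.ofReal σ < pStar n s p →
          (besovSpace s p q μ).Equivalent (spaceS s ε σ p q μ)) ∧
        (ENNReal.ofReal (n / (n + s)) < p →
          ∀ σ : ℝ, 0 < σ → ENNReal.ofReal σ < pStar n s p →
            (besovSpace s p q μ).Equivalent (spaceA s σ p q μ))) ∧
    -- (v)-(vii): optimality of the ranges on Euclidean spaces
    (∀ n : ℕ, 1 ≤ n →
      (∀ s p σ : ℝ, 0 < s → s < 1 → 0 < p → p < n / s → 0 < σ →
        pStar n s (ENNReal.ofReal p) < ENNReal.ofReal σ →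
        ∃ u : EuclideanSpace ℝ (Fin n) → ℝ, ∀ q : ℝ≥0∞, 0 < q →
          u ∈ (besovSpace s (ENNReal.ofReal p) q volume).carrier ∧
          ¬ MemLpLoc u (ENNReal.ofReal σ) volume ∧
          u ∉ (spaceA s σ (ENNReal.ofReal p) q volume).carrier ∧
          u ∉ (spaceI s σ (ENNReal.ofReal p) q volume).carrier ∧
          ∀ ε : ℝ, 0 ≤ ε → ε ≤ s →
            u ∉ (spaceS s ε σ (ENNReal.ofReal p) q volume).carrier) ∧
      (∀ s p σ : ℝ, 0 < p → p < σ → 0 < s → s < n / p - n / σ → s < 1 →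
        ∃ u : EuclideanSpace ℝ (Fin n) → ℝ, ∀ q : ℝ≥0∞, 0 < q →
          u ∈ (besovSpace s (ENNReal.ofReal p) q volume).carrier ∧
          u ∉ (spaceC s σ (ENNReal.ofReal p) q volume).carrier) ∧
      (∀ s p : ℝ, 0 < s → s < 1 → 0 < p →
        ∃ u : EuclideanSpace ℝ (Fin n) → ℝ,
          u ∈ (besovSpace s (ENNReal.ofReal p) (ENNReal.ofReal p) volume).carrier ∧
          u ∉ (spaceS s s p (ENNReal.ofReal p) (ENNReal.ofReal p) volume).carrier)) := by
  refine ⟨fun X _ _ _ μ C₁ n hμ s p q hs hp hq => ⟨fun σ hσ h => ?_, fun σ hσ h => ?_,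
    fun ε σ hε hεs hσ h => ?_, fun hps σ hσ h => ?_⟩, fun n hn => ?_⟩
  · exact hμ.besovSpace_equivalent_spaceC hs hq.ne' hσ h
  · exact hμ.besovSpace_equivalent_spaceI hs hp.ne' hq.ne' hσ h
  · exact hμ.besovSpace_equivalent_spaceS hε hεs hp.ne' hq.ne' hσ h
  · exact hμ.besovSpace_equivalent_spaceA hs hps hq.ne' hσ h
  have : Nonempty (Fin n) := ⟨⟨0, hn⟩⟩
  have hsing : ∀ s p σ : ℝ, 0 < s → s < 1 → 0 < p → 0 < σ → n / σ < n / p - s →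
      ∃ u : EuclideanSpace ℝ (Fin n) → ℝ, (∀ q : ℝ≥0∞, q ≠ 0 →
        u ∈ (besovSpace s (ENNReal.ofReal p) q volume).carrier) ∧
        ¬ MemLpLoc u (ENNReal.ofReal σ) volume := fun s p σ hs hs1 hp hσ h =>
    exists_mem_besovSpace_not_memLpLoc volume hs hs1 (by simpa using hp) ENNReal.ofReal_ne_top hσ
      (by rwa [finrank_euclideanSpace_fin, ENNReal.toReal_ofReal hp.le])
  refine ⟨fun s p σ hs hs1 hp _ hσ hσp => ?_, fun s p σ hp hpσ hs hsn hs1 => ?_,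
    fun s p hs hs1 hp => ?_⟩
  · have h := div_lt_div_sub_of_pStar_lt hs (by simpa using hp) hσp
    rw [ENNReal.toReal_ofReal hp.le] at h
    obtain ⟨u, hu, hloc⟩ := hsing s p σ hs hs1 hp hσ h
    exact ⟨u, fun q hq => ⟨hu q hq.ne', hloc, fun h => hloc h.1, fun h => hloc h.1,
      fun _ _ _ h => hloc h.1⟩⟩
  · obtain ⟨u, hu, hloc⟩ := hsing s p σ hs hs1 hp (hp.trans hpσ) (by linarith)
    exact ⟨u, fun q hq => ⟨hu q hq.ne', fun h => hloc h.1⟩⟩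
  · have hp0 : ENNReal.ofReal p ≠ 0 := by simpa using hp
    exact ⟨coneFunction, coneFunction_mem_besovSpace hs hs1 hp0 ENNReal.ofReal_ne_top hp0,
      coneFunction_notMem_spaceS hp hp0 hp0 ENNReal.ofReal_ne_top⟩
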